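/- \textbf{Definitions.} Let $K$ be a triangulation of an $m$-dimensional lattice polytope $P\subset\mathbb{R}^m$, i.e. a finite geometric simplicial complex covering $P$. Call $K$ \emph{regular} if its faces are exactly the projections of the lower faces of the convex hull of the lifted vertices $(v,\lambda(v))$ for some convex function $\lambda:\mathbb{R}^m\to\mathbb{R}$; \emph{dense} if its vertex set is $P\cap\mathbb{Z}^m$; \emph{foldable} if its $1$-skeleton can be properly colored with $m+1$ colors. An \emph{rdf-triangulation} is one that is regular, dense and foldable. A linear ordering of the vertices is \emph{color consecutive} if some proper coloring $c:V\to\{0,\dots,m\}$ is weakly monotone with respect to it. The dual graph of $K$ has the facets as nodes, two facets being adjacent if they differ in one vertex; for an rdf-triangulation it is connected and bipartite. A lattice $m$-simplex is \emph{odd} if its normalized volume $m!\,\mathrm{vol}$ is an odd integer, and the \emph{signature} $\sigma(K)$ is the absolute value of the difference of the numbers of odd facets in the two color classes of the dual graph. For complexes $K,L$ with linearly ordered vertex sets $V_K,V_L$, the \emph{simplicial product} $K\boxtimes L$ consists of all nonempty $F\subseteq V_K\times V_L$ that project to a face of $K$ and to a face of $L$ and on which the product ordering is total. Let $\sigma_{m,n}$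 be the signature of the staircase triangulation of $\Delta_m\times\Delta_n$, i.e. of the simplicial product of the standard simplices $\mathrm{conv}(0,e_1,\dots,e_m)$ and $\mathrm{conv}(0,e_1,\dots,e_n)$ with the orderings $0<e_1<e_2<\cdots$ of their vertices. Let $B_n$ be a dense triangulation of an $n$-dimensional lattice polytope $Q\subset\mathbb{R}^n$, $n\ge 1$, formed of two $n$-simplices sharing a common facet $T$ (for instance, of a lattice bipyramid over an $(n-1)$-simplex $T$). The two vertices not in $T$ are the apices; a vertex ordering of $B_n$ is \emph{symmetric} if it starts with one apex, ends with the other, and has the vertices of $T$ in between. \textbf{Proposition.} Let $K$ be an rdf-triangulation of an $m$-dimensional lattice polytope $P\subset\mathbb{R}^m$ with a color consecutive ordering of its vertices, and let the vertex ordering of $B_n$ be color consecutive or symmetric. Then $K\boxtimes B_n$ is an rdf-triangulation of $P\times Q$, with signature \[ \sigma(K\boxtimes B_n)=\begin{cases}\sigma_{m,n}\,\sigma(K)\,\sigma(B_n) & \text{if the ordering of } B_n \text{ is color consecutive or } m \text{ is even},\\ \sigma_{m,n}\,\sigma(K)\,\omega & \text{if the ordering of } B_n \text{ is symmetric and } m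 \text{ is odd,}\end{cases} \] where $\omega\in\{0,1,2\}$ is the number of odd simplices among the two facets of $B_n$. -/

import Mathlib

open MeasureTheory
open scoped Nat

noncomputable section

namespace RDF

/-! Complexes in `ℝ^ι` are given by their sets of (nonempty) faces, each face being the finite set
of its vertices. The lattice is `ℤ^ι`, and the ambient dimension is `Fintype.card ι`. -/

section Triangulations

variable {ι : Type*}

/-- The vertices of a complex. -/
def vertexSet (K : Set (Finset (ι → ℝ))) : Set (ι → ℝ) :=
  {v | {v} ∈ K}

/-- The facets of a complex, that is, its maximal faces. -/
def facets (K : Set (Finset (ι → ℝ))) : Set (Finset (ι → ℝ)) :=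
  {F | F ∈ K ∧ ∀ G ∈ K, F ⊆ G → F = G}

/-- A point of `ℝ^ι` with integral coordinates. -/
def IsLatticePoint (x : ι → ℝ) : Prop :=
  ∃ z : ι → ℤ, ∀ i, x i = (z i : ℝ)

/-- A lattice polytope is the convex hull of finitely many lattice points. -/
def IsLatticePolytope (P : Set (ι → ℝ)) : Prop :=
  ∃ S : Finset (ι → ℝ), (∀ x ∈ S, IsLatticePoint x) ∧ P = convexHull ℝ (S : Set (ι → ℝ))

/-- `K` is a triangulation of `P`: it is a finite geometric simplicial complex that covers `P`. -/
def IsTriangulation (P : Set (ι → ℝ)) (K : Set (Finset (ι → ℝ))) : Prop :=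
  K.Finite ∧ ∃ S : Geometry.SimplicialComplex ℝ (ι → ℝ), S.faces = K ∧ S.space = P

/-- `K` is induced by a convex lifting function `lam`: the faces of `K` are exactly the nonempty
vertex sets of the faces of the lower convex hull of the points `(v, lam v)`, where `v` runs through
the vertices of `K`. A lower face consists of the lifted points lying on the graph of an affine
function `a` such that no lifted point is below this graph. -/
def IsRegular (K : Set (Finset (ι → ℝ))) : Prop :=
  ∃ lam : (ι → ℝ) → ℝ, ConvexOn ℝ Set.univ lam ∧
    ∀ F : Finset (ι → ℝ), F ∈ K ↔
      F.Nonempty ∧ ∃ a : (ι → ℝ) →ᵃ[ℝ] ℝ,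
        (∀ v ∈ vertexSet K, a v ≤ lam v) ∧
        (F : Set (ι → ℝ)) = {v | v ∈ vertexSet K ∧ a v = lam v}

/-- A triangulation of `P` is dense if its vertices are all the lattice points of `P`. -/
def IsDense (P : Set (ι → ℝ)) (K : Set (Finset (ι → ℝ))) : Prop :=
  vertexSet K = {x | x ∈ P ∧ IsLatticePoint x}

variable [Fintype ι]

/-- A coloring of the 1-skeleton with `m + 1` colors, where `m` is the dimension. -/
def IsColoring (K : Set (Finset (ι → ℝ))) (c : (ι → ℝ) → Fin (Fintype.card ι + 1)) : Prop :=
  ∀ v w, v ≠ w → {v, w} ∈ K → c v ≠ c w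

/-- A full-dimensional complex is foldable if its 1-skeleton is `(m + 1)`-colorable. -/
def IsFoldable (K : Set (Finset (ι → ℝ))) : Prop :=
  ∃ c, IsColoring K c

/-- `K` is a regular, dense and foldable triangulation of the full-dimensional lattice
polytope `P`. -/
structure IsRDFTriangulation (P : Set (ι → ℝ)) (K : Set (Finset (ι → ℝ))) : Prop where
  latticePolytope : IsLatticePolytope P
  fullDim : affineSpan ℝ P = ⊤
  triangulation : IsTriangulation P K
  regular : IsRegular K
  dense : IsDense P K
  foldable : IsFoldable K

/-- The dual graph: its nodes are the facets, and two facets are adjacent if they differ in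
one vertex. -/
def dualGraph (K : Set (Finset (ι → ℝ))) : SimpleGraph (facets K) where
  Adj F G := (F.1 \ G.1).card = 1 ∧ (G.1 \ F.1).card = 1
  symm := ⟨fun _ _ h => ⟨h.2, h.1⟩⟩
  loopless := ⟨fun _ h => by simp at h⟩

/-- The normalized volume `m! · vol` of the simplex with vertex set `F`. -/
def normalizedVolume (F : Finset (ι → ℝ)) : ℝ :=
  (Fintype.card ι)! * (volume (convexHull ℝ (F : Set (ι → ℝ)))).toReal

/-- A simplex is odd if its normalized volume is an odd integer. -/
def IsOddSimplex (F : Finset (ι → ℝ)) : Prop :=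
  ∃ k : ℕ, Odd k ∧ normalizedVolume F = k

/-- The number of odd facets of `K`. -/
def oddFacetCount (K : Set (Finset (ι → ℝ))) : ℕ :=
  {F | F ∈ facets K ∧ IsOddSimplex F}.ncard

/-- The number of odd facets in the color class `b` of a 2-coloring of the dual graph. -/
def oddClassCount (K : Set (Finset (ι → ℝ))) (col : (dualGraph K).Coloring Bool) (b : Bool) : ℕ :=
  {F : facets K | col F = b ∧ IsOddSimplex F.1}.ncard

open Classical in
/-- The signature: the absolute value of the difference of the numbers of odd black and odd white
facets, for a 2-coloring of the dual graph. (The dual graph of a triangulation of a full-dimensional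
polytope is connected, so that a 2-coloring is unique up to exchanging the two colors.) -/
def signature (K : Set (Finset (ι → ℝ))) : ℕ :=
  if h : Nonempty ((dualGraph K).Coloring Bool) then
    ((oddClassCount K h.some true : ℤ) - (oddClassCount K h.some false : ℤ)).natAbs
  else 0

/-- A linear ordering of the vertices of `K`, given by numbering the vertices: `v` precedes `w`
if and only if `O v < O w`. -/
def IsVertexOrdering (K : Set (Finset (ι → ℝ))) (O : (ι → ℝ) → ℕ) : Prop :=
  Set.InjOn O (vertexSet K)

/-- A vertex ordering is color consecutive if some coloring with `m + 1` colors is weakly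
monotone. -/
def IsColorConsecutive (K : Set (Finset (ι → ℝ))) (O : (ι → ℝ) → ℕ) : Prop :=
  ∃ c, IsColoring K c ∧
    ∀ v ∈ vertexSet K, ∀ w ∈ vertexSet K, O v ≤ O w → c v ≤ c w

/-- `B` is a dense triangulation of `Q` formed of two `n`-simplices that share a common facet with
vertex set `T`; the two remaining vertices are the apices `p` and `q`. -/
structure IsBipyramidTriangulation (Q : Set (ι → ℝ)) (B : Set (Finset (ι → ℝ)))
    (T : Finset (ι → ℝ)) (p q : ι → ℝ) : Prop where
  card_base : T.card = Fintype.card ι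
  left_notMem : p ∉ T
  right_notMem : q ∉ T
  apices_ne : p ≠ q
  latticePolytope : IsLatticePolytope Q
  triangulation : IsTriangulation Q B
  dense : IsDense Q B
  faces_eq : B = {F | F.Nonempty ∧ (F ⊆ insert p T ∨ F ⊆ insert q T)}

/-- The symmetric ordering of the two-simplex bipyramid starts with the apex `p`, ends with the
apex `q`, and has the vertices of the base in between. -/
def IsSymmetricOrdering (T : Finset (ι → ℝ)) (p q : ι → ℝ) (O : (ι → ℝ) → ℕ) : Prop :=
  ∀ t ∈ T, O p < O t ∧ O t < O q

end Triangulations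

section Products

variable {ι κ : Type*}

/-- The product `P × Q ⊆ ℝ^ι × ℝ^κ`, where `ℝ^ι × ℝ^κ` is identified with `ℝ^(ι ⊕ κ)`. -/
def polytopeProduct (P : Set (ι → ℝ)) (Q : Set (κ → ℝ)) : Set (ι ⊕ κ → ℝ) :=
  {z | (fun i => z (Sum.inl i)) ∈ P ∧ (fun j => z (Sum.inr j)) ∈ Q}

open Classical in
/-- The simplicial product of `K` and `L` with respect to the vertex orderings `O` and `O'`: the
faces are the sets that project to a face of `K` and to a face of `L` and that are totally ordered
by the product ordering. -/
def simplicialProduct (K : Set (Finset (ι → ℝ))) (O : (ι → ℝ) → ℕ)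
    (L : Set (Finset (κ → ℝ))) (O' : (κ → ℝ) → ℕ) : Set (Finset (ι ⊕ κ → ℝ)) :=
  {F | F.image (fun z i => z (Sum.inl i)) ∈ K ∧ F.image (fun z j => z (Sum.inr j)) ∈ L ∧
    ∀ z ∈ F, ∀ z' ∈ F,
      (O (fun i => z (Sum.inl i)) ≤ O (fun i => z' (Sum.inl i)) ∧
        O' (fun j => z (Sum.inr j)) ≤ O' (fun j => z' (Sum.inr j))) ∨
      (O (fun i => z' (Sum.inl i)) ≤ O (fun i => z (Sum.inl i)) ∧
        O' (fun j => z' (Sum.inr j)) ≤ O' (fun j => z (Sum.inr j)))}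

end Products

/-- The vertices `e_0 = 0, e_1, …, e_m` of the standard `m`-simplex. -/
def stdVertex (m : ℕ) : Fin (m + 1) → (Fin m → ℝ) :=
  Fin.cons 0 (fun i => Pi.single i 1)

/-- The complex of all faces of the standard `m`-simplex `conv (e_0, …, e_m)`. -/
def stdSimplexComplex (m : ℕ) : Set (Finset (Fin m → ℝ)) :=
  {F | F.Nonempty ∧ (F : Set (Fin m → ℝ)) ⊆ Set.range (stdVertex m)}

/-- The ordering `e_0 < e_1 < … < e_m` of the vertices of the standard `m`-simplex: the number of
`e_i` is `i`. -/
def stdOrdering (m : ℕ) (x : Fin m → ℝ) : ℕ :=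
  (Function.invFun (stdVertex m) x : Fin (m + 1))

/-- The staircase triangulation of the product of the standard simplices of dimension
`m` and `n`. Its facets are the maximal chains ("staircases") in the grid of all
pairs `(e_i, e_j)`. -/
def staircaseTriangulation (m n : ℕ) : Set (Finset (Fin m ⊕ Fin n → ℝ)) :=
  simplicialProduct (stdSimplexComplex m) (stdOrdering m) (stdSimplexComplex n) (stdOrdering n)

/-- The signature `σ_{m,n}` of the staircase triangulation. -/
def staircaseSignature (m n : ℕ) : ℕ :=
  signature (staircaseTriangulation m n)

end RDF

end

/-! The geometric half rests on `IsSupportedComplex`: simplices covering a convex set, with heights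
on the vertices such that each face is cut out by an affine function below the heights. Such data
already force simplices to meet in common faces and to be induced by a convex lifting. For the
product the heights are h + h' - ε·O·O' with small ε > 0. The sum h + h' cuts the product into cells
A × B. The term -O·O' refines each cell into chains, because a chain is exactly where some sum f(x)
+ g(y) touches -xy from below (`exists_chain_potential`). A monotone coupling of barycentric weights
shows that the chains cover (`exists_chain_coupling`).

For the signature, list the vertices of every facet by color. Adjacent facets then differ in one row
and have determinants of opposite sign. As the dual graph is connected, the signature is the
absolute value of the sum of the signs of the odd determinants. Suppose instead that vertices carry
integer labels which on each facet F are consecutive, starting at s(F). Their residues mod a + 1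
form a coloring, and listing by label rather than by residue costs s(F) cyclic rotations, that is,
the sign (-1)^(a·s(F)) (`labeling_homDet_neg`).

Along a staircase in F × G the sum of the two labels grows by one per step, so the product facets
are labeled consecutively again, starting at s(G) if K is labeled by its colors. This gives
foldability. The determinant of a staircase simplex is the product of those of F, of G and of the
same staircase over standard simplices (`homDet_pathPoints`), so the signed sum factors, with the
sign (-1)^((m+n)·s(G)) attached to G.

A color consecutive ordering of the bipyramid allows s = 0. In a symmetric ordering the simplex at p
starts at 0 and the one at q at 1. Compared with the sign (-1)^(n·s(G)) that computes the signature
of the bipyramid itself, the simplex at q gains (-1)^m. For even m nothing changes; for odd m the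
opposite orientations are undone and the odd simplices are counted with equal signs, which yields ω.
-/

noncomputable section

namespace RDF

/-! ### Complexes with supporting affine functions; triangulation and regularity -/

section Supported

variable {ι : Type*}

open Filter Topology

/-- A finite complex `K` covering the convex set `P`, together with heights `h` on its vertices such
that every face is cut out by an affine function supporting the heights. -/
structure IsSupportedComplex (P : Set (ι → ℝ)) (K : Set (Finset (ι → ℝ)))
    (h : (ι → ℝ) → ℝ) : Prop where
  finite : K.Finite
  nonempty : ∀ F ∈ K, F.Nonempty
  down_closed : ∀ F ∈ K, ∀ G ⊆ F, G.Nonempty → G ∈ K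
  indep : ∀ F ∈ K, AffineIndependent ℝ ((↑) : F → (ι → ℝ))
  mem_iff : ∀ x, x ∈ P ↔ ∃ F ∈ K, x ∈ convexHull ℝ (F : Set (ι → ℝ))
  convex : Convex ℝ P
  support : ∀ F ∈ K, ∃ a : (ι → ℝ) →ᵃ[ℝ] ℝ,
    (∀ v ∈ vertexSet K, a v ≤ h v) ∧ ∀ v ∈ vertexSet K, (a v = h v ↔ v ∈ F)

theorem affineMap_sum_smul {E : Type*} [AddCommGroup E] [Module ℝ E] {α : Type*} (s : Finset α)
    (g : E →ᵃ[ℝ] ℝ) (w : α → ℝ) (z : α → E) (hw : ∑ i ∈ s, w i = 1) :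
    g (∑ i ∈ s, w i • z i) = ∑ i ∈ s, w i * g (z i) := by
  rw [← Finset.affineCombination_eq_linear_combination s z w hw, Finset.map_affineCombination _ _ _ hw,
    Finset.affineCombination_eq_linear_combination s _ w hw]
  simp

theorem affineMap_le_of_mem_convexHull {E : Type*} [AddCommGroup E] [Module ℝ E] {s : Set E}
    {f g : E →ᵃ[ℝ] ℝ} (hfg : ∀ v ∈ s, f v ≤ g v) {x : E} (hx : x ∈ convexHull ℝ s) :
    f x ≤ g x := by
  have h1 : Convex ℝ {x | f x ≤ g x} := by
    have : {x | f x ≤ g x} = (f - g) ⁻¹' (Set.Iic 0) := by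
      ext; simp
    rw [this]
    exact (convex_Iic 0).affine_preimage (f - g)
  exact convexHull_min (t := {x | f x ≤ g x}) hfg h1 hx

/-- A point of the hull of `F` with positive weights: a nonnegative affine function that
vanishes there vanishes on all of `F`. -/
theorem exists_relativeInterior_point {E : Type*} [AddCommGroup E] [Module ℝ E] {F : Finset E}
    (hF : F.Nonempty) :
    ∃ x ∈ convexHull ℝ (F : Set E), ∀ f g : E →ᵃ[ℝ] ℝ, (∀ v ∈ F, f v ≤ g v) → g x ≤ f x →
      ∀ v ∈ F, f v = g v := by
  have hc : (0 : ℝ) < F.card := by exact_mod_cast hF.card_pos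
  have hs : ∑ _v ∈ F, (F.card : ℝ)⁻¹ = 1 := by
    simp [hc.ne']
  refine ⟨∑ v ∈ F, (F.card : ℝ)⁻¹ • v, ?_, ?_⟩
  · exact (convex_convexHull ℝ _).sum_mem (fun _ _ => by positivity) hs
      (fun v hv => subset_convexHull ℝ _ hv)
  · intro f g hfg hx v hv
    rw [affineMap_sum_smul F g (fun _ => (F.card : ℝ)⁻¹) (fun v => v) hs,
      affineMap_sum_smul F f (fun _ => (F.card : ℝ)⁻¹) (fun v => v) hs] at hx
    have h1 : ∀ v ∈ F, (F.card : ℝ)⁻¹ * f v ≤ (F.card : ℝ)⁻¹ * g v := fun v hv =>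
      mul_le_mul_of_nonneg_left (hfg v hv) (by positivity)
    have h2 := (Finset.sum_eq_sum_iff_of_le h1).1 (le_antisymm (Finset.sum_le_sum h1) hx) v hv
    exact mul_left_cancel₀ (by positivity) h2

/-- Extend the set to an affine basis and interpolate with its coordinate functions. This provides
separating and correcting functions on a single face. -/
theorem exists_affineMap_eq [Finite ι] {F : Finset (ι → ℝ)}
    (hF : AffineIndependent ℝ ((↑) : F → (ι → ℝ))) (f : (ι → ℝ) → ℝ) :
    ∃ a : (ι → ℝ) →ᵃ[ℝ] ℝ, ∀ v ∈ F, a v = f v := by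
  classical
  obtain ⟨t, hFt, ht, htop⟩ := exists_subset_affineIndependent_affineSpan_eq_top
    (k := ℝ) (V := ι → ℝ) (P := ι → ℝ) (s := (F : Set (ι → ℝ))) hF
  let b : AffineBasis t ℝ (ι → ℝ) := ⟨(↑), ht, by simpa using htop⟩
  have : Finite t := b.finite
  have : Fintype t := Fintype.ofFinite t
  refine ⟨∑ i : t, f i • b.coord i, fun v hv => ?_⟩
  have h1 : ∀ i : t, b.coord i v = if (i : ι → ℝ) = v then 1 else 0 := fun i => by
    refine (b.coord_apply i ⟨v, hFt hv⟩).trans ?_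
    simp [Subtype.ext_iff]
  have h2 : (∑ i : t, f i • b.coord i) v = ∑ i : t, f i * b.coord i v := by
    induction (Finset.univ : Finset t) using Finset.induction_on with
    | empty => simp
    | insert i s hi ih => simp [Finset.sum_insert hi, ih]
  rw [h2, Finset.sum_eq_single ⟨v, hFt hv⟩]
  · simp [h1]
  · intro i _ hi
    have : (i : ι → ℝ) ≠ v := fun h => hi (Subtype.ext h)
    simp [h1, this]
  · simp

theorem affineBasis_apply_eq_sum {E : Type*} [AddCommGroup E] [Module ℝ E] {α : Type*} [Fintype α]
    (b : AffineBasis α ℝ E) (g : E →ᵃ[ℝ] ℝ) (x : E) :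
    g x = ∑ i, b.coord i x * g (b i) := by
  conv_lhs => rw [← b.linear_combination_coord_eq_self x]
  exact affineMap_sum_smul _ g _ _ (b.sum_coord_apply_eq_one x)

/-- Every affine function can be perturbed so that it supports a given subface. -/
theorem exists_support_subset [Finite ι] {V : Set (ι → ℝ)} (hV : V.Finite) {h : (ι → ℝ) → ℝ}
    {F G : Finset (ι → ℝ)} (hF : AffineIndependent ℝ ((↑) : F → (ι → ℝ))) (hG : G ⊆ F)
    {a : (ι → ℝ) →ᵃ[ℝ] ℝ} (ha : ∀ v ∈ V, a v ≤ h v) (ha' : ∀ v ∈ V, (a v = h v ↔ v ∈ F)) :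
    ∃ b : (ι → ℝ) →ᵃ[ℝ] ℝ, (∀ v ∈ V, b v ≤ h v) ∧ ∀ v ∈ V, (b v = h v ↔ v ∈ G) := by
  classical
  -- Subtracting a small multiple of `l` keeps contact on `G`, loses it on the rest of `F`, and
  -- preserves the finitely many strict inequalities off `F`.
  obtain ⟨l, hl⟩ := exists_affineMap_eq hF (fun v => if v ∈ G then 0 else 1)
  have key : ∀ᶠ ε in 𝓝[>] (0 : ℝ), ∀ v ∈ V, v ∉ F → a v - ε * l v < h v := by
    rw [eventually_all_finite hV]
    intro v hv
    by_cases hvF : v ∈ F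
    · simp [hvF]
    have h1 : a v < h v := lt_of_le_of_ne (ha v hv) (fun e => hvF ((ha' v hv).1 e))
    have h2 : Tendsto (fun ε : ℝ => a v - ε * l v) (𝓝[>] 0) (𝓝 (a v - 0 * l v)) := by
      apply Tendsto.mono_left _ nhdsWithin_le_nhds
      exact Continuous.tendsto (by fun_prop) 0
    rw [zero_mul, sub_zero] at h2
    filter_upwards [h2.eventually_lt_const h1] with ε hε _ using hε
  obtain ⟨ε, hε, hpos⟩ := (key.and self_mem_nhdsWithin).exists
  have hpos : 0 < ε := hpos
  have hval : ∀ v ∈ V, (v ∈ G → a v - ε * l v = h v) ∧ (v ∉ G → a v - ε * l v < h v) := by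
    intro v hv
    by_cases hvF : v ∈ F
    · have := (ha' v hv).2 hvF
      by_cases hvG : v ∈ G
      · simp [hvG, hl v hvF, this]
      · simp [hvG, hl v hvF, this, hpos]
    · have hvG : v ∉ G := fun h => hvF (hG h)
      exact ⟨fun h => absurd h hvG, fun _ => hε v hv hvF⟩
  refine ⟨a - ε • l, fun v hv => ?_, fun v hv => ?_⟩
  · have := hval v hv
    by_cases hvG : v ∈ G
    · simpa using (this.1 hvG).le
    · simpa using (this.2 hvG).le
  · have := hval v hv
    by_cases hvG : v ∈ G
    · simpa [hvG] using this.1 hvG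
    · simpa [hvG] using (this.2 hvG).ne

namespace IsSupportedComplex

variable {P : Set (ι → ℝ)} {K : Set (Finset (ι → ℝ))} {h : (ι → ℝ) → ℝ}

theorem mem_vertexSet (hK : IsSupportedComplex P K h) {F : Finset (ι → ℝ)} (hF : F ∈ K)
    {v : ι → ℝ} (hv : v ∈ F) : v ∈ vertexSet K :=
  hK.down_closed F hF {v} (by simpa using hv) (by simp)

theorem finite_vertexSet (hK : IsSupportedComplex P K h) : (vertexSet K).Finite := by
  have : (⋃ F ∈ K, (F : Set (ι → ℝ))).Finite := hK.finite.biUnion (fun F _ => F.finite_toSet)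
  refine this.subset fun v hv => ?_
  simp only [Set.mem_iUnion]
  exact ⟨{v}, hv, by simp⟩

theorem subset (hK : IsSupportedComplex P K h) {F : Finset (ι → ℝ)} (hF : F ∈ K) :
    (F : Set (ι → ℝ)) ⊆ P := fun v hv =>
  (hK.mem_iff v).2 ⟨F, hF, subset_convexHull ℝ _ hv⟩

/-- The support function of a face dominates all others over the hull of that face. -/
theorem le_of_mem_convexHull (hK : IsSupportedComplex P K h) {F : Finset (ι → ℝ)} (hF : F ∈ K)
    {a b : (ι → ℝ) →ᵃ[ℝ] ℝ} (ha : ∀ v ∈ vertexSet K, (a v = h v ↔ v ∈ F))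
    (hb : ∀ v ∈ vertexSet K, b v ≤ h v) {x : ι → ℝ} (hx : x ∈ convexHull ℝ (F : Set (ι → ℝ))) :
    b x ≤ a x := by
  refine affineMap_le_of_mem_convexHull (fun v hv => ?_) hx
  have hv' := hK.mem_vertexSet hF hv
  rw [(ha v hv').2 hv]
  exact hb v hv'

/-- Hypothesis `hxF` says that `x` behaves like a relative interior point of `F`. The support
function of `G` dominates `a` at `x`, yet is at most `a` on `F`; so the two agree on `F`, and the
contact set of the former is `G`. -/
theorem subset_of_support (hK : IsSupportedComplex P K h) {F G : Finset (ι → ℝ)}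
    (hF : (F : Set (ι → ℝ)) ⊆ vertexSet K) (hG : G ∈ K)
    {a : (ι → ℝ) →ᵃ[ℝ] ℝ} (ha : ∀ v ∈ vertexSet K, a v ≤ h v) (ha' : ∀ v ∈ F, a v = h v)
    {x : ι → ℝ} (hxF : ∀ f g : (ι → ℝ) →ᵃ[ℝ] ℝ, (∀ v ∈ F, f v ≤ g v) → g x ≤ f x →
      ∀ v ∈ F, f v = g v) (hx : x ∈ convexHull ℝ (G : Set (ι → ℝ))) : F ⊆ G := by
  obtain ⟨b, hb, hb'⟩ := hK.support G hG
  intro v hv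
  rw [← hb' v (hF hv), ← ha' v hv]
  refine hxF b a (fun w hw => ?_) (hK.le_of_mem_convexHull hG hb' ha hx) v hv
  rw [ha' w hw]
  exact hb w (hF hw)

/-- The support functions of both faces dominate each other at a common point, so they agree there.
Expanding the point over `G`, equality must hold term by term, which kills every weight at a vertex
outside `F`. -/
theorem convexHull_inter_subset (hK : IsSupportedComplex P K h) {F G : Finset (ι → ℝ)}
    (hF : F ∈ K) (hG : G ∈ K) :
    convexHull ℝ (F : Set (ι → ℝ)) ∩ convexHull ℝ (G : Set (ι → ℝ)) ⊆
      convexHull ℝ ((F : Set (ι → ℝ)) ∩ G) := by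
  classical
  rintro x ⟨hxF, hxG⟩
  obtain ⟨a, ha, ha'⟩ := hK.support F hF
  obtain ⟨b, hb, hb'⟩ := hK.support G hG
  have hab : a x = b x := le_antisymm (hK.le_of_mem_convexHull hG hb' ha hxG)
    (hK.le_of_mem_convexHull hF ha' hb hxF)
  obtain ⟨w, hw0, hw1, hwx⟩ := Finset.mem_convexHull'.1 hxG
  rw [← hwx, affineMap_sum_smul G a w (fun v => v) hw1, affineMap_sum_smul G b w (fun v => v) hw1]
    at hab
  have h1 : ∀ v ∈ G, w v * a v ≤ w v * b v := fun v hv => by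
    have hv' := hK.mem_vertexSet hG hv
    rw [(hb' v hv').2 hv]
    exact mul_le_mul_of_nonneg_left (ha v hv') (hw0 v hv)
  have h2 := (Finset.sum_eq_sum_iff_of_le h1).1 hab
  have h3 : ∀ v ∈ G, v ∉ F → w v = 0 := fun v hv hvF => by
    by_contra hne
    have hv' := hK.mem_vertexSet hG hv
    have := mul_left_cancel₀ hne (h2 v hv)
    rw [(hb' v hv').2 hv] at this
    exact hvF ((ha' v hv').1 this)
  rw [← hwx, ← Finset.sum_subset (s₁ := G.filter (· ∈ F)) (Finset.filter_subset _ _)]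
  · refine (convex_convexHull ℝ _).sum_mem (fun v hv => hw0 v (Finset.mem_filter.1 hv).1) ?_ ?_
    · rw [← hw1]
      refine Finset.sum_subset (Finset.filter_subset _ _) fun v hv hv' => h3 v hv ?_
      simpa [hv] using hv'
    · intro v hv
      rw [Finset.mem_filter] at hv
      exact subset_convexHull ℝ _ ⟨hv.2, hv.1⟩
  · intro v hv hv'
    rw [h3 v hv (by simpa [hv] using hv'), zero_smul]

theorem isTriangulation (hK : IsSupportedComplex P K h) : IsTriangulation P K := by
  refine ⟨hK.finite, ⟨⟨K, ?_⟩, fun {s} hs => hK.indep s hs, fun hs ht =>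
    hK.convexHull_inter_subset hs ht⟩, rfl, ?_⟩
  · intro F hF
    exact ⟨hK.nonempty F hF, fun G hG hG' => hK.down_closed F hF G hG hG'⟩
  · ext x
    rw [Geometry.SimplicialComplex.mem_space_iff, hK.mem_iff]

/-- The upper envelope of all support functions is convex and equals `h` at each vertex `v`, where
the support function of `{v}` attains it. A lower face of this lifting lies in some face of `K`,
found by covering one of its relative interior points. The empty complex is separate because the
supremum needs an index. -/
theorem isRegular (hK : IsSupportedComplex P K h) : IsRegular K := by
  rcases K.eq_empty_or_nonempty with rfl | hne
  · refine ⟨fun _ => 0, convexOn_const 0 convex_univ, fun F => ⟨fun h => h.elim, ?_⟩⟩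
    rintro ⟨hF, a, -, ha⟩
    obtain ⟨v, hv⟩ := hF
    have : v ∈ (F : Set (ι → ℝ)) := hv
    rw [ha] at this
    exact this.1
  choose a ha ha' using hK.support
  have : Finite K := hK.finite
  have : Nonempty K := hne.to_subtype
  let lam : (ι → ℝ) → ℝ := fun x => ⨆ F : K, a F.1 F.2 x
  have hbdd : ∀ x, BddAbove (Set.range fun F : K => a F.1 F.2 x) := fun x =>
    Set.finite_range _ |>.bddAbove
  have hle : ∀ (F : K) x, a F.1 F.2 x ≤ lam x := fun F x => le_ciSup (hbdd x) F
  have hlam : ∀ v ∈ vertexSet K, lam v = h v := fun v hv => by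
    apply le_antisymm
    · exact ciSup_le fun F => ha F.1 F.2 v hv
    · rw [← (ha' {v} hv v hv).2 (by simp)]
      exact hle ⟨{v}, hv⟩ v
  refine ⟨lam, ⟨convex_univ, ?_⟩, fun F => ⟨fun hF => ⟨hK.nonempty F hF, a F hF, ?_, ?_⟩, ?_⟩⟩
  · intro x _ y _ s t hs ht hst
    refine ciSup_le fun F => ?_
    rw [Convex.combo_affine_apply hst]
    simp only [smul_eq_mul]
    gcongr
    exacts [hle F x, hle F y]
  · intro v hv
    rw [hlam v hv]
    exact ha F hF v hv
  · ext v
    constructor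
    · intro hv
      have hv' := hK.mem_vertexSet hF hv
      exact ⟨hv', by rw [hlam v hv']; exact (ha' F hF v hv').2 hv⟩
    · rintro ⟨hv, hv'⟩
      rw [hlam v hv] at hv'
      exact (ha' F hF v hv).1 hv'
  · rintro ⟨hF, b, hb, hb'⟩
    obtain ⟨x, hx, hx'⟩ := exists_relativeInterior_point hF
    have hFV : ∀ v ∈ F, v ∈ vertexSet K ∧ b v = lam v := fun v hv => by
      have : v ∈ (F : Set (ι → ℝ)) := hv
      rwa [hb'] at this
    have hxP : x ∈ P := convexHull_min (fun v hv => hK.subset (hFV v hv).1 (by simp)) hK.convex hx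
    obtain ⟨G, hG, hxG⟩ := (hK.mem_iff x).1 hxP
    refine hK.down_closed G hG F ?_ hF
    refine hK.subset_of_support (fun v hv => (hFV v hv).1) hG (a := b) ?_ ?_ hx' hxG
    · intro v hv
      rw [← hlam v hv]
      exact hb v hv
    · intro v hv
      rw [(hFV v hv).2, hlam v (hFV v hv).1]

end IsSupportedComplex

/-- The converse passage: the lifting function itself serves as the heights. -/
theorem exists_isSupportedComplex {P : Set (ι → ℝ)} {K : Set (Finset (ι → ℝ))}
    (hP : Convex ℝ P) (hT : IsTriangulation P K) (hR : IsRegular K) :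
    ∃ h, IsSupportedComplex P K h := by
  obtain ⟨hfin, S, rfl, rfl⟩ := hT
  obtain ⟨lam, -, hlam⟩ := hR
  refine ⟨lam, hfin, fun F hF => S.nonempty_of_mem_faces hF, fun F hF G hG hG' =>
    S.down_closed hF hG hG', fun F hF => S.indep hF, fun x =>
    Geometry.SimplicialComplex.mem_space_iff, hP, fun F hF => ?_⟩
  obtain ⟨-, a, ha, ha'⟩ := (hlam F).1 hF
  refine ⟨a, ha, fun v hv => ?_⟩
  rw [← Finset.mem_coe, ha']
  exact ⟨fun h => ⟨hv, h⟩, fun h => h.2⟩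

end Supported

/-! ### Facets are full-dimensional and the dual graph is connected -/

section Connectivity

variable {ι : Type*}

open Filter Topology

namespace IsSupportedComplex

variable {P : Set (ι → ℝ)} {K : Set (Finset (ι → ℝ))} {h : (ι → ℝ) → ℝ}

theorem finite_facets (hK : IsSupportedComplex P K h) : (facets K).Finite :=
  hK.finite.subset fun _ hF => hF.1

theorem exists_facet_superset (hK : IsSupportedComplex P K h) {F : Finset (ι → ℝ)} (hF : F ∈ K) :
    ∃ G ∈ facets K, F ⊆ G := by
  obtain ⟨G, hFG, hG⟩ := hK.finite.exists_le_maximal hF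
  exact ⟨G, ⟨hG.prop, fun H hH hGH => le_antisymm hGH (hG.le_of_ge hH hGH)⟩, hFG⟩

/-- Starting in the relative interior of a face and walking to a point of `P`, one first moves
inside a face containing the given one. -/
theorem exists_frequently_mem (hK : IsSupportedComplex P K h) [Finite ι] {R : Finset (ι → ℝ)}
    (hR : R ∈ K) {y : ι → ℝ} (hy : y ∈ P) :
    ∃ x ∈ convexHull ℝ (R : Set (ι → ℝ)), ∃ F ∈ K, R ⊆ F ∧
      ∃ᶠ t in 𝓝[>] (0 : ℝ), AffineMap.lineMap x y t ∈ convexHull ℝ (F : Set (ι → ℝ)) := by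
  obtain ⟨x, hx, hx'⟩ := exists_relativeInterior_point (hK.nonempty R hR)
  have hxP : x ∈ P := (hK.mem_iff x).2 ⟨R, hR, hx⟩
  -- Finitely many faces cover the segment, so one of them is met at arbitrarily small parameters.
  -- Its closed hull then contains `x`, hence the face contains `R`.
  have key : ∃ F ∈ K,
      ∃ᶠ t in 𝓝[>] (0 : ℝ), AffineMap.lineMap x y t ∈ convexHull ℝ (F : Set (ι → ℝ)) := by
    by_contra! hcon
    have h1 : ∀ᶠ t in 𝓝[>] (0 : ℝ), ∀ F ∈ K,
        ¬ AffineMap.lineMap x y t ∈ convexHull ℝ (F : Set (ι → ℝ)) :=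
      (eventually_all_finite hK.finite).2 fun F hF => by simpa using hcon F hF
    have h2 : ∀ᶠ t in 𝓝[>] (0 : ℝ), t ∈ Set.Ioo (0 : ℝ) 1 := Ioo_mem_nhdsGT one_pos
    obtain ⟨t, ht, ht'⟩ := (h1.and h2).exists
    have : AffineMap.lineMap x y t ∈ P := hK.convex.lineMap_mem hxP hy ⟨ht'.1.le, ht'.2.le⟩
    obtain ⟨F, hF, hF'⟩ := (hK.mem_iff _).1 this
    exact ht F hF hF'
  obtain ⟨F, hF, hfr⟩ := key
  refine ⟨x, hx, F, hF, ?_, hfr⟩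
  have hcl : IsClosed (convexHull ℝ (F : Set (ι → ℝ))) := F.finite_toSet.isClosed_convexHull ℝ
  have hlim : Tendsto (fun t : ℝ => AffineMap.lineMap x y t) (𝓝[>] 0) (𝓝 x) := by
    have : Tendsto (fun t : ℝ => AffineMap.lineMap x y t) (𝓝 0)
        (𝓝 (AffineMap.lineMap x y (0 : ℝ))) := AffineMap.lineMap_continuous.tendsto 0
    rw [AffineMap.lineMap_apply_zero] at this
    exact this.mono_left nhdsWithin_le_nhds
  have hxF := hcl.mem_of_frequently_of_tendsto hfr hlim
  obtain ⟨a, ha, ha'⟩ := hK.support R hR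
  exact hK.subset_of_support (fun v hv => hK.mem_vertexSet hR hv) hF ha
    (fun v hv => (ha' v (hK.mem_vertexSet hR hv)).2 hv) hx' hxF

variable [Fintype ι]

/-- By maximality, a walk from the relative interior of a facet towards any `y` in `P` is in that
facet at arbitrarily small positive times. The line through the start and such a point puts `y` into
the affine span. -/
theorem affineSpan_facet (hK : IsSupportedComplex P K h) (hP : affineSpan ℝ P = ⊤)
    {F : Finset (ι → ℝ)} (hF : F ∈ facets K) : affineSpan ℝ (F : Set (ι → ℝ)) = ⊤ := by
  rw [eq_top_iff, ← hP, affineSpan_le]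
  intro y hy
  obtain ⟨x, hx, G, hG, hFG, hfr⟩ := hK.exists_frequently_mem hF.1 hy
  obtain rfl := hF.2 G hG hFG
  obtain ⟨t, ht, ht0⟩ := (hfr.and_eventually self_mem_nhdsWithin).exists
  have ht0 : 0 < t := ht0
  have h1 := convexHull_subset_affineSpan (𝕜 := ℝ) _ hx
  have h2 := convexHull_subset_affineSpan (𝕜 := ℝ) _ ht
  have h3 := AffineMap.lineMap_mem t⁻¹ h1 h2
  rwa [AffineMap.lineMap_lineMap_right, inv_mul_cancel₀ ht0.ne', AffineMap.lineMap_apply_one] at h3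

theorem card_facet (hK : IsSupportedComplex P K h) (hP : affineSpan ℝ P = ⊤)
    {F : Finset (ι → ℝ)} (hF : F ∈ facets K) : F.card = Fintype.card ι + 1 := by
  have h1 := (hK.indep F hF.1).affineSpan_eq_top_iff_card_eq_finrank_add_one.1
    (by simpa using hK.affineSpan_facet hP hF)
  simpa using h1

theorem card_le (hK : IsSupportedComplex P K h) {F : Finset (ι → ℝ)} (hF : F ∈ K) :
    F.card ≤ Fintype.card ι + 1 := by
  have h1 := (hK.indep F hF).card_le_finrank_succ
  have h2 := Submodule.finrank_le (vectorSpan ℝ (Set.range ((↑) : F → (ι → ℝ))))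
  simp at h1 h2
  omega

theorem mem_facets_of_card (hK : IsSupportedComplex P K h) {F : Finset (ι → ℝ)} (hF : F ∈ K)
    (hc : F.card = Fintype.card ι + 1) : F ∈ facets K :=
  ⟨hF, fun _ hG hFG => Finset.eq_of_subset_of_card_le hFG (hc ▸ hK.card_le hG)⟩

/-- The barycentric coordinates of a facet. -/
def facetBasis (hK : IsSupportedComplex P K h) (hP : affineSpan ℝ P = ⊤)
    {F : Finset (ι → ℝ)} (hF : F ∈ facets K) : AffineBasis F ℝ (ι → ℝ) :=
  ⟨(↑), hK.indep F hF.1, by simpa using hK.affineSpan_facet hP hF⟩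

/-- From a facet not containing `y` one can step to an adjacent facet whose support function is
larger at `y`. -/
theorem exists_adj_lt (hK : IsSupportedComplex P K h) (hP : affineSpan ℝ P = ⊤)
    {a : Finset (ι → ℝ) → (ι → ℝ) →ᵃ[ℝ] ℝ} (ha : ∀ F ∈ K, ∀ v ∈ vertexSet K, a F v ≤ h v)
    (ha' : ∀ F ∈ K, ∀ v ∈ vertexSet K, (a F v = h v ↔ v ∈ F)) (F : facets K) {y : ι → ℝ}
    (hy : y ∈ P) (hyF : y ∉ convexHull ℝ (F.1 : Set (ι → ℝ))) :
    ∃ G : facets K, (dualGraph K).Adj F G ∧ a F.1 y < a G.1 y := by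
  classical
  obtain ⟨F, hF⟩ := F
  dsimp only at hyF ⊢
  let b := hK.facetBasis hP hF
  have hbr : Set.range b = F := Subtype.range_coe
  have hmem : ∀ z, z ∈ convexHull ℝ (F : Set (ι → ℝ)) ↔ ∀ i, 0 ≤ b.coord i z := fun z => by
    rw [← hbr, b.convexHull_eq_nonneg_coord]; rfl
  rw [hmem] at hyF
  push Not at hyF
  obtain ⟨⟨v, hv⟩, hneg⟩ := hyF
  have hRne : (F.erase v).Nonempty := by
    by_contra hemp
    rw [Finset.not_nonempty_iff_eq_empty] at hemp
    have hs := b.sum_coord_apply_eq_one y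
    have : ∀ i : F, i = ⟨v, hv⟩ := fun i => by
      by_contra hne
      have : i.1 ∈ F.erase v := Finset.mem_erase.2 ⟨fun e => hne (Subtype.ext e), i.2⟩
      simp [hemp] at this
    rw [Finset.sum_eq_single ⟨v, hv⟩ (fun i _ hi => absurd (this i) hi) (by simp)] at hs
    linarith
  have hRK : F.erase v ∈ K := hK.down_closed F hF.1 _ (Finset.erase_subset _ _) hRne
  obtain ⟨x, hx, G', hG', hRG', hfr⟩ := hK.exists_frequently_mem hRK hy
  obtain ⟨t, ht, ht0⟩ := (hfr.and_eventually self_mem_nhdsWithin).exists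
  have ht0 : 0 < t := ht0
  obtain ⟨G, hG, hGG⟩ := hK.exists_facet_superset hG'
  have hRG : F.erase v ⊆ G := hRG'.trans hGG
  have hbv : ∀ i : F, b i = i.1 := fun i => rfl
  have hx0 : b.coord ⟨v, hv⟩ x = 0 := by
    have h1 : ∀ w ∈ ((F.erase v : Finset _) : Set (ι → ℝ)), b.coord ⟨v, hv⟩ w = 0 := by
      intro w hw
      have hw' := Finset.mem_erase.1 (Finset.mem_coe.1 hw)
      have := b.coord_apply_ne (i := ⟨v, hv⟩) (j := ⟨w, hw'.2⟩)
        (fun e => hw'.1 (congrArg Subtype.val e).symm)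
      simpa [hbv] using this
    have hle := affineMap_le_of_mem_convexHull (f := b.coord ⟨v, hv⟩) (g := AffineMap.const ℝ _ 0)
      (fun w hw => (h1 w hw).le) hx
    have hge := affineMap_le_of_mem_convexHull (g := b.coord ⟨v, hv⟩) (f := AffineMap.const ℝ _ 0)
      (fun w hw => (h1 w hw).ge) hx
    exact le_antisymm (by simpa using hle) (by simpa using hge)
  -- The barycentric coordinate at `v` vanishes at `x` and is negative at `y`, so it is negative as
  -- soon as the walk has left `x`.
  have hvG : v ∉ G := by
    intro hvG
    have hFG : F ⊆ G := by
      intro w hw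
      by_cases hwv : w = v
      · exact hwv ▸ hvG
      · exact hRG (Finset.mem_erase.2 ⟨hwv, hw⟩)
    obtain rfl := hF.2 G hG.1 hFG
    have h1 := (hmem _).1 (convexHull_mono (Finset.coe_subset.2 hGG) ht) ⟨v, hv⟩
    rw [AffineMap.apply_lineMap, hx0, AffineMap.lineMap_apply] at h1
    simp at h1
    nlinarith
  have hFG : F \ G = {v} := by
    ext w
    simp only [Finset.mem_sdiff, Finset.mem_singleton]
    constructor
    · rintro ⟨hw, hwG⟩
      by_contra hne
      exact hwG (hRG (Finset.mem_erase.2 ⟨hne, hw⟩))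
    · rintro rfl
      exact ⟨hv, hvG⟩
  have hcard : (G \ F).card = 1 := by
    have h1 := Finset.card_sdiff_add_card_inter F G
    have h2 := Finset.card_sdiff_add_card_inter G F
    rw [Finset.inter_comm] at h2
    rw [hK.card_facet hP hF, hFG] at h1
    rw [hK.card_facet hP hG] at h2
    simp at h1
    omega
  refine ⟨⟨G, hG⟩, ⟨by simp [hFG], hcard⟩, ?_⟩
  -- The difference of support functions vanishes on the common vertices and is negative at `v`;
  -- since `y` has a negative coordinate at `v`, it is positive at `y`.
  have hexp := affineBasis_apply_eq_sum b (a G - a F) y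
  rw [Finset.sum_eq_single ⟨v, hv⟩] at hexp
  · have hvV := hK.mem_vertexSet hF.1 hv
    have h1 : a G v < a F v := by
      rw [(ha' F hF.1 v hvV).2 hv]
      exact lt_of_le_of_ne (ha G hG.1 v hvV) fun e => hvG ((ha' G hG.1 v hvV).1 e)
    rw [hbv] at hexp
    simp at hexp
    nlinarith
  · intro w _ hw
    have hwV := hK.mem_vertexSet hF.1 w.2
    have hwG : w.1 ∈ G := hRG (Finset.mem_erase.2 ⟨fun e => hw (Subtype.ext e), w.2⟩)
    simp [hbv, (ha' F hF.1 w hwV).2 w.2, (ha' G hG.1 w hwV).2 hwG]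
  · simp

/-- The dual graph of a regular triangulation of a full-dimensional convex set is connected. -/
theorem preconnected_dualGraph (hK : IsSupportedComplex P K h) (hP : affineSpan ℝ P = ⊤) :
    (dualGraph K).Preconnected := by
  intro F G
  have hex : ∀ F : Finset (ι → ℝ), ∃ a : (ι → ℝ) →ᵃ[ℝ] ℝ, F ∈ K →
      (∀ v ∈ vertexSet K, a v ≤ h v) ∧ ∀ v ∈ vertexSet K, (a v = h v ↔ v ∈ F) := fun F => by
    by_cases hF : F ∈ K
    · obtain ⟨a, ha⟩ := hK.support F hF
      exact ⟨a, fun _ => ha⟩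
    · exact ⟨0, fun h => absurd h hF⟩
  choose a haa using hex
  have ha : ∀ F ∈ K, ∀ v ∈ vertexSet K, a F v ≤ h v := fun F hF => (haa F hF).1
  have ha' : ∀ F ∈ K, ∀ v ∈ vertexSet K, (a F v = h v ↔ v ∈ F) := fun F hF => (haa F hF).2
  obtain ⟨y, hyG, hy⟩ := exists_relativeInterior_point (hK.nonempty G.1 G.2.1)
  have hyP : y ∈ P := (hK.mem_iff y).2 ⟨G.1, G.2.1, hyG⟩
  have : Finite (facets K) := hK.finite_facets
  -- Among the facets reachable from `F`, maximize the support function at a relative interior point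
  -- of `G`. The maximizer must contain that point, for otherwise one could step higher; hence it is
  -- `G`.
  obtain ⟨H, hH, hmax⟩ := (Set.toFinite {H | (dualGraph K).Reachable F H}).exists_maximalFor
    (fun H : facets K => a H.1 y) _ ⟨F, SimpleGraph.Reachable.refl F⟩
  have hyH : y ∈ convexHull ℝ (H.1 : Set (ι → ℝ)) := by
    by_contra hyH
    obtain ⟨H', hadj, hlt⟩ := hK.exists_adj_lt hP ha ha' H hyP hyH
    have := hmax (SimpleGraph.Reachable.trans hH hadj.reachable) hlt.le
    exact absurd hlt (not_lt.2 this)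
  have hGH : G.1 ⊆ H.1 := hK.subset_of_support (fun v hv => hK.mem_vertexSet G.2.1 hv) H.2.1
    (ha G.1 G.2.1) (fun v hv => (ha' G.1 G.2.1 v (hK.mem_vertexSet G.2.1 hv)).2 hv) hy hyH
  have : G = H := Subtype.ext (G.2.2 H.1 H.2.1 hGH)
  exact this ▸ hH

end IsSupportedComplex

end Connectivity

/-! ### Homogeneous determinants and normalized volume -/

section Determinants

variable {ι : Type*} {a : ℕ}

/-- The determinant of the homogeneous coordinates of `a + 1` points in an `a`-dimensional space. -/
def homMatrix (e : Fin a ≃ ι) (v : Fin (a + 1) → ι → ℝ) : Matrix (Fin (a + 1)) (Fin (a + 1)) ℝ :=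
  Matrix.of fun i => Fin.cons 1 fun k => v i (e k)

def homDet (e : Fin a ≃ ι) (v : Fin (a + 1) → ι → ℝ) : ℝ :=
  (homMatrix e v).det

@[simp] theorem homMatrix_zero (e : Fin a ≃ ι) (v : Fin (a + 1) → ι → ℝ) (i : Fin (a + 1)) :
    homMatrix e v i 0 = 1 := rfl

@[simp] theorem homMatrix_succ (e : Fin a ≃ ι) (v : Fin (a + 1) → ι → ℝ) (i : Fin (a + 1))
    (k : Fin a) : homMatrix e v i k.succ = v i (e k) := rfl

/-- The points `0, e_1, …, e_a`. -/
def stdPoint [DecidableEq ι] (e : Fin a ≃ ι) : Fin (a + 1) → ι → ℝ :=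
  Fin.cons 0 fun k => Pi.single (e k) 1

/-- Cramer's rule: as the weights sum to 1, the new row is the same combination of the old rows, and
only the `k`-th term survives. This turns the sign of a barycentric coordinate into a relative
orientation. -/
theorem homDet_update (e : Fin a ≃ ι) (v : Fin (a + 1) → ι → ℝ) (k : Fin (a + 1))
    (c : Fin (a + 1) → ℝ) (hc : ∑ i, c i = 1) :
    homDet e (Function.update v k (∑ i, c i • v i)) = c k * homDet e v := by
  have : homMatrix e (Function.update v k (∑ i, c i • v i)) =
      (homMatrix e v).updateRow k (∑ i, c i • homMatrix e v i) := by
    ext i j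
    rw [Matrix.updateRow_apply]
    rcases eq_or_ne i k with rfl | hik
    · simp only [if_true]
      refine Fin.cases ?_ (fun l => ?_) j
      · simp [hc]
      · simp [Finset.sum_apply]
    · simp only [hik, if_false]
      refine Fin.cases rfl (fun l => ?_) j
      simp [hik]
  rw [homDet, this, Matrix.det_updateRow_sum, smul_eq_mul, homDet]

theorem homDet_comp_perm (e : Fin a ≃ ι) (v : Fin (a + 1) → ι → ℝ)
    (σ : Equiv.Perm (Fin (a + 1))) :
    homDet e (v ∘ σ) = ((Equiv.Perm.sign σ : ℤ) : ℝ) * homDet e v := by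
  rw [homDet, homDet, ← Matrix.det_permute]
  rfl

theorem homDet_ne_zero (e : Fin a ≃ ι) {v : Fin (a + 1) → ι → ℝ} (hv : AffineIndependent ℝ v) :
    homDet e v ≠ 0 := by
  intro h
  obtain ⟨c, hc, hc'⟩ := Matrix.exists_vecMul_eq_zero_iff.2 h
  apply hc
  have h0 : ∑ i, c i = 0 := by
    have := congrFun hc' 0
    simpa [Matrix.vecMul, dotProduct] using this
  have h1 : ∑ i, c i • v i = 0 := by
    ext j
    have := congrFun hc' (e.symm j).succ
    simpa [Matrix.vecMul, dotProduct] using this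
  ext i
  exact (affineIndependent_iff.1 hv) Finset.univ c h0 h1 i (Finset.mem_univ i)

theorem exists_int_homDet (e : Fin a ≃ ι) {v : Fin (a + 1) → ι → ℝ}
    (hv : ∀ i, IsLatticePoint (v i)) : ∃ z : ℤ, homDet e v = z := by
  choose z hz using hv
  refine ⟨(Matrix.of fun i : Fin (a + 1) =>
    (Fin.cons 1 fun k => z i (e k) : Fin (a + 1) → ℤ)).det, ?_⟩
  refine Eq.trans ?_ (RingHom.map_det (Int.castRingHom ℝ) _).symm
  rw [homDet]
  congr 1
  ext i j
  refine Fin.cases ?_ (fun l => ?_) j <;> simp [hz]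

theorem homDet_stdPoint [DecidableEq ι] (e : Fin a ≃ ι) : homDet e (stdPoint e) = 1 := by
  rw [homDet, Matrix.det_of_isLowerTriangular]
  · refine Finset.prod_eq_one fun i _ => ?_
    refine Fin.cases ?_ (fun k => ?_) i <;> simp [stdPoint]
  · intro i j hij
    have hij : i < j := hij
    obtain ⟨l, rfl⟩ := Fin.exists_succ_eq.2 (Fin.ne_zero_of_lt hij)
    revert hij
    refine Fin.cases ?_ (fun k hij => ?_) i
    · simp [stdPoint]
    · have : l ≠ k := fun e => by simp [e] at hij
      simp [stdPoint, this]

variable [Fintype ι]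

/-- In homogeneous coordinates an affine map is right multiplication by a block triangular matrix
with diagonal blocks 1 and the transpose of `L`. -/
theorem homDet_affine (e : Fin a ≃ ι) (v : Fin (a + 1) → ι → ℝ) (L : (ι → ℝ) →ₗ[ℝ] (ι → ℝ))
    (t : ι → ℝ) : homDet e (fun i => L (v i) + t) = LinearMap.det L * homDet e v := by
  classical
  let N : Matrix (Fin (a + 1)) (Fin (a + 1)) ℝ := Matrix.of (Fin.cons (Fin.cons 1 fun k => t (e k))
    fun l => Fin.cons 0 fun k => LinearMap.toMatrix' L (e k) (e l))
  have hN : homMatrix e (fun i => L (v i) + t) = homMatrix e v * N := by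
    ext i j
    rw [Matrix.mul_apply, Fin.sum_univ_succ]
    refine Fin.cases ?_ (fun k => ?_) j
    · simp [N]
    · have : L (v i) (e k) = ∑ l, v i (e l) * LinearMap.toMatrix' L (e k) (e l) := by
        conv_lhs => rw [← LinearMap.toMatrix'_mulVec]
        rw [Matrix.mulVec, dotProduct, ← e.sum_comp]
        exact Finset.sum_congr rfl fun _ _ => mul_comm _ _
      simp [N, this, add_comm]
  have hdet : N.det = LinearMap.det L := by
    rw [Matrix.det_succ_column_zero, Fin.sum_univ_succ]
    have : N.submatrix (Fin.succAbove 0) Fin.succ =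
        ((LinearMap.toMatrix' L).transpose).submatrix e e := by
      ext i j; simp [N]
    rw [this, Matrix.det_submatrix_equiv_self, Matrix.det_transpose, LinearMap.det_toMatrix']
    simp [N]
  rw [homDet, hN, Matrix.det_mul, hdet, mul_comm, homDet]

/-- The affine map taking the standard points to given points. -/
theorem exists_affine_stdPoint [DecidableEq ι] (e : Fin a ≃ ι) (v : Fin (a + 1) → ι → ℝ) :
    ∃ L : (ι → ℝ) →ₗ[ℝ] (ι → ℝ), (∀ i, L (stdPoint e i) + v 0 = v i) ∧
      LinearMap.det L = homDet e v := by
  let L : (ι → ℝ) →ₗ[ℝ] (ι → ℝ) :=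
    (Pi.basisFun ℝ ι).constr ℝ fun i => v (e.symm i).succ - v 0
  have hL : ∀ i, L (stdPoint e i) + v 0 = v i := by
    refine Fin.cases ?_ fun k => ?_
    · simp [stdPoint]
    · have : L (Pi.single (e k) 1) = v k.succ - v 0 := by
        simp [L]
      simp [stdPoint, this]
  refine ⟨L, hL, ?_⟩
  have := homDet_affine e (stdPoint e) L (v 0)
  simp_rw [hL] at this
  rw [this, homDet_stdPoint, mul_one]

theorem convexHull_range_stdPoint [DecidableEq ι] (e : Fin a ≃ ι) :
    convexHull ℝ (Set.range (stdPoint e)) = {x | (∀ i, 0 ≤ x i) ∧ ∑ i, x i ≤ 1} := by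
  apply Set.Subset.antisymm
  · refine convexHull_min ?_ ?_
    · rintro _ ⟨i, rfl⟩
      refine Fin.cases ?_ (fun k => ?_) i
      · simp [stdPoint]
      · refine ⟨fun j => ?_, ?_⟩
        · simp only [stdPoint, Fin.cons_succ, Pi.single_apply]
          split_ifs <;> norm_num
        · simp [stdPoint]
    · rintro x ⟨hx, hx'⟩ y ⟨hy, hy'⟩ s t hs ht hst
      refine ⟨fun i => ?_, ?_⟩
      · have := hx i; have := hy i
        simp only [Pi.add_apply, Pi.smul_apply, smul_eq_mul]
        positivity
      · simp only [Pi.add_apply, Pi.smul_apply, smul_eq_mul, Finset.sum_add_distrib,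
          ← Finset.mul_sum]
        nlinarith
  · rintro x ⟨hx, hx'⟩
    have hsum : ∑ k, x (e k) = ∑ i, x i := e.sum_comp x
    have hxe : x = ∑ i, (Fin.cons (1 - ∑ i, x i) (fun k => x (e k)) : Fin (a + 1) → ℝ) i •
        stdPoint e i := by
      ext j
      simp only [Fin.sum_univ_succ, stdPoint, Fin.cons_zero, Fin.cons_succ,
        Finset.sum_apply, Pi.smul_apply, Pi.single_apply, smul_eq_mul, mul_ite, mul_one, mul_zero]
      rw [Finset.sum_eq_single (e.symm j)]
      · simp
      · intro k _ hk
        rw [if_neg]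
        rintro rfl
        simp at hk
      · simp
    rw [hxe]
    refine (convex_convexHull ℝ _).sum_mem (fun i _ => ?_) ?_
      (fun i _ => subset_convexHull ℝ _ ⟨i, rfl⟩)
    · refine Fin.cases ?_ (fun k => ?_) i
      · simpa using hx'
      · simpa using hx _
    · simp [Fin.sum_univ_succ, hsum]

/-- Slice by the first coordinate: the slice at `t` is the corner of size `r - t` one dimension
lower, which is why the size varies in the induction. -/
theorem volume_corner_fin (n : ℕ) : ∀ r : ℝ, 0 ≤ r →
    volume {x : Fin n → ℝ | (∀ i, 0 ≤ x i) ∧ ∑ i, x i ≤ r} = ENNReal.ofReal (r ^ n / n !) := by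
  induction n with
  | zero =>
    intro r hr
    have : {x : Fin 0 → ℝ | (∀ i, 0 ≤ x i) ∧ ∑ i, x i ≤ r} = Set.univ := by
      ext; simp [hr]
    rw [this]
    simp [volume_pi]
  | succ n ih =>
    intro r hr
    have hmp := volume_preserving_piFinSuccAbove (fun _ : Fin (n + 1) => ℝ) 0
    let S : Set (ℝ × (Fin n → ℝ)) := {p | 0 ≤ p.1 ∧ (∀ i, 0 ≤ p.2 i) ∧ p.1 + ∑ i, p.2 i ≤ r}
    have hS : MeasurableSet S := by
      apply IsClosed.measurableSet
      have h1 : IsClosed {p : ℝ × (Fin n → ℝ) | 0 ≤ p.1} := isClosed_le (by fun_prop) (by fun_prop)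
      have h2 : IsClosed {p : ℝ × (Fin n → ℝ) | p.1 + ∑ i, p.2 i ≤ r} :=
        isClosed_le (by fun_prop) (by fun_prop)
      refine IsClosed.inter h1 (IsClosed.inter ?_ h2)
      have : {p : ℝ × (Fin n → ℝ) | ∀ i, 0 ≤ p.2 i} = ⋂ i, {p | 0 ≤ p.2 i} := by ext; simp
      change IsClosed {p : ℝ × (Fin n → ℝ) | ∀ i, 0 ≤ p.2 i}
      rw [this]
      exact isClosed_iInter fun i => isClosed_le (by fun_prop) (by fun_prop)
    have hpre : {x : Fin (n + 1) → ℝ | (∀ i, 0 ≤ x i) ∧ ∑ i, x i ≤ r} =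
        (MeasurableEquiv.piFinSuccAbove (fun _ : Fin (n + 1) => ℝ) 0) ⁻¹' S := by
      ext x
      simp [S, MeasurableEquiv.piFinSuccAbove, Fin.forall_fin_succ, Fin.sum_univ_succ,
        Fin.tail, and_assoc]
    rw [hpre, hmp.measure_preimage hS.nullMeasurableSet, Measure.volume_eq_prod,
      Measure.prod_apply hS]
    have hsec : ∀ t : ℝ, volume (Prod.mk t ⁻¹' S) =
        (Set.Icc 0 r).indicator (fun t => ENNReal.ofReal ((r - t) ^ n / n !)) t := by
      intro t
      by_cases ht : t ∈ Set.Icc 0 r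
      · rw [Set.indicator_of_mem ht, ← ih (r - t) (by linarith [ht.2])]
        congr 1
        ext y
        simp [S, ht.1, le_sub_iff_add_le']
      · rw [Set.indicator_of_notMem ht]
        have : Prod.mk t ⁻¹' S = ∅ := by
          ext y
          simp only [S, Set.mem_preimage, Set.mem_ofPred_eq, Set.mem_empty_iff_false, iff_false]
          rintro ⟨h1, h2, h3⟩
          exact ht ⟨h1, by linarith [Finset.sum_nonneg fun i (_ : i ∈ Finset.univ) => h2 i]⟩
        rw [this, measure_empty]
    simp_rw [hsec]
    rw [lintegral_indicator measurableSet_Icc, ← ofReal_integral_eq_lintegral_ofReal]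
    · congr 1
      rw [integral_Icc_eq_integral_Ioc, ← intervalIntegral.integral_of_le hr,
        intervalIntegral.integral_div, intervalIntegral.integral_comp_sub_left (fun x => x ^ n)]
      simp only [sub_self, sub_zero, integral_pow, Nat.factorial_succ, Nat.cast_mul]
      push_cast
      rw [div_div]
      simp
    · exact (Continuous.continuousOn (by fun_prop)).integrableOn_Icc
    · refine (ae_restrict_iff' measurableSet_Icc).2 (Filter.Eventually.of_forall fun t ht => ?_)
      have : 0 ≤ r - t := by linarith [ht.2]
      simp only [Pi.zero_apply]
      positivity

theorem volume_corner (e : Fin a ≃ ι) :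
    volume {x : ι → ℝ | (∀ i, 0 ≤ x i) ∧ ∑ i, x i ≤ 1} = ENNReal.ofReal (1 / a !) := by
  have hmp := volume_measurePreserving_piCongrLeft (fun _ : ι => ℝ) e
  rw [← hmp.measure_preimage_equiv]
  have h := volume_corner_fin a 1 zero_le_one
  rw [one_pow] at h
  rw [← h]
  congr 1
  ext x
  have h1 : ∀ k, MeasurableEquiv.piCongrLeft (fun _ : ι => ℝ) e x (e k) = x k := fun k => by
    simp [MeasurableEquiv.coe_piCongrLeft]
  simp only [Set.mem_preimage, Set.mem_ofPred_eq]
  rw [← e.sum_comp, ← e.forall_congr_right]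
  simp only [h1]

/-- The simplex is an affine image of the corner simplex, of volume 1/a!, under a map whose linear
part has determinant `homDet e v`. -/
theorem normalizedVolume_eq_abs_homDet (e : Fin a ≃ ι) {F : Finset (ι → ℝ)}
    {v : Fin (a + 1) → ι → ℝ} (hv : Set.range v = F) :
    normalizedVolume F = |homDet e v| := by
  classical
  have hcard : Fintype.card ι = a := by simpa using (Fintype.card_congr e).symm
  obtain ⟨L, hL, hdet⟩ := exists_affine_stdPoint e v
  have himg : convexHull ℝ (F : Set (ι → ℝ)) =
      (fun x => x + v 0) '' (L '' convexHull ℝ (Set.range (stdPoint e))) := by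
    rw [L.image_convexHull, ← hv]
    have := (AffineEquiv.vaddConst ℝ (v 0)).toAffineMap.image_convexHull
      (L '' Set.range (stdPoint e))
    refine Eq.trans ?_ this.symm
    congr 1
    rw [← Set.range_comp, ← Set.range_comp]
    congr 1
    ext i : 1
    simp [← hL i]
  rw [normalizedVolume, himg, Set.image_add_right, measure_preimage_add_right,
    Measure.addHaar_image_linearMap, convexHull_range_stdPoint, volume_corner e, hdet,
    ENNReal.toReal_mul, ENNReal.toReal_ofReal (abs_nonneg _),
    ENNReal.toReal_ofReal (by positivity), hcard]
  have : (a ! : ℝ) ≠ 0 := by positivity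
  field_simp

end Determinants

/-! ### The signature as a signed sum of odd determinants -/

section Signature

open Classical in
/-- The sign of an odd integer, and zero for all other reals. -/
def oddSign (x : ℝ) : ℤ :=
  if ∃ k : ℤ, Odd k ∧ x = k then (SignType.sign x : ℤ) else 0

theorem oddSign_intCast (k : ℤ) : oddSign k = if Odd k then k.sign else 0 := by
  have h1 : (∃ l : ℤ, Odd l ∧ (k : ℝ) = l) ↔ Odd k :=
    ⟨fun ⟨l, hl, h⟩ => by rw [Int.cast_inj] at h; exact h ▸ hl, fun h => ⟨k, h, rfl⟩⟩
  rw [oddSign, h1, Int.sign_eq_sign]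
  congr 2
  rcases lt_trichotomy k 0 with h | rfl | h
  · rw [sign_neg h, sign_neg (by exact_mod_cast h)]
  · simp
  · rw [sign_pos h, sign_pos (by exact_mod_cast h)]

/-- A product of integers is odd exactly if both factors are. Integrality matters: 3/2 and 2 have
`oddSign` zero, but their product 3 does not. -/
theorem oddSign_mul {x y : ℝ} (hx : ∃ k : ℤ, x = k) (hy : ∃ k : ℤ, y = k) :
    oddSign (x * y) = oddSign x * oddSign y := by
  obtain ⟨k, rfl⟩ := hx
  obtain ⟨l, rfl⟩ := hy
  rw [← Int.cast_mul, oddSign_intCast, oddSign_intCast, oddSign_intCast]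
  by_cases hk : Odd k <;> by_cases hl : Odd l <;> simp [hk, hl, Int.sign_mul, Int.odd_mul]

theorem oddSign_one : oddSign 1 = 1 := by
  simpa using oddSign_intCast 1

theorem oddSign_neg (x : ℝ) : oddSign (-x) = -oddSign x := by
  have h1 : (∃ k : ℤ, Odd k ∧ -x = k) ↔ ∃ k : ℤ, Odd k ∧ x = k :=
    ⟨fun ⟨k, hk, h⟩ => ⟨-k, hk.neg, by push_cast; linarith⟩,
      fun ⟨k, hk, h⟩ => ⟨-k, hk.neg, by push_cast; linarith⟩⟩
  unfold oddSign
  rw [h1, Left.sign_neg]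
  split_ifs <;> simp

theorem oddSign_neg_one_pow_mul (n : ℕ) (x : ℝ) : oddSign ((-1) ^ n * x) = (-1) ^ n * oddSign x := by
  induction n with
  | zero => simp
  | succ n ih => rw [pow_succ', mul_assoc, neg_one_mul, oddSign_neg, ih]; ring

variable {ι : Type*} [Fintype ι]

theorem isOddSimplex_iff {F : Finset (ι → ℝ)} {x : ℝ} (hx : normalizedVolume F = |x|) :
    IsOddSimplex F ↔ ∃ k : ℤ, Odd k ∧ x = k := by
  rw [IsOddSimplex, hx]
  constructor
  · rintro ⟨k, hk, h⟩
    have hk' : Odd (k : ℤ) := by exact_mod_cast hk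
    rcases abs_choice x with h' | h' <;> rw [h'] at h
    · exact ⟨k, hk', by simpa using h⟩
    · exact ⟨-k, hk'.neg, by push_cast; linarith⟩
  · rintro ⟨k, hk, rfl⟩
    refine ⟨k.natAbs, Int.natAbs_odd.2 hk, ?_⟩
    rw [Nat.cast_natAbs, Int.cast_abs]

/-- Both colorings flip along each edge, so their difference is constant on connected components.
Hence the signature does not depend on the chosen coloring. -/
theorem coloring_xor_eq {α : Type*} {G : SimpleGraph α} (c c' : G.Coloring Bool) {x y : α}
    (h : G.Reachable x y) : (c x ^^ c' x) = (c y ^^ c' y) := by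
  obtain ⟨p⟩ := h
  induction p with
  | nil => rfl
  | cons hadj _ ih =>
    rw [← ih]
    have h1 := c.valid hadj
    have h2 := c'.valid hadj
    revert h1 h2
    generalize c _ = a1, c' _ = a2, c _ = a3, c' _ = a4
    revert a1 a2 a3 a4
    decide

namespace IsSupportedComplex

variable {P : Set (ι → ℝ)} {K : Set (Finset (ι → ℝ))} {h : (ι → ℝ) → ℝ}

/-- The signature computed from oriented volumes that change sign between adjacent facets. -/
theorem signature_eq (hK : IsSupportedComplex P K h) (hP : affineSpan ℝ P = ⊤)
    {D : Finset (ι → ℝ) → ℝ} (hD : ∀ F ∈ facets K, normalizedVolume F = |D F|)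
    (hadj : ∀ F G : facets K, (dualGraph K).Adj F G → D F.1 * D G.1 < 0) :
    signature K = (∑ F ∈ hK.finite_facets.toFinset, oddSign (D F)).natAbs := by
  classical
  have : Fintype (facets K) := hK.finite_facets.fintype
  -- The sign of `D` is itself a 2-coloring; by connectivity the coloring chosen in `signature`
  -- differs from it by at most a global swap, which `natAbs` absorbs.
  let col : (dualGraph K).Coloring Bool := SimpleGraph.Coloring.mk (fun F => decide (0 < D F.1))
    fun {F G} hFG => by
      have := hadj F G hFG
      rcases mul_neg_iff.1 this with h | h
      · simp [h.1, h.2.le]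
      · simp [h.1.le, h.2]
  have hne : Nonempty ((dualGraph K).Coloring Bool) := ⟨col⟩
  rw [signature, dif_pos hne]
  generalize hne.some = c
  have hcount : ∀ b, (oddClassCount K c b : ℤ) =
      ∑ F : facets K, if c F = b ∧ IsOddSimplex F.1 then 1 else 0 := fun b => by
    rw [oddClassCount, Set.ncard_eq_toFinset_card', Finset.sum_boole]
    congr 2
    ext; simp
  have hsum : ∑ F ∈ hK.finite_facets.toFinset, oddSign (D F) = ∑ F : facets K, oddSign (D F.1) :=
    Finset.sum_subtype _ (by simp) _
  rw [hcount, hcount, hsum, ← Finset.sum_sub_distrib]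
  have hval : ∀ F : facets K, oddSign (D F.1) =
      if IsOddSimplex F.1 then (if col F then 1 else -1) else 0 := fun F => by
    rw [oddSign, isOddSimplex_iff (hD F.1 F.2)]
    by_cases hodd : ∃ k : ℤ, Odd k ∧ D F.1 = k
    · rw [if_pos hodd, if_pos hodd]
      have hcol : col F = decide (0 < D F.1) := rfl
      obtain ⟨k, hk, hk'⟩ := hodd
      have hk0 : D F.1 ≠ 0 := by
        rw [hk']; rintro h0
        rw [Int.cast_eq_zero] at h0
        simp [h0] at hk
      rcases lt_or_gt_of_ne hk0 with h | h
      · simp [hcol, h.not_gt, sign_neg h]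
      · simp [hcol, h, sign_pos h]
    · rw [if_neg hodd, if_neg hodd]
  have hcc : ∃ s : Bool, ∀ F : facets K, c F = (col F ^^ s) := by
    rcases isEmpty_or_nonempty (facets K) with hemp | ⟨⟨F0⟩⟩
    · exact ⟨true, fun F => hemp.elim F⟩
    · refine ⟨c F0 ^^ col F0, fun F => ?_⟩
      rw [coloring_xor_eq c col (hK.preconnected_dualGraph hP F0 F)]
      cases c F <;> cases col F <;> rfl
  obtain ⟨s, hs⟩ := hcc
  cases s
  · congr 1
    refine Finset.sum_congr rfl fun F _ => ?_
    rw [hval, hs]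
    by_cases hodd : IsOddSimplex F.1 <;> cases col F <;> simp [hodd]
  · rw [← Int.natAbs_neg, ← Finset.sum_neg_distrib]
    congr 1
    refine Finset.sum_congr rfl fun F _ => ?_
    rw [hval, hs]
    by_cases hodd : IsOddSimplex F.1 <;> cases col F <;> simp [hodd]

variable {a : ℕ}

theorem injective_of_range (hK : IsSupportedComplex P K h) (hP : affineSpan ℝ P = ⊤)
    (e : Fin a ≃ ι) {F : Finset (ι → ℝ)} (hF : F ∈ facets K) {v : Fin (a + 1) → ι → ℝ}
    (hv : Set.range v = F) : Function.Injective v := by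
  classical
  have h1 : Finset.univ.image v = F := by
    rw [← Finset.coe_inj, ← hv]; simp
  have h2 : (Finset.univ.image v).card = Finset.card (Finset.univ : Finset (Fin (a + 1))) := by
    rw [h1, hK.card_facet hP hF, ← Fintype.card_congr e]; simp
  exact fun x y hxy => Finset.card_image_iff.1 h2 (by simp) (by simp) hxy

theorem affineIndependent_of_range (hK : IsSupportedComplex P K h) (hP : affineSpan ℝ P = ⊤)
    (e : Fin a ≃ ι) {F : Finset (ι → ℝ)} (hF : F ∈ facets K) {v : Fin (a + 1) → ι → ℝ}
    (hv : Set.range v = F) : AffineIndependent ℝ v := by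
  have hmem : ∀ i, v i ∈ F := fun i => by
    have : v i ∈ Set.range v := ⟨i, rfl⟩
    rwa [hv] at this
  have := (hK.indep F hF.1).comp_embedding ⟨fun i => (⟨v i, hmem i⟩ : F), fun i j hij =>
    hK.injective_of_range hP e hF hv (congrArg Subtype.val hij)⟩
  exact this

/-- Two adjacent facets have opposite orientations. -/
theorem homDet_mul_homDet_neg (hK : IsSupportedComplex P K h) (hP : affineSpan ℝ P = ⊤)
    (e : Fin a ≃ ι) {F G : Finset (ι → ℝ)} (hF : F ∈ facets K) (hG : G ∈ facets K)
    {v w : Fin (a + 1) → ι → ℝ} (hv : Set.range v = F) (hw : Set.range w = G) (k : Fin (a + 1))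
    (hvw : ∀ i, i ≠ k → v i = w i) (hvG : v k ∉ G) (hwF : w k ∉ F) :
    homDet e v * homDet e w < 0 := by
  have hmemF : ∀ i, v i ∈ F := fun i => by
    have : v i ∈ Set.range v := ⟨i, rfl⟩
    rwa [hv] at this
  have hmemG : ∀ i, w i ∈ G := fun i => by
    have : w i ∈ Set.range w := ⟨i, rfl⟩
    rwa [hw] at this
  have hind := hK.affineIndependent_of_range hP e hF hv
  let b : AffineBasis (Fin (a + 1)) ℝ (ι → ℝ) :=
    ⟨v, hind, by rw [hv]; exact hK.affineSpan_facet hP hF⟩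
  have hb : ∀ i, b i = v i := fun i => rfl
  obtain ⟨f, hf, hf'⟩ := hK.support F hF.1
  obtain ⟨g, hg, hg'⟩ := hK.support G hG.1
  have hfF : ∀ i, f (v i) = h (v i) := fun i =>
    (hf' _ (hK.mem_vertexSet hF.1 (hmemF i))).2 (hmemF i)
  have hgG : ∀ i, g (w i) = h (w i) := fun i =>
    (hg' _ (hK.mem_vertexSet hG.1 (hmemG i))).2 (hmemG i)
  have hfw : f (w k) < h (w k) := by
    have hV := hK.mem_vertexSet hG.1 (hmemG k)
    exact lt_of_le_of_ne (hf _ hV) fun e => hwF ((hf' _ hV).1 e)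
  have hgv : g (v k) < h (v k) := by
    have hV := hK.mem_vertexSet hF.1 (hmemF k)
    exact lt_of_le_of_ne (hg _ hV) fun e => hvG ((hg' _ hV).1 e)
  -- `g - f` vanishes on the shared vertices, is negative at `v k` and positive at `w k`. So `w k`
  -- has a negative coordinate at `v k`, and by `homDet_update` that coordinate is the ratio of the
  -- determinants.
  have hexp := affineBasis_apply_eq_sum b (g - f) (w k)
  rw [Finset.sum_eq_single k] at hexp
  · have hneg : b.coord k (w k) < 0 := by
      rw [hb] at hexp
      simp [hgG, hfF] at hexp
      nlinarith
    have hupd : w = Function.update v k (∑ i, b.coord i (w k) • v i) := by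
      have : ∑ i, b.coord i (w k) • v i = w k := b.linear_combination_coord_eq_self (w k)
      rw [this]
      ext i : 1
      rcases eq_or_ne i k with rfl | hik
      · simp
      · simp [hik, hvw i hik]
    have hdet := homDet_update e v k (fun i => b.coord i (w k)) (b.sum_coord_apply_eq_one _)
    rw [← hupd] at hdet
    rw [hdet]
    have := homDet_ne_zero e hind
    nlinarith [sq_pos_of_ne_zero this]
  · intro i _ hi
    rw [hb]
    have : g (v i) = f (v i) := by rw [hfF, hvw i hi, hgG]
    simp [this]
  · simp

end IsSupportedComplex

/-- Enumerations of the facets along which the vertex labels `d` are consecutive integers, starting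
with `s F` on the facet `F`. -/
structure IsLabeling (K : Set (Finset (ι → ℝ))) {a : ℕ} (d : (ι → ℝ) → ℕ)
    (w : Finset (ι → ℝ) → Fin (a + 1) → ι → ℝ) (s : Finset (ι → ℝ) → ℕ) : Prop where
  range_eq : ∀ F ∈ facets K, Set.range (w F) = F
  label : ∀ F ∈ facets K, ∀ j, d (w F j) = s F + j

theorem val_finRotate_pow (a s : ℕ) (j : Fin (a + 1)) :
    (((finRotate (a + 1)) ^ s) j : ℕ) = (s + j) % (a + 1) := by
  induction s with
  | zero => simp [Nat.mod_eq_of_lt j.2]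
  | succ s ih =>
    rw [pow_succ', Equiv.Perm.mul_apply, finRotate_apply, Fin.val_add, ih]
    rw [Fin.val_one', Nat.mod_add_mod, Nat.add_mod_mod, Nat.add_right_comm]

namespace IsSupportedComplex

variable {P : Set (ι → ℝ)} {K : Set (Finset (ι → ℝ))} {h : (ι → ℝ) → ℝ} {a : ℕ}

/-- Each facet contains every residue of `d` mod `a + 1` once. Rotating its list by `s F` places
moves each vertex to the position of its residue; one rotation of `a + 1` entries has sign (-1)^a,
whence the exponent. A vertex shared by two facets then occupies the same position in both, so
adjacent facets differ in one position and `homDet_mul_homDet_neg` applies. -/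
theorem labeling_homDet_neg (hK : IsSupportedComplex P K h) (hP : affineSpan ℝ P = ⊤)
    (e : Fin a ≃ ι) {d : (ι → ℝ) → ℕ} {w : Finset (ι → ℝ) → Fin (a + 1) → ι → ℝ}
    {s : Finset (ι → ℝ) → ℕ} (hw : IsLabeling K d w s) {F G : facets K}
    (hadj : (dualGraph K).Adj F G) :
    ((-1) ^ (a * s F) * homDet e (w F)) * ((-1) ^ (a * s G) * homDet e (w G)) < 0 := by
  classical
  let u : Finset (ι → ℝ) → Fin (a + 1) → ι → ℝ := fun F => w F ∘ ⇑((finRotate (a + 1)) ^ s F)⁻¹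
  have hdet : ∀ F, homDet e (u F) = (-1) ^ (a * s F) * homDet e (w F) := fun F => by
    rw [homDet_comp_perm, Equiv.Perm.sign_inv, map_pow, sign_finRotate, ← pow_mul]
    simp
  have hrange : ∀ F ∈ facets K, Set.range (u F) = F := fun F hF => by
    rw [← hw.range_eq F hF]
    exact EquivLike.range_comp _ _
  have hcol : ∀ F ∈ facets K, ∀ j, d (u F j) % (a + 1) = j := fun F hF j => by
    have h1 := hw.label F hF (((finRotate (a + 1)) ^ s F)⁻¹ j)
    change d (w F _) % (a + 1) = j
    rw [h1, ← val_finRotate_pow]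
    exact congrArg Fin.val (Equiv.apply_symm_apply _ j)
  rw [← hdet, ← hdet]
  have hmem : ∀ F ∈ facets K, ∀ i, u F i ∈ F := fun F hF i => by
    have : u F i ∈ Set.range (u F) := ⟨i, rfl⟩
    rwa [hrange F hF] at this
  have hmem' : ∀ F ∈ facets K, ∀ x ∈ F, ∃ i, u F i = x := fun F hF x hx => by
    have : x ∈ (F : Set (ι → ℝ)) := hx
    rwa [← hrange F hF] at this
  have hcommon : ∀ H ∈ facets K, ∀ H' ∈ facets K, ∀ i, u H i ∈ H' → u H i = u H' i := by
    intro H hH H' hH' i hi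
    obtain ⟨j, hj⟩ := hmem' H' hH' _ hi
    have h1 := hcol H hH i
    rw [← hj, hcol H' hH' j] at h1
    rw [← hj, Fin.ext h1]
  obtain ⟨x, hx⟩ := Finset.card_eq_one.1 hadj.1
  have hxF : x ∈ F.1 ∧ x ∉ G.1 := by
    rw [← Finset.mem_sdiff, hx]; simp
  obtain ⟨k, rfl⟩ := hmem' F.1 F.2 x hxF.1
  have hoff : ∀ i, i ≠ k → u F.1 i = u G.1 i := fun i hi => by
    refine hcommon F.1 F.2 G.1 G.2 i ?_
    by_contra hiG
    have : u F.1 i ∈ F.1 \ G.1 := Finset.mem_sdiff.2 ⟨hmem F.1 F.2 i, hiG⟩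
    rw [hx, Finset.mem_singleton] at this
    exact hi (hK.injective_of_range hP e F.2 (hrange F.1 F.2) this)
  refine hK.homDet_mul_homDet_neg hP e F.2 G.2 (hrange F.1 F.2) (hrange G.1 G.2) k hoff hxF.2 ?_
  intro hkF
  have := hcommon G.1 G.2 F.1 F.2 k hkF
  exact hxF.2 (this ▸ hmem G.1 G.2 k)

theorem signature_eq_of_labeling (hK : IsSupportedComplex P K h) (hP : affineSpan ℝ P = ⊤)
    (e : Fin a ≃ ι) {d : (ι → ℝ) → ℕ} {w : Finset (ι → ℝ) → Fin (a + 1) → ι → ℝ}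
    {s : Finset (ι → ℝ) → ℕ} (hw : IsLabeling K d w s) :
    signature K = (∑ F ∈ hK.finite_facets.toFinset,
      (-1) ^ (a * s F) * oddSign (homDet e (w F))).natAbs := by
  rw [hK.signature_eq hP (D := fun F => (-1) ^ (a * s F) * homDet e (w F))]
  · simp only [oddSign_neg_one_pow_mul]
  · intro F hF
    rw [normalizedVolume_eq_abs_homDet e (hw.range_eq F hF), abs_mul]
    simp
  · exact fun F G hadj => hK.labeling_homDet_neg hP e hw hadj

end IsSupportedComplex

end Signature

/-! ### Monotone couplings and dual potentials for chains -/

section Coupling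

/-- Two finite weight systems of equal mass have a coupling that is supported on a chain. -/
theorem exists_chain_coupling {α β : Type*} (O : α → ℕ) (O' : β → ℕ) (n : ℕ) :
    ∀ (A : Finset α) (B : Finset β) (p : α → ℝ) (q : β → ℝ), A.card + B.card = n →
      (∀ x ∈ A, 0 ≤ p x) → (∀ y ∈ B, 0 ≤ q y) → ∑ x ∈ A, p x = ∑ y ∈ B, q y →
      ∃ (C : Finset (α × β)) (γ : α × β → ℝ), (∀ z ∈ C, z.1 ∈ A ∧ z.2 ∈ B ∧ 0 ≤ γ z) ∧
        (∀ z ∈ C, ∀ z' ∈ C, (O z.1 ≤ O z'.1 ∧ O' z.2 ≤ O' z'.2) ∨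
          (O z'.1 ≤ O z.1 ∧ O' z'.2 ≤ O' z.2)) ∧
        (∀ g : α → ℝ, ∑ z ∈ C, γ z * g z.1 = ∑ x ∈ A, p x * g x) ∧
        ∀ g : β → ℝ, ∑ z ∈ C, γ z * g z.2 = ∑ y ∈ B, q y * g y := by
  classical
  induction n with
  | zero =>
    intro A B p q hn _ _ _
    have hA : A = ∅ := Finset.card_eq_zero.1 (by omega)
    have hB : B = ∅ := Finset.card_eq_zero.1 (by omega)
    exact ⟨∅, fun _ => 0, by simp, by simp, by simp [hA], by simp [hB]⟩
  | succ n ih =>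
    intro A B p q hn hp hq hpq
    rcases A.eq_empty_or_nonempty with rfl | hA
    · have h0 : ∀ y ∈ B, q y = 0 :=
        (Finset.sum_eq_zero_iff_of_nonneg hq).1 (by rw [← hpq]; simp)
      refine ⟨∅, fun _ => 0, by simp, by simp, by simp, fun g => ?_⟩
      rw [Finset.sum_empty, Finset.sum_eq_zero]
      intro y hy
      rw [h0 y hy, zero_mul]
    rcases B.eq_empty_or_nonempty with rfl | hB
    · have h0 : ∀ x ∈ A, p x = 0 :=
        (Finset.sum_eq_zero_iff_of_nonneg hp).1 (by rw [hpq]; simp)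
      refine ⟨∅, fun _ => 0, by simp, by simp, fun g => ?_, by simp⟩
      rw [Finset.sum_empty, Finset.sum_eq_zero]
      intro x hx
      rw [h0 x hx, zero_mul]
    -- The greedy northwest corner rule: match the two minima, use up the lighter weight and leave
    -- the remainder on the heavier one. The new pair lies below all later ones, so the chain
    -- property persists.
    obtain ⟨x₀, hx₀, hxmin⟩ := A.exists_min_image O hA
    obtain ⟨y₀, hy₀, hymin⟩ := B.exists_min_image O' hB
    have hcA := Finset.card_erase_add_one hx₀
    have hcB := Finset.card_erase_add_one hy₀
    have hsA := fun f : α → ℝ => Finset.add_sum_erase A f hx₀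
    have hsB := fun f : β → ℝ => Finset.add_sum_erase B f hy₀
    rcases le_total (p x₀) (q y₀) with hle | hle
    · let q' := Function.update q y₀ (q y₀ - p x₀)
      have hq'0 : q' y₀ = q y₀ - p x₀ := by simp [q']
      have hq' : ∀ y ∈ B.erase y₀, q' y = q y := fun y hy => by
        simp [q', (Finset.mem_erase.1 hy).1]
      have hq's : ∀ g : β → ℝ, ∑ y ∈ B, q' y * g y = ∑ y ∈ B, q y * g y - p x₀ * g y₀ := by
        intro g
        rw [← hsB, ← hsB (fun y => q y * g y), hq'0, Finset.sum_congr rfl fun y hy => by rw [hq' y hy]]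
        ring
      obtain ⟨C, γ, hC, hch, h1, h2⟩ := ih (A.erase x₀) B p q' (by omega)
        (fun x hx => hp x (Finset.mem_of_mem_erase hx))
        (fun y hy => by
          by_cases hyy : y = y₀
          · subst hyy; rw [hq'0]; linarith
          · rw [hq' y (Finset.mem_erase.2 ⟨hyy, hy⟩)]; exact hq y hy)
        (by
          have e1 := hq's fun _ => 1
          have e2 := hsA p
          simp only [mul_one] at e1
          linarith)
      have hnot : (x₀, y₀) ∉ C := fun h => by simpa using (hC _ h).1
      have hγ : ∀ z ∈ C, Function.update γ (x₀, y₀) (p x₀) z = γ z := fun z hz => by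
        rw [Function.update_of_ne]
        rintro rfl
        exact hnot hz
      refine ⟨insert (x₀, y₀) C, Function.update γ (x₀, y₀) (p x₀), ?_, ?_, fun g => ?_,
        fun g => ?_⟩
      · intro z hz
        rcases Finset.mem_insert.1 hz with rfl | hz
        · simpa using ⟨hx₀, hy₀, hp x₀ hx₀⟩
        · obtain ⟨a1, a2, a3⟩ := hC z hz
          rw [hγ z hz]
          exact ⟨Finset.mem_of_mem_erase a1, a2, a3⟩
      · intro z hz z' hz'
        rcases Finset.mem_insert.1 hz with rfl | hz <;> rcases Finset.mem_insert.1 hz' with rfl | hz'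
        · simp
        · exact Or.inl ⟨hxmin _ (Finset.mem_of_mem_erase (hC z' hz').1), hymin _ (hC z' hz').2.1⟩
        · exact Or.inr ⟨hxmin _ (Finset.mem_of_mem_erase (hC z hz).1), hymin _ (hC z hz).2.1⟩
        · exact hch z hz z' hz'
      · rw [Finset.sum_insert hnot, Finset.sum_congr rfl fun z hz => by rw [hγ z hz], h1 g,
          ← hsA (fun x => p x * g x)]
        simp
      · rw [Finset.sum_insert hnot, Finset.sum_congr rfl fun z hz => by rw [hγ z hz], h2 g, hq's]
        simp
    · let p' := Function.update p x₀ (p x₀ - q y₀)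
      have hp'0 : p' x₀ = p x₀ - q y₀ := by simp [p']
      have hp' : ∀ x ∈ A.erase x₀, p' x = p x := fun x hx => by
        simp [p', (Finset.mem_erase.1 hx).1]
      have hp's : ∀ g : α → ℝ, ∑ x ∈ A, p' x * g x = ∑ x ∈ A, p x * g x - q y₀ * g x₀ := by
        intro g
        rw [← hsA, ← hsA (fun y => p y * g y), hp'0, Finset.sum_congr rfl fun y hy => by rw [hp' y hy]]
        ring
      obtain ⟨C, γ, hC, hch, h1, h2⟩ := ih A (B.erase y₀) p' q (by omega)
        (fun x hx => by
          by_cases hxx : x = x₀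
          · subst hxx; rw [hp'0]; linarith
          · rw [hp' x (Finset.mem_erase.2 ⟨hxx, hx⟩)]; exact hp x hx)
        (fun y hy => hq y (Finset.mem_of_mem_erase hy))
        (by
          have e1 := hp's fun _ => 1
          have e2 := hsB q
          simp only [mul_one] at e1
          linarith)
      have hnot : (x₀, y₀) ∉ C := fun h => by simpa using (hC _ h).2.1
      have hγ : ∀ z ∈ C, Function.update γ (x₀, y₀) (q y₀) z = γ z := fun z hz => by
        rw [Function.update_of_ne]
        rintro rfl
        exact hnot hz
      refine ⟨insert (x₀, y₀) C, Function.update γ (x₀, y₀) (q y₀), ?_, ?_, fun g => ?_,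
        fun g => ?_⟩
      · intro z hz
        rcases Finset.mem_insert.1 hz with rfl | hz
        · simpa using ⟨hx₀, hy₀, hq y₀ hy₀⟩
        · obtain ⟨a1, a2, a3⟩ := hC z hz
          rw [hγ z hz]
          exact ⟨a1, Finset.mem_of_mem_erase a2, a3⟩
      · intro z hz z' hz'
        rcases Finset.mem_insert.1 hz with rfl | hz <;> rcases Finset.mem_insert.1 hz' with rfl | hz'
        · simp
        · exact Or.inl ⟨hxmin _ (hC z' hz').1, hymin _ (Finset.mem_of_mem_erase (hC z' hz').2.1)⟩
        · exact Or.inr ⟨hxmin _ (hC z hz).1, hymin _ (Finset.mem_of_mem_erase (hC z hz).2.1)⟩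
        · exact hch z hz z' hz'
      · rw [Finset.sum_insert hnot, Finset.sum_congr rfl fun z hz => by rw [hγ z hz], h1 g, hp's]
        simp
      · rw [Finset.sum_insert hnot, Finset.sum_congr rfl fun z hz => by rw [hγ z hz], h2 g,
          ← hsB (fun x => q x * g x)]
        simp

/-- Over the grid spanned by a chain, the function `-x y` is supported exactly on the chain by a
sum of functions of one variable. -/
theorem exists_chain_potential (n : ℕ) : ∀ C : Finset (ℝ × ℝ), C.card = n →
    (∀ z ∈ C, ∀ z' ∈ C, z ≤ z' ∨ z' ≤ z) →
    ∃ f g : ℝ → ℝ, ∀ x y, (∃ y', (x, y') ∈ C) → (∃ x', (x', y) ∈ C) →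
      f x + g y ≤ -(x * y) ∧ (f x + g y = -(x * y) ↔ (x, y) ∈ C) := by
  classical
  induction n with
  | zero =>
    intro C hC _
    obtain rfl := Finset.card_eq_zero.1 hC
    exact ⟨0, 0, by simp⟩
  | succ n ih =>
    intro C hC hch
    -- On a chain, maximizing the coordinate sum finds the greatest element; it is removed, and the
    -- potentials of the rest are extended to it.
    obtain ⟨⟨x₀, y₀⟩, hz₀, hmax⟩ := C.exists_max_image (fun z => z.1 + z.2)
      (Finset.card_pos.1 (by omega))
    have hle₀ : ∀ z ∈ C, z.1 ≤ x₀ ∧ z.2 ≤ y₀ := by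
      intro z hz
      have h1 := hmax z hz
      rcases hch z hz _ hz₀ with h | h
      · exact h
      · obtain ⟨h2, h3⟩ := Prod.mk_le_mk.1 (show (x₀, y₀) ≤ (z.1, z.2) from h)
        dsimp only at h1
        constructor <;> linarith
    obtain ⟨f, g, hfg⟩ := ih (C.erase (x₀, y₀)) (by rw [Finset.card_erase_of_mem hz₀, hC]; rfl)
      (fun z hz z' hz' => hch z (Finset.mem_of_mem_erase hz) z' (Finset.mem_of_mem_erase hz'))
    rcases (C.erase (x₀, y₀)).eq_empty_or_nonempty with hemp | hne
    · have hC1 : ∀ z, z ∈ C ↔ z = (x₀, y₀) := fun z => by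
        constructor
        · intro hz
          by_contra hne
          have : z ∈ C.erase (x₀, y₀) := Finset.mem_erase.2 ⟨hne, hz⟩
          simp [hemp] at this
        · rintro rfl; exact hz₀
      refine ⟨fun _ => 0, fun _ => -(x₀ * y₀), fun x y ⟨y', hx⟩ ⟨x', hy⟩ => ?_⟩
      rw [hC1, Prod.mk.injEq] at hx hy
      rw [hC1, hx.1, hy.2]
      simp
    obtain ⟨⟨x₁, y₁⟩, hz₁, hmax₁⟩ := (C.erase (x₀, y₀)).exists_max_image (fun z => z.1 + z.2) hne
    have hle₁ : ∀ z ∈ C.erase (x₀, y₀), z.1 ≤ x₁ ∧ z.2 ≤ y₁ := by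
      intro z hz
      have h1 := hmax₁ z hz
      rcases hch z (Finset.mem_of_mem_erase hz) _ (Finset.mem_of_mem_erase hz₁) with h | h
      · exact h
      · obtain ⟨h2, h3⟩ := Prod.mk_le_mk.1 (show (x₁, y₁) ≤ (z.1, z.2) from h)
        dsimp only at h1
        constructor <;> linarith
    obtain ⟨hx10, hy10⟩ := hle₀ _ (Finset.mem_of_mem_erase hz₁)
    dsimp only at hx10 hy10
    have hz₁e := ((hfg x₁ y₁ ⟨y₁, hz₁⟩ ⟨x₁, hz₁⟩).2).2 hz₁
    -- The slope of `f` between `x₁` and `x₀`. If `y₁ < y₀`, it must lie strictly between them to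
    -- exclude both new off-chain corners; if `y₁ = y₀`, it equals both, and `g₀` agrees with the
    -- old value of `g`. The midpoint serves both cases. `g₀` is then forced by contact at the new
    -- point.
    let s := (y₀ + y₁) / 2
    let f₀ := f x₁ - s * (x₀ - x₁)
    let g₀ := -(x₀ * y₀) - f₀
    have hs : s = (y₀ + y₁) / 2 := rfl
    have hf₀ : f₀ = f x₁ - s * (x₀ - x₁) := rfl
    have hg₀ : g₀ = -(x₀ * y₀) - f₀ := rfl
    clear_value s f₀ g₀
    have hCx : ∀ x, x ≠ x₀ → (∃ y', (x, y') ∈ C) → ∃ y', (x, y') ∈ C.erase (x₀, y₀) :=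
      fun x hx ⟨y', h⟩ => ⟨y', Finset.mem_erase.2 ⟨fun e => hx (Prod.mk.inj e).1, h⟩⟩
    have hCy : ∀ y, y ≠ y₀ → (∃ x', (x', y) ∈ C) → ∃ x', (x', y) ∈ C.erase (x₀, y₀) :=
      fun y hy ⟨x', h⟩ => ⟨x', Finset.mem_erase.2 ⟨fun e => hy (Prod.mk.inj e).2, h⟩⟩
    have hCm : ∀ x y, (x ≠ x₀ ∨ y ≠ y₀) → ((x, y) ∈ C ↔ (x, y) ∈ C.erase (x₀, y₀)) := by
      intro x y hxy
      rw [Finset.mem_erase, and_iff_right]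
      intro e
      rw [Prod.mk.injEq] at e
      tauto
    refine ⟨Function.update f x₀ f₀, Function.update g y₀ g₀, fun x y hx hy => ?_⟩
    by_cases hxx : x = x₀ <;> by_cases hyy : y = y₀
    · subst hxx hyy
      simp only [Function.update_self, hz₀, iff_true]
      exact ⟨by linarith, by linarith⟩
    · subst hxx
      rw [Function.update_self, Function.update_of_ne hyy, hCm x y (Or.inr hyy)]
      obtain ⟨x', hx'⟩ := hCy y hyy hy
      have hyy₀ : y < y₀ := lt_of_le_of_ne (hle₀ _ (Finset.mem_of_mem_erase hx')).2 hyy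
      have hyy₁ : y ≤ y₁ := (hle₁ _ hx').2
      have hih := hfg x₁ y ⟨y₁, hz₁⟩ ⟨x', hx'⟩
      rcases hx10.eq_or_lt with rfl | hlt
      · have : f₀ = f x₁ := by rw [hf₀]; ring
        rw [this]
        exact hih
      · have hys : y < s := by linarith
        have hstrict : f₀ + g y < -(x * y) := by nlinarith [hih.1]
        refine ⟨hstrict.le, fun e => absurd e hstrict.ne, fun hm => ?_⟩
        have := (hle₁ _ hm).1
        dsimp only at this
        linarith
    · subst hyy
      rw [Function.update_self, Function.update_of_ne hxx, hCm x y (Or.inl hxx)]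
      obtain ⟨y', hy'⟩ := hCx x hxx hx
      have hxx₀ : x < x₀ := lt_of_le_of_ne (hle₀ _ (Finset.mem_of_mem_erase hy')).1 hxx
      have hxx₁ : x ≤ x₁ := (hle₁ _ hy').1
      have hih := hfg x y₁ ⟨y', hy'⟩ ⟨x₁, hz₁⟩
      rcases hy10.eq_or_lt with rfl | hlt
      · have : g₀ = g y₁ := by rw [hg₀, hf₀, hs]; linarith
        rw [this]
        exact hih
      · have hstrict : f x + g₀ < -(x * y) := by
          have e1 : f x ≤ f x₁ + (x₁ - x) * y₁ := by linarith [hih.1]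
          have e2 : (x₁ - x) * y₁ + s * (x₀ - x₁) < (x₁ - x) * y + (x₀ - x₁) * y := by
            rcases hxx₁.eq_or_lt with rfl | h
            · nlinarith
            · nlinarith
          rw [hg₀, hf₀]
          linarith
        refine ⟨hstrict.le, fun e => absurd e hstrict.ne, fun hm => ?_⟩
        have := (hle₁ _ hm).2
        dsimp only at this
        linarith
    · rw [Function.update_of_ne hxx, Function.update_of_ne hyy, hCm x y (Or.inl hxx)]
      exact hfg x y (hCx x hxx hx) (hCy y hyy hy)

end Coupling

/-! ### The simplicial product is a dense supported complex over the product polytope -/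

section Product

open Filter Topology

variable {ι κ : Type*}

/-- The projection `ℝ^(ι ⊕ κ) → ℝ^ι`. -/
def projL : (ι ⊕ κ → ℝ) →ₗ[ℝ] (ι → ℝ) := LinearMap.funLeft ℝ ℝ Sum.inl

/-- The projection `ℝ^(ι ⊕ κ) → ℝ^κ`. -/
def projR : (ι ⊕ κ → ℝ) →ₗ[ℝ] (κ → ℝ) := LinearMap.funLeft ℝ ℝ Sum.inr

@[simp] theorem projL_elim (x : ι → ℝ) (y : κ → ℝ) : projL (Sum.elim x y) = x := rfl

@[simp] theorem projR_elim (x : ι → ℝ) (y : κ → ℝ) : projR (Sum.elim x y) = y := rfl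

theorem elim_proj (z : ι ⊕ κ → ℝ) : Sum.elim (projL z) (projR z) = z := by
  ext (i | i) <;> rfl

theorem ext_proj {z z' : ι ⊕ κ → ℝ} (h1 : projL z = projL z') (h2 : projR z = projR z') :
    z = z' := by
  rw [← elim_proj z, ← elim_proj z', h1, h2]

/-- The set `F` is totally ordered by the product ordering. -/
def IsProductChain (O : (ι → ℝ) → ℕ) (O' : (κ → ℝ) → ℕ) (F : Finset (ι ⊕ κ → ℝ)) : Prop :=
  ∀ z ∈ F, ∀ z' ∈ F, (O (projL z) ≤ O (projL z') ∧ O' (projR z) ≤ O' (projR z')) ∨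
    (O (projL z') ≤ O (projL z) ∧ O' (projR z') ≤ O' (projR z))

variable {K : Set (Finset (ι → ℝ))} {O : (ι → ℝ) → ℕ} {L : Set (Finset (κ → ℝ))}
  {O' : (κ → ℝ) → ℕ}

/-- Images of sets replace `Finset.image`, so that no decidability instance has to be matched. -/
theorem mem_simplicialProduct_iff {F : Finset (ι ⊕ κ → ℝ)} :
    F ∈ simplicialProduct K O L O' ↔ (∃ A ∈ K, (A : Set (ι → ℝ)) = projL '' (F : Set (ι ⊕ κ → ℝ))) ∧
      (∃ B ∈ L, (B : Set (κ → ℝ)) = projR '' (F : Set (ι ⊕ κ → ℝ))) ∧ IsProductChain O O' F := by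
  classical
  refine and_congr ⟨fun h => ⟨_, h, by rw [Finset.coe_image]; rfl⟩, ?_⟩
    (and_congr ⟨fun h => ⟨_, h, by rw [Finset.coe_image]; rfl⟩, ?_⟩ Iff.rfl)
  · rintro ⟨A, hA, hA'⟩
    have : A = F.image projL := by rw [← Finset.coe_inj, hA', Finset.coe_image]
    exact this ▸ hA
  · rintro ⟨A, hA, hA'⟩
    have : A = F.image projR := by rw [← Finset.coe_inj, hA', Finset.coe_image]
    exact this ▸ hA

theorem mem_vertexSet_simplicialProduct {z : ι ⊕ κ → ℝ} :
    z ∈ vertexSet (simplicialProduct K O L O') ↔ projL z ∈ vertexSet K ∧ projR z ∈ vertexSet L := by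
  classical
  change {z} ∈ simplicialProduct K O L O' ↔ {projL z} ∈ K ∧ {projR z} ∈ L
  rw [mem_simplicialProduct_iff]
  constructor
  · rintro ⟨⟨A, hA, hA'⟩, ⟨B, hB, hB'⟩, -⟩
    have h1 : A = {projL z} := by rw [← Finset.coe_inj, hA']; simp
    have h2 : B = {projR z} := by rw [← Finset.coe_inj, hB']; simp
    exact ⟨h1 ▸ hA, h2 ▸ hB⟩
  · rintro ⟨h1, h2⟩
    exact ⟨⟨_, h1, by simp⟩, ⟨_, h2, by simp⟩, by
      intro a ha b hb; rw [Finset.mem_singleton] at ha hb; subst ha hb; simp⟩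

theorem affineMap_apply_eq_linear_add {E : Type*} [AddCommGroup E] [Module ℝ E] (g : E →ᵃ[ℝ] ℝ)
    (x : E) : g x = g.linear x + g 0 := by
  have := congrFun (AffineMap.decomp g) x
  simpa using this

theorem affineMap_sum_eq_zero {E : Type*} [AddCommGroup E] [Module ℝ E] {α : Type*} (s : Finset α)
    (g : E →ᵃ[ℝ] ℝ) (w : α → ℝ) (z : α → E) (hw : ∑ i ∈ s, w i = 0)
    (hz : ∑ i ∈ s, w i • z i = 0) : ∑ i ∈ s, w i * g (z i) = 0 := by
  have h1 : ∑ i ∈ s, w i * g.linear (z i) = 0 := by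
    have := congrArg g.linear hz
    simpa using this
  simp_rw [affineMap_apply_eq_linear_add g (z _), mul_add, Finset.sum_add_distrib,
    ← Finset.sum_mul, h1, hw]
  simp

/-- Chains over affinely independent sets are affinely independent. -/
theorem affineIndependent_of_isProductChain [Finite ι] [Finite κ] {F : Finset (ι ⊕ κ → ℝ)}
    {A : Finset (ι → ℝ)} {B : Finset (κ → ℝ)} (hA : AffineIndependent ℝ ((↑) : A → (ι → ℝ)))
    (hB : AffineIndependent ℝ ((↑) : B → (κ → ℝ))) (hFA : ∀ z ∈ F, projL z ∈ A)
    (hFB : ∀ z ∈ F, projR z ∈ B) (hO : Set.InjOn O A) (hO' : Set.InjOn O' B)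
    (hch : IsProductChain O O' F) : AffineIndependent ℝ ((↑) : F → (ι ⊕ κ → ℝ)) := by
  classical
  rw [affineIndependent_iff]
  intro s w hw hz
  by_contra! hcon
  obtain ⟨j, hj, hj'⟩ := hcon
  -- Take the lowest point of the chain that carries a nonzero weight.
  obtain ⟨i, hi, hmin⟩ := (s.filter fun i => w i ≠ 0).exists_min_image
    (fun z => O (projL z.1) + O' (projR z.1)) ⟨j, by simp [hj, hj']⟩
  obtain ⟨his, hwi⟩ := Finset.mem_filter.1 hi
  have hle : ∀ k ∈ s, w k ≠ 0 →
      O (projL i.1) ≤ O (projL k.1) ∧ O' (projR i.1) ≤ O' (projR k.1) := by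
    intro k hk hwk
    have h1 := hmin k (Finset.mem_filter.2 ⟨hk, hwk⟩)
    rcases hch i.1 i.2 k.1 k.2 with h | h
    · exact h
    · omega
  -- A second weighted point with the same first coordinate and one with the same second coordinate
  -- would be incomparable. So one coordinate isolates `i`, and an affine function of that factor
  -- that is 1 there and 0 at its other vertices gives `w i = 0`.
  have key : (∀ k ∈ s, w k ≠ 0 → projL k.1 = projL i.1 → k = i) ∨
      (∀ k ∈ s, w k ≠ 0 → projR k.1 = projR i.1 → k = i) := by
    by_contra! hcon
    obtain ⟨⟨k, hk, hwk, hkL, hki⟩, l, hl, hwl, hlR, hli⟩ := hcon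
    have h1 : O' (projR i.1) < O' (projR k.1) := by
      refine lt_of_le_of_ne (hle k hk hwk).2 fun e => hki ?_
      exact Subtype.ext (ext_proj hkL (hO' (hFB _ i.2) (hFB _ k.2) e).symm)
    have h2 : O (projL i.1) < O (projL l.1) := by
      refine lt_of_le_of_ne (hle l hl hwl).1 fun e => hli ?_
      exact Subtype.ext (ext_proj (hO (hFA _ i.2) (hFA _ l.2) e).symm hlR)
    rcases hch k.1 k.2 l.1 l.2 with ⟨-, h⟩ | ⟨h, -⟩
    · rw [hlR] at h; omega
    · rw [hkL] at h; omega
  rcases key with key | key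
  · obtain ⟨g, hg⟩ := exists_affineMap_eq hA fun v => if v = projL i.1 then 1 else 0
    have h0 := affineMap_sum_eq_zero s (g.comp projL.toAffineMap) w (fun k => k.1) hw hz
    rw [Finset.sum_eq_single i] at h0
    · simp [hg _ (hFA _ i.2)] at h0
      exact hwi h0
    · intro k hk hki
      by_cases hwk : w k = 0
      · simp [hwk]
      · have : projL k.1 ≠ projL i.1 := fun e => hki (key k hk hwk e)
        simp [hg _ (hFA _ k.2), this]
    · exact fun h => absurd his h
  · obtain ⟨g, hg⟩ := exists_affineMap_eq hB fun v => if v = projR i.1 then 1 else 0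
    have h0 := affineMap_sum_eq_zero s (g.comp projR.toAffineMap) w (fun k => k.1) hw hz
    rw [Finset.sum_eq_single i] at h0
    · simp [hg _ (hFB _ i.2)] at h0
      exact hwi h0
    · intro k hk hki
      by_cases hwk : w k = 0
      · simp [hwk]
      · have : projR k.1 ≠ projR i.1 := fun e => hki (key k hk hwk e)
        simp [hg _ (hFB _ k.2), this]
    · exact fun h => absurd his h

theorem exists_projections {F : Finset (ι ⊕ κ → ℝ)} (hF : F ∈ simplicialProduct K O L O') :
    ∃ A ∈ K, ∃ B ∈ L, (∀ z ∈ F, projL z ∈ A ∧ projR z ∈ B) ∧ (∀ x ∈ A, ∃ z ∈ F, projL z = x) ∧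
      (∀ y ∈ B, ∃ z ∈ F, projR z = y) ∧ IsProductChain O O' F := by
  obtain ⟨⟨A, hA, hA'⟩, ⟨B, hB, hB'⟩, hch⟩ := mem_simplicialProduct_iff.1 hF
  refine ⟨A, hA, B, hB, fun z hz => ⟨?_, ?_⟩, fun x hx => ?_, fun y hy => ?_, hch⟩
  · rw [← Finset.mem_coe, hA']; exact ⟨z, hz, rfl⟩
  · rw [← Finset.mem_coe, hB']; exact ⟨z, hz, rfl⟩
  · rw [← Finset.mem_coe, hA'] at hx; exact hx
  · rw [← Finset.mem_coe, hB'] at hy; exact hy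

variable {P : Set (ι → ℝ)} {Q : Set (κ → ℝ)} {h : (ι → ℝ) → ℝ} {h' : (κ → ℝ) → ℝ}

/-- It suffices that the projections land inside faces, since their images are then faces by
downward closure. A coupling may leave vertices of weight zero unused. -/
theorem mem_simplicialProduct_of_subset (hK : IsSupportedComplex P K h)
    (hL : IsSupportedComplex Q L h') {F : Finset (ι ⊕ κ → ℝ)} (hF : F.Nonempty)
    {A : Finset (ι → ℝ)} (hA : A ∈ K) {B : Finset (κ → ℝ)} (hB : B ∈ L)
    (hFA : ∀ z ∈ F, projL z ∈ A) (hFB : ∀ z ∈ F, projR z ∈ B) (hch : IsProductChain O O' F) :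
    F ∈ simplicialProduct K O L O' := by
  classical
  rw [mem_simplicialProduct_iff]
  refine ⟨⟨F.image projL, hK.down_closed A hA _ ?_ (hF.image _), by simp⟩,
    ⟨F.image projR, hL.down_closed B hB _ ?_ (hF.image _), by simp⟩, hch⟩
  · intro x hx
    obtain ⟨z, hz, rfl⟩ := Finset.mem_image.1 hx
    exact hFA z hz
  · intro x hx
    obtain ⟨z, hz, rfl⟩ := Finset.mem_image.1 hx
    exact hFB z hz

/-- Every point of the product lies in a simplex of the simplicial product. -/
theorem exists_mem_simplicialProduct (hK : IsSupportedComplex P K h)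
    (hL : IsSupportedComplex Q L h') {z : ι ⊕ κ → ℝ} (hz : z ∈ polytopeProduct P Q) :
    ∃ F ∈ simplicialProduct K O L O', z ∈ convexHull ℝ (F : Set (ι ⊕ κ → ℝ)) := by
  classical
  obtain ⟨A, hA, hxA⟩ := (hK.mem_iff _).1 hz.1
  obtain ⟨B, hB, hyB⟩ := (hL.mem_iff _).1 hz.2
  obtain ⟨p, hp0, hp1, hpx⟩ := Finset.mem_convexHull'.1 hxA
  obtain ⟨q, hq0, hq1, hqy⟩ := Finset.mem_convexHull'.1 hyB
  obtain ⟨C, γ, hC, hch, hγp, hγq⟩ := exists_chain_coupling O O' _ A B p q rfl hp0 hq0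
    (hp1.trans hq1.symm)
  have hsum : ∑ c ∈ C, γ c = 1 := by simpa [hp1] using hγp fun _ => 1
  have hCne : C.Nonempty := by
    rw [Finset.nonempty_iff_ne_empty]
    rintro rfl
    simp at hsum
  refine ⟨C.image fun c => Sum.elim c.1 c.2,
    mem_simplicialProduct_of_subset hK hL (hCne.image _) hA hB ?_ ?_ ?_, ?_⟩
  · intro w hw
    obtain ⟨c, hc, rfl⟩ := Finset.mem_image.1 hw
    exact (hC c hc).1
  · intro w hw
    obtain ⟨c, hc, rfl⟩ := Finset.mem_image.1 hw
    exact (hC c hc).2.1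
  · intro w hw w' hw'
    obtain ⟨c, hc, rfl⟩ := Finset.mem_image.1 hw
    obtain ⟨c', hc', rfl⟩ := Finset.mem_image.1 hw'
    exact hch c hc c' hc'
  · have hzs : z = ∑ c ∈ C, γ c • (Sum.elim c.1 c.2 : ι ⊕ κ → ℝ) := by
      ext (i | j)
      · have h1 : ∑ x ∈ A, p x * x i = z (Sum.inl i) := by
          have := congrFun hpx i
          simpa [Finset.sum_apply] using this
        rw [← h1, ← hγp fun x => x i]
        simp [Finset.sum_apply]
      · have h1 : ∑ x ∈ B, q x * x j = z (Sum.inr j) := by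
          have := congrFun hqy j
          simpa [Finset.sum_apply] using this
        rw [← h1, ← hγq fun x => x j]
        simp [Finset.sum_apply]
    rw [hzs]
    exact (convex_convexHull ℝ _).sum_mem (fun c hc => (hC c hc).2.2) hsum fun c hc =>
      subset_convexHull ℝ _ (Finset.mem_coe.2 (Finset.mem_image_of_mem _ hc))

/-- The two parts of the support function of a chain: one supporting the product cell, the other
supporting the chain within that cell. -/
theorem exists_support_pair [Finite ι] [Finite κ] (hK : IsSupportedComplex P K h)
    (hL : IsSupportedComplex Q L h') (hO : Set.InjOn O (vertexSet K))
    (hO' : Set.InjOn O' (vertexSet L)) {F : Finset (ι ⊕ κ → ℝ)}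
    (hF : F ∈ simplicialProduct K O L O') :
    ∃ p q : (ι ⊕ κ → ℝ) →ᵃ[ℝ] ℝ, ∀ z ∈ vertexSet (simplicialProduct K O L O'),
      (p z < h (projL z) + h' (projR z) ∧ z ∉ F) ∨ (p z = h (projL z) + h' (projR z) ∧
        q z ≤ -(O (projL z) * O' (projR z)) ∧ (q z = -(O (projL z) * O' (projR z)) ↔ z ∈ F)) := by
  classical
  obtain ⟨A, hA, B, hB, hFAB, hAF, hBF, hch⟩ := exists_projections hF
  obtain ⟨a, ha, ha'⟩ := hK.support A hA
  obtain ⟨b, hb, hb'⟩ := hL.support B hB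
  obtain ⟨f, g, hfg⟩ := exists_chain_potential _
    (F.image fun z => ((O (projL z) : ℝ), (O' (projR z) : ℝ))) rfl (by
      intro c hc c' hc'
      obtain ⟨z, hz, rfl⟩ := Finset.mem_image.1 hc
      obtain ⟨z', hz', rfl⟩ := Finset.mem_image.1 hc'
      simp only [Prod.mk_le_mk, Nat.cast_le]
      exact hch z hz z' hz')
  obtain ⟨f', hf'⟩ := exists_affineMap_eq (hK.indep A hA) fun x => f (O x)
  obtain ⟨g', hg'⟩ := exists_affineMap_eq (hL.indep B hB) fun x => g (O' x)
  refine ⟨a.comp projL.toAffineMap + b.comp projR.toAffineMap,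
    f'.comp projL.toAffineMap + g'.comp projR.toAffineMap, fun z hz => ?_⟩
  obtain ⟨hzK, hzL⟩ := mem_vertexSet_simplicialProduct.1 hz
  have h1 := ha _ hzK
  have h2 := hb _ hzL
  by_cases hzA : projL z ∈ A
  · by_cases hzB : projR z ∈ B
    · right
      have e1 := (ha' _ hzK).2 hzA
      have e2 := (hb' _ hzL).2 hzB
      obtain ⟨z₁, hz₁, hz₁'⟩ := hAF _ hzA
      obtain ⟨z₂, hz₂, hz₂'⟩ := hBF _ hzB
      have hpot := hfg (O (projL z)) (O' (projR z))
        ⟨O' (projR z₁), Finset.mem_image.2 ⟨z₁, hz₁, by rw [hz₁']⟩⟩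
        ⟨O (projL z₂), Finset.mem_image.2 ⟨z₂, hz₂, by rw [hz₂']⟩⟩
      have hmem : ((O (projL z) : ℝ), (O' (projR z) : ℝ)) ∈
          F.image (fun z => ((O (projL z) : ℝ), (O' (projR z) : ℝ))) ↔ z ∈ F := by
        rw [Finset.mem_image]
        constructor
        · rintro ⟨w, hw, hw'⟩
          rw [Prod.mk.injEq, Nat.cast_inj, Nat.cast_inj] at hw'
          have hwz : w = z := ext_proj
            (hO (hK.mem_vertexSet hA (hFAB w hw).1) hzK hw'.1)
            (hO' (hL.mem_vertexSet hB (hFAB w hw).2) hzL hw'.2)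
          exact hwz ▸ hw
        · exact fun hz => ⟨z, hz, rfl⟩
      rw [hmem] at hpot
      simpa [e1, e2, hf' _ hzA, hg' _ hzB] using hpot
    · left
      have : b (projR z) ≠ h' (projR z) := fun e => hzB ((hb' _ hzL).1 e)
      have := lt_of_le_of_ne h2 this
      refine ⟨?_, fun hzF => hzB (hFAB z hzF).2⟩
      simpa using add_lt_add_of_le_of_lt h1 this
  · left
    have : a (projL z) ≠ h (projL z) := fun e => hzA ((ha' _ hzK).1 e)
    have := lt_of_le_of_ne h1 this
    refine ⟨?_, fun hzF => hzA (hFAB z hzF).1⟩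
    simpa using add_lt_add_of_lt_of_le this h2

/-- The simplicial product of regular triangulations is a regular triangulation of the product. -/
theorem exists_isSupportedComplex_simplicialProduct [Finite ι] [Finite κ]
    (hK : IsSupportedComplex P K h) (hL : IsSupportedComplex Q L h')
    (hO : Set.InjOn O (vertexSet K)) (hO' : Set.InjOn O' (vertexSet L)) :
    ∃ H, IsSupportedComplex (polytopeProduct P Q) (simplicialProduct K O L O') H := by
  classical
  have hVfin : (vertexSet (simplicialProduct K O L O')).Finite := by
    have : (Set.image2 (fun x y => (Sum.elim x y : ι ⊕ κ → ℝ)) (vertexSet K) (vertexSet L)).Finite :=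
      hK.finite_vertexSet.image2 _ hL.finite_vertexSet
    refine this.subset fun z hz => ?_
    obtain ⟨h1, h2⟩ := mem_vertexSet_simplicialProduct.1 hz
    exact ⟨_, h1, _, h2, elim_proj z⟩
  have hmemV : ∀ F ∈ simplicialProduct K O L O', ∀ z ∈ F,
      z ∈ vertexSet (simplicialProduct K O L O') := fun F hF z hz => by
    obtain ⟨A, hA, B, hB, hFAB, -⟩ := exists_projections hF
    exact mem_vertexSet_simplicialProduct.2
      ⟨hK.mem_vertexSet hA (hFAB z hz).1, hL.mem_vertexSet hB (hFAB z hz).2⟩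
  have hfin : (simplicialProduct K O L O').Finite := by
    refine (hVfin.toFinset.powerset.finite_toSet).subset fun F hF => ?_
    rw [Finset.mem_coe, Finset.mem_powerset]
    intro z hz
    simpa using hmemV F hF z hz
  choose p q hpq using fun F : simplicialProduct K O L O' =>
    exists_support_pair hK hL hO hO' F.2
  -- Off the cell of `F`, the strict inequality for `p` survives small ε; on the cell, `p` is an
  -- equality and `q` decides for every ε > 0. There are finitely many conditions, so one ε serves
  -- all.
  have hev : ∀ᶠ ε in 𝓝[>] (0 : ℝ), ∀ F ∈ simplicialProduct K O L O',
      ∀ z ∈ vertexSet (simplicialProduct K O L O'), ∀ hF : F ∈ simplicialProduct K O L O',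
      p ⟨F, hF⟩ z + ε * q ⟨F, hF⟩ z ≤
        h (projL z) + h' (projR z) - ε * (O (projL z) * O' (projR z)) ∧
      (p ⟨F, hF⟩ z + ε * q ⟨F, hF⟩ z =
        h (projL z) + h' (projR z) - ε * (O (projL z) * O' (projR z)) ↔ z ∈ F) := by
    rw [eventually_all_finite hfin]
    intro F hF
    rw [eventually_all_finite hVfin]
    intro z hz
    rcases hpq ⟨F, hF⟩ z hz with ⟨hlt, hzF⟩ | ⟨h1, h2, h3⟩
    · have hlim : Tendsto (fun ε : ℝ => h (projL z) + h' (projR z) -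
          ε * (O (projL z) * O' (projR z)) - (p ⟨F, hF⟩ z + ε * q ⟨F, hF⟩ z)) (𝓝[>] 0)
          (𝓝 (h (projL z) + h' (projR z) -
          0 * (O (projL z) * O' (projR z)) - (p ⟨F, hF⟩ z + 0 * q ⟨F, hF⟩ z))) := by
        apply Tendsto.mono_left _ nhdsWithin_le_nhds
        exact Continuous.tendsto (by fun_prop) 0
      have hpos := hlim.eventually_const_lt (u := 0) (by linarith)
      filter_upwards [hpos] with ε hε _
      refine ⟨by linarith, fun e => by linarith, fun hz => absurd hz hzF⟩
    · filter_upwards [self_mem_nhdsWithin] with ε hε _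
      have hε : 0 < ε := hε
      refine ⟨by nlinarith, ?_⟩
      rw [← h3, h1]
      constructor
      · intro e
        have : ε * q ⟨F, hF⟩ z = ε * -(O (projL z) * O' (projR z)) := by linarith
        exact mul_left_cancel₀ hε.ne' this
      · intro e
        rw [e]; ring
  obtain ⟨ε, hε⟩ := hev.exists
  refine ⟨fun z => h (projL z) + h' (projR z) - ε * (O (projL z) * O' (projR z)), hfin, ?_, ?_, ?_,
    ?_, ?_, ?_⟩
  · intro F hF
    obtain ⟨A, hA, B, hB, hFAB, hAF, -⟩ := exists_projections hF
    obtain ⟨x, hx⟩ := hK.nonempty A hA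
    obtain ⟨z, hz, -⟩ := hAF x hx
    exact ⟨z, hz⟩
  · intro F hF G hGF hG
    obtain ⟨A, hA, B, hB, hFAB, -, -, hch⟩ := exists_projections hF
    exact mem_simplicialProduct_of_subset hK hL hG hA hB (fun z hz => (hFAB z (hGF hz)).1)
      (fun z hz => (hFAB z (hGF hz)).2) fun z hz z' hz' => hch z (hGF hz) z' (hGF hz')
  · intro F hF
    obtain ⟨A, hA, B, hB, hFAB, -, -, hch⟩ := exists_projections hF
    exact affineIndependent_of_isProductChain (hK.indep A hA) (hL.indep B hB)
      (fun z hz => (hFAB z hz).1) (fun z hz => (hFAB z hz).2)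
      (hO.mono fun x hx => hK.mem_vertexSet hA hx) (hO'.mono fun x hx => hL.mem_vertexSet hB hx) hch
  · intro z
    refine ⟨fun hz => exists_mem_simplicialProduct hK hL hz, ?_⟩
    rintro ⟨F, hF, hz⟩
    obtain ⟨A, hA, B, hB, hFAB, -⟩ := exists_projections hF
    refine convexHull_min ?_ ?_ hz
    · intro w hw
      exact ⟨hK.subset hA (hFAB w hw).1, hL.subset hB (hFAB w hw).2⟩
    · exact (hK.convex.linear_preimage projL).inter (hL.convex.linear_preimage projR)
  · exact (hK.convex.linear_preimage projL).inter (hL.convex.linear_preimage projR)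
  · intro F hF
    refine ⟨p ⟨F, hF⟩ + ε • q ⟨F, hF⟩, fun z hz => ?_, fun z hz => ?_⟩
    · simpa using (hε F hF z hz hF).1
    · simpa using (hε F hF z hz hF).2

/-- The inclusion `x ↦ (x, y)` of the first factor. -/
def inclL (y : κ → ℝ) : (ι → ℝ) →ᵃ[ℝ] (ι ⊕ κ → ℝ) where
  toFun x := Sum.elim x y
  linear :=
    { toFun := fun x => Sum.elim x 0
      map_add' := fun x x' => by ext (i | i) <;> simp
      map_smul' := fun c x => by ext (i | i) <;> simp }
  map_vadd' x x' := by ext (i | i) <;> simp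

/-- The inclusion `y ↦ (x, y)` of the second factor. -/
def inclR (x : ι → ℝ) : (κ → ℝ) →ᵃ[ℝ] (ι ⊕ κ → ℝ) where
  toFun y := Sum.elim x y
  linear :=
    { toFun := fun y => Sum.elim 0 y
      map_add' := fun x x' => by ext (i | i) <;> simp
      map_smul' := fun c x => by ext (i | i) <;> simp }
  map_vadd' x x' := by ext (i | i) <;> simp

theorem inclR_apply (x : ι → ℝ) (y : κ → ℝ) : inclR x y = Sum.elim x y := rfl

/-- Slices at heights `y` in `Q` fill the first factor; over any `x` the span then contains all of
`Q`, which fills the second. -/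
theorem affineSpan_polytopeProduct (hP : affineSpan ℝ P = ⊤) (hQ : affineSpan ℝ Q = ⊤) :
    affineSpan ℝ (polytopeProduct P Q) = ⊤ := by
  have h1 : ∀ y ∈ Q, (affineSpan ℝ (polytopeProduct P Q)).comap (inclL y) = ⊤ := fun y hy => by
    rw [eq_top_iff, ← hP, affineSpan_le]
    exact fun x hx => subset_affineSpan ℝ _ ⟨hx, hy⟩
  have h2 : ∀ x, (affineSpan ℝ (polytopeProduct P Q)).comap (inclR x) = ⊤ := fun x => by
    rw [eq_top_iff, ← hQ, affineSpan_le]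
    intro y hy
    have : x ∈ (affineSpan ℝ (polytopeProduct P Q)).comap (inclL y) := by
      rw [h1 y hy]; trivial
    exact this
  rw [eq_top_iff]
  intro z _
  have : projR z ∈ (affineSpan ℝ (polytopeProduct P Q)).comap (inclR (projL z)) := by
    rw [h2]; trivial
  rwa [AffineSubspace.mem_comap, inclR_apply, elim_proj] at this

theorem isLatticePolytope_polytopeProduct (hP : IsLatticePolytope P) (hQ : IsLatticePolytope Q) :
    IsLatticePolytope (polytopeProduct P Q) := by
  classical
  obtain ⟨S, hS, rfl⟩ := hP
  obtain ⟨T, hT, rfl⟩ := hQ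
  refine ⟨(S ×ˢ T).image fun c => Sum.elim c.1 c.2, ?_, Set.Subset.antisymm ?_ ?_⟩
  · intro z hz
    obtain ⟨c, hc, rfl⟩ := Finset.mem_image.1 hz
    rw [Finset.mem_product] at hc
    obtain ⟨x, hx⟩ := hS _ hc.1
    obtain ⟨y, hy⟩ := hT _ hc.2
    refine ⟨Sum.elim x y, ?_⟩
    rintro (i | j)
    exacts [hx i, hy j]
  · generalize hC : ((S ×ˢ T).image fun c => (Sum.elim c.1 c.2 : ι ⊕ κ → ℝ)) = C
    -- A product of hulls is filled in two moves: vary the second coordinate over a fixed generator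
    -- of the first factor, then vary the first coordinate.
    have h1 : ∀ x ∈ S, convexHull ℝ (T : Set (κ → ℝ)) ⊆ inclR x ⁻¹' convexHull ℝ (C : Set _) := by
      intro x hx
      refine convexHull_min (fun y hy => subset_convexHull ℝ _ ?_)
        ((convex_convexHull ℝ _).affine_preimage _)
      rw [← hC]
      exact Finset.mem_coe.2 (Finset.mem_image.2 ⟨(x, y), Finset.mem_product.2 ⟨hx, hy⟩, rfl⟩)
    rintro z ⟨hz1, hz2⟩
    have h2 : convexHull ℝ (S : Set (ι → ℝ)) ⊆
        inclL (projR z) ⁻¹' convexHull ℝ (C : Set _) :=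
      convexHull_min (fun x hx => h1 x hx hz2) ((convex_convexHull ℝ _).affine_preimage _)
    have := h2 hz1
    rw [← elim_proj z]
    exact this
  · refine convexHull_min ?_
      (((convex_convexHull ℝ _).linear_preimage projL).inter
        ((convex_convexHull ℝ _).linear_preimage projR))
    intro z hz
    obtain ⟨c, hc, rfl⟩ := Finset.mem_image.1 (Finset.mem_coe.1 hz)
    rw [Finset.mem_product] at hc
    exact ⟨subset_convexHull ℝ _ hc.1, subset_convexHull ℝ _ hc.2⟩

theorem isDense_simplicialProduct (hK : IsDense P K) (hL : IsDense Q L) :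
    IsDense (polytopeProduct P Q) (simplicialProduct K O L O') := by
  ext z
  rw [mem_vertexSet_simplicialProduct, hK, hL]
  constructor
  · rintro ⟨⟨h1, x, hx⟩, h2, y, hy⟩
    refine ⟨⟨h1, h2⟩, Sum.elim x y, ?_⟩
    rintro (i | j)
    exacts [hx i, hy j]
  · rintro ⟨⟨h1, h2⟩, x, hx⟩
    exact ⟨⟨h1, fun i => x (Sum.inl i), fun i => hx _⟩, h2, fun i => x (Sum.inr i), fun i => hx _⟩

end Product

/-! ### Staircases, facets of the product, and factorization of the signature -/

section Staircases

/-- A strictly monotone lattice path of maximal length visits a cell on each antidiagonal. -/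
theorem staircase_add_eq {a b N : ℕ} (hN : N = a + b) {σ : Fin (N + 1) → Fin (a + 1) × Fin (b + 1)}
    (hσ : StrictMono σ) (k : Fin (N + 1)) : ((σ k).1 : ℕ) + (σ k).2 = k := by
  -- The coordinate sum is a strictly monotone self-map of `Fin (N + 1)`, hence the identity.
  let g : Fin (N + 1) → Fin (N + 1) := fun k => ⟨(σ k).1 + (σ k).2, by omega⟩
  have hg : StrictMono g := by
    intro i j hij
    have h := hσ hij
    rw [Prod.lt_iff] at h
    simp only [g, Fin.mk_lt_mk]
    rcases h with ⟨h1, h2⟩ | ⟨h1, h2⟩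
    · have h1 : ((σ i).1 : ℕ) < (σ j).1 := h1
      have h2 : ((σ i).2 : ℕ) ≤ (σ j).2 := h2
      omega
    · have h1 : ((σ i).1 : ℕ) ≤ (σ j).1 := h1
      have h2 : ((σ i).2 : ℕ) < (σ j).2 := h2
      omega
  have : g k = k := le_antisymm hg.apply_le hg.le_apply
  exact congrArg Fin.val this

/-- Discrete intermediate values: the first coordinate starts at 0, ends at `a`, and rises by at
most one per step. -/
theorem staircase_fst_surjective {a b N : ℕ} (hN : N = a + b)
    {σ : Fin (N + 1) → Fin (a + 1) × Fin (b + 1)} (hσ : StrictMono σ) (i : Fin (a + 1)) :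
    ∃ k, (σ k).1 = i := by
  have key : ∀ k (hk : k < N + 1), (i : ℕ) ≤ (σ ⟨k, hk⟩).1 → ∃ k, (σ k).1 = i := by
    intro k
    induction k with
    | zero =>
      intro hk hi
      have := staircase_add_eq hN hσ ⟨0, hk⟩
      exact ⟨⟨0, hk⟩, Fin.ext (by simp only at this; omega)⟩
    | succ k ih =>
      intro hk hi
      have h1 := staircase_add_eq hN hσ ⟨k, by omega⟩
      have h2 := staircase_add_eq hN hσ ⟨k + 1, hk⟩
      have hle : σ ⟨k, by omega⟩ ≤ σ ⟨k + 1, hk⟩ := hσ.monotone (by simp)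
      have h3 : ((σ ⟨k, by omega⟩).2 : ℕ) ≤ (σ ⟨k + 1, hk⟩).2 := hle.2
      simp only at h1 h2
      by_cases h : (i : ℕ) ≤ (σ ⟨k, by omega⟩).1
      · exact ih _ h
      · exact ⟨⟨k + 1, hk⟩, Fin.ext (by omega)⟩
  have hlast := staircase_add_eq hN hσ ⟨N, by omega⟩
  simp only at hlast
  exact key N (by omega) (by omega)

theorem staircase_snd_surjective {a b N : ℕ} (hN : N = a + b)
    {σ : Fin (N + 1) → Fin (a + 1) × Fin (b + 1)} (hσ : StrictMono σ) (j : Fin (b + 1)) :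
    ∃ k, (σ k).2 = j :=
  staircase_fst_surjective (a := b) (b := a) (by omega) (σ := fun k => (σ k).swap)
    (fun _ _ h => Prod.swap_lt_swap.2 (hσ h)) j

open Classical in
/-- The maximal chains of the grid. -/
def staircases (a b : ℕ) : Finset (Fin (a + b + 1) → Fin (a + 1) × Fin (b + 1)) :=
  Finset.univ.filter StrictMono

theorem mem_staircases {a b : ℕ} {σ : Fin (a + b + 1) → Fin (a + 1) × Fin (b + 1)} :
    σ ∈ staircases a b ↔ StrictMono σ := by
  simp [staircases]

variable {ι κ : Type*} {a b : ℕ}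

/-- The points on a lattice path in the product of two simplices. -/
def pathPoints (x : Fin (a + 1) → ι → ℝ) (y : Fin (b + 1) → κ → ℝ)
    (σ : Fin (a + b + 1) → Fin (a + 1) × Fin (b + 1)) (k : Fin (a + b + 1)) : ι ⊕ κ → ℝ :=
  Sum.elim (x (σ k).1) (y (σ k).2)

/-- The ordering of the coordinates of the product space. -/
def sumCoord (e : Fin a ≃ ι) (e' : Fin b ≃ κ) : Fin (a + b) ≃ ι ⊕ κ :=
  finSumFinEquiv.symm.trans (Equiv.sumCongr e e')

variable {K : Set (Finset (ι → ℝ))} {O : (ι → ℝ) → ℕ}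
  {L : Set (Finset (κ → ℝ))} {O' : (κ → ℝ) → ℕ} {P : Set (ι → ℝ)} {Q : Set (κ → ℝ)}
  {h : (ι → ℝ) → ℝ} {h' : (κ → ℝ) → ℝ} {H : (ι ⊕ κ → ℝ) → ℝ}
  {c : (ι → ℝ) → ℕ} {v : Finset (ι → ℝ) → Fin (a + 1) → ι → ℝ}
  {d : (κ → ℝ) → ℕ} {w : Finset (κ → ℝ) → Fin (b + 1) → κ → ℝ} {s : Finset (κ → ℝ) → ℕ}

/-- The labels order every face in the same way as `O`. -/
def IsOrderLabeling (K : Set (Finset (ι → ℝ))) (O c : (ι → ℝ) → ℕ) : Prop :=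
  ∀ F ∈ K, ∀ x ∈ F, ∀ y ∈ F, (O x ≤ O y ↔ c x ≤ c y)


open Classical in
/-- The simplex spanned by the points on a lattice path. -/
def pathFacet (x : Fin (a + 1) → ι → ℝ) (y : Fin (b + 1) → κ → ℝ)
    (σ : Fin (a + b + 1) → Fin (a + 1) × Fin (b + 1)) : Finset (ι ⊕ κ → ℝ) :=
  Finset.univ.image (pathPoints x y σ)

theorem coe_pathFacet (x : Fin (a + 1) → ι → ℝ) (y : Fin (b + 1) → κ → ℝ)
    (σ : Fin (a + b + 1) → Fin (a + 1) × Fin (b + 1)) :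
    (pathFacet x y σ : Set (ι ⊕ κ → ℝ)) = Set.range (pathPoints x y σ) := by
  simp [pathFacet]

theorem mem_pathFacet {x : Fin (a + 1) → ι → ℝ} {y : Fin (b + 1) → κ → ℝ}
    {σ : Fin (a + b + 1) → Fin (a + 1) × Fin (b + 1)} {z : ι ⊕ κ → ℝ} :
    z ∈ pathFacet x y σ ↔ ∃ k, pathPoints x y σ k = z := by
  simp [pathFacet]

theorem card_pathFacet {x : Fin (a + 1) → ι → ℝ} {y : Fin (b + 1) → κ → ℝ}
    {σ : Fin (a + b + 1) → Fin (a + 1) × Fin (b + 1)}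
    (hinj : Function.Injective (pathPoints x y σ)) : (pathFacet x y σ).card = a + b + 1 := by
  classical
  rw [pathFacet, Finset.card_image_of_injective _ hinj, Finset.card_fin]

theorem IsLabeling.mem {s : Finset (ι → ℝ) → ℕ} (hv : IsLabeling K c v s) {F : Finset (ι → ℝ)}
    (hF : F ∈ facets K) (i : Fin (a + 1)) : v F i ∈ F := by
  rw [← Finset.mem_coe, ← hv.range_eq F hF]
  exact ⟨i, rfl⟩

theorem IsLabeling.exists_eq {s : Finset (ι → ℝ) → ℕ} (hv : IsLabeling K c v s)
    {F : Finset (ι → ℝ)} (hF : F ∈ facets K) {x : ι → ℝ} (hx : x ∈ F) : ∃ i, v F i = x := by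
  rw [← Finset.mem_coe, ← hv.range_eq F hF] at hx
  exact hx

theorem IsLabeling.injective {s : Finset (ι → ℝ) → ℕ} (hv : IsLabeling K c v s)
    {F : Finset (ι → ℝ)} (hF : F ∈ facets K) : Function.Injective (v F) := by
  intro i j hij
  have h1 := hv.label F hF i
  rw [hij, hv.label F hF j] at h1
  exact Fin.ext (by omega)

/-- On a facet, the ordering of the vertices is that of the indices. -/
theorem IsLabeling.le_iff {s : Finset (ι → ℝ) → ℕ} (hv : IsLabeling K c v s)
    (hc : IsOrderLabeling K O c) {F : Finset (ι → ℝ)} (hF : F ∈ facets K) (i j : Fin (a + 1)) :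
    O (v F i) ≤ O (v F j) ↔ i ≤ j := by
  rw [hc F hF.1 _ (hv.mem hF i) _ (hv.mem hF j), hv.label F hF, hv.label F hF, Fin.le_def]
  omega

/-- Each step of a staircase raises exactly one index by one, so the summed labels of a product
facet are again consecutive and the theory of `IsLabeling` applies to the product. -/
theorem pathPoints_label {s' : Finset (ι → ℝ) → ℕ} (hv : IsLabeling K c v s')
    (hw : IsLabeling L d w s) {F : Finset (ι → ℝ)} (hF : F ∈ facets K) {G : Finset (κ → ℝ)}
    (hG : G ∈ facets L) {σ : Fin (a + b + 1) → Fin (a + 1) × Fin (b + 1)} (hσ : StrictMono σ)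
    (k : Fin (a + b + 1)) :
    c (projL (pathPoints (v F) (w G) σ k)) + d (projR (pathPoints (v F) (w G) σ k)) =
      s' F + s G + k := by
  rw [pathPoints, projL_elim, projR_elim, hv.label F hF, hw.label G hG]
  have := staircase_add_eq rfl hσ k
  omega

theorem projL_image_pathFacet (x : Fin (a + 1) → ι → ℝ) (y : Fin (b + 1) → κ → ℝ)
    {σ : Fin (a + b + 1) → Fin (a + 1) × Fin (b + 1)} (hσ : StrictMono σ) :
    projL '' (pathFacet x y σ : Set (ι ⊕ κ → ℝ)) = Set.range x := by
  rw [coe_pathFacet, ← Set.range_comp]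
  ext u
  constructor
  · rintro ⟨k, rfl⟩
    exact ⟨_, rfl⟩
  · rintro ⟨i, rfl⟩
    obtain ⟨k, rfl⟩ := staircase_fst_surjective rfl hσ i
    exact ⟨k, rfl⟩

theorem projR_image_pathFacet (x : Fin (a + 1) → ι → ℝ) (y : Fin (b + 1) → κ → ℝ)
    {σ : Fin (a + b + 1) → Fin (a + 1) × Fin (b + 1)} (hσ : StrictMono σ) :
    projR '' (pathFacet x y σ : Set (ι ⊕ κ → ℝ)) = Set.range y := by
  rw [coe_pathFacet, ← Set.range_comp]
  ext u
  constructor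
  · rintro ⟨k, rfl⟩
    exact ⟨_, rfl⟩
  · rintro ⟨i, rfl⟩
    obtain ⟨k, rfl⟩ := staircase_snd_surjective rfl hσ i
    exact ⟨k, rfl⟩

/-- The two facets are the projections of the simplex, and the summed label identifies the `k`-th
point, hence the path. -/
theorem pathFacet_injective {s' : Finset (ι → ℝ) → ℕ} (hv : IsLabeling K c v s')
    (hw : IsLabeling L d w s) {F F' : Finset (ι → ℝ)} (hF : F ∈ facets K) (hF' : F' ∈ facets K)
    {G G' : Finset (κ → ℝ)} (hG : G ∈ facets L) (hG' : G' ∈ facets L)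
    {σ σ' : Fin (a + b + 1) → Fin (a + 1) × Fin (b + 1)} (hσ : StrictMono σ) (hσ' : StrictMono σ')
    (heq : pathFacet (v F) (w G) σ = pathFacet (v F') (w G') σ') : F = F' ∧ G = G' ∧ σ = σ' := by
  have h1 : F = F' := by
    rw [← Finset.coe_inj, ← hv.range_eq F hF, ← hv.range_eq F' hF',
      ← projL_image_pathFacet (v F) (w G) hσ, heq, projL_image_pathFacet _ _ hσ']
  have h2 : G = G' := by
    rw [← Finset.coe_inj, ← hw.range_eq G hG, ← hw.range_eq G' hG',
      ← projR_image_pathFacet (v F) (w G) hσ, heq, projR_image_pathFacet _ _ hσ']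
  subst h1 h2
  refine ⟨rfl, rfl, funext fun k => ?_⟩
  have hk : pathPoints (v F) (w G) σ k ∈ (pathFacet (v F) (w G) σ' : Set (ι ⊕ κ → ℝ)) := by
    rw [← heq, coe_pathFacet]
    exact ⟨k, rfl⟩
  rw [coe_pathFacet] at hk
  obtain ⟨k', hk'⟩ := hk
  have e1 := pathPoints_label hv hw hF hG hσ k
  rw [← hk', pathPoints_label hv hw hF hG hσ' k'] at e1
  obtain rfl : k' = k := Fin.ext (by omega)
  have e2 := congrArg projL hk'
  have e3 := congrArg projR hk'
  exact Prod.ext (hv.injective hF e2).symm (hw.injective hG e3).symm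

theorem isLatticePoint_stdPoint [DecidableEq ι] (e : Fin a ≃ ι) (i : Fin (a + 1)) :
    IsLatticePoint (stdPoint e i) := by
  refine Fin.cases ⟨0, by simp [stdPoint]⟩ (fun k => ⟨Pi.single (e k) 1, fun j => ?_⟩) i
  simp only [stdPoint, Fin.cons_succ, Pi.single_apply]
  split_ifs <;> simp

/-- The points are the image of the standard path under the direct sum of the two affine maps that
carry the standard simplices to the given points; its linear part is block diagonal. -/
theorem homDet_pathPoints [Fintype ι] [Fintype κ] [DecidableEq ι] [DecidableEq κ] (e : Fin a ≃ ι)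
    (e' : Fin b ≃ κ) (x : Fin (a + 1) → ι → ℝ) (y : Fin (b + 1) → κ → ℝ)
    (σ : Fin (a + b + 1) → Fin (a + 1) × Fin (b + 1)) :
    homDet (sumCoord e e') (pathPoints x y σ) = homDet e x * homDet e' y *
      homDet (sumCoord e e') (pathPoints (stdPoint e) (stdPoint e') σ) := by
  obtain ⟨L, hL, hLd⟩ := exists_affine_stdPoint e x
  obtain ⟨M, hM, hMd⟩ := exists_affine_stdPoint e' y
  let N := Matrix.toLin' (Matrix.fromBlocks (LinearMap.toMatrix' L) 0 0 (LinearMap.toMatrix' M))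
  have hN : LinearMap.det N = homDet e x * homDet e' y := by
    rw [LinearMap.det_toLin', Matrix.det_fromBlocks_zero₂₁, LinearMap.det_toMatrix',
      LinearMap.det_toMatrix', hLd, hMd]
  rw [← hN, ← homDet_affine _ _ N (Sum.elim (x 0) (y 0))]
  congr 1
  ext k : 1
  have h1 : ∀ (x : ι → ℝ) (y : κ → ℝ), N (Sum.elim x y) = Sum.elim (L x) (M y) := fun x y => by
    simp only [N, Matrix.toLin'_apply, Matrix.fromBlocks_mulVec, Matrix.zero_mulVec, add_zero,
      zero_add]
    congr 1
    · exact LinearMap.toMatrix'_mulVec L x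
    · exact LinearMap.toMatrix'_mulVec M y
  rw [pathPoints, pathPoints, h1, ← hL, ← hM]
  ext (i | j) <;> rfl

variable [Fintype ι] [Fintype κ]

/-- The points form a chain and carry distinct summed labels, so there are `a + b + 1` of them; this
cardinality already makes the face maximal. -/
theorem pathFacet_mem_facets (e : Fin a ≃ ι) (e' : Fin b ≃ κ) (hK : IsSupportedComplex P K h)
    (hL : IsSupportedComplex Q L h')
    (hH : IsSupportedComplex (polytopeProduct P Q) (simplicialProduct K O L O') H)
    {s' : Finset (ι → ℝ) → ℕ} (hv : IsLabeling K c v s') (hw : IsLabeling L d w s)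
    (hc : IsOrderLabeling K O c) (hd : IsOrderLabeling L O' d) {F : Finset (ι → ℝ)}
    (hF : F ∈ facets K) {G : Finset (κ → ℝ)} (hG : G ∈ facets L)
    {σ : Fin (a + b + 1) → Fin (a + 1) × Fin (b + 1)} (hσ : StrictMono σ) :
    pathFacet (v F) (w G) σ ∈ facets (simplicialProduct K O L O') := by
  have hmem : ∀ z ∈ pathFacet (v F) (w G) σ, ∃ k, pathPoints (v F) (w G) σ k = z :=
    fun z hz => mem_pathFacet.1 hz
  refine hH.mem_facets_of_card (mem_simplicialProduct_of_subset hK hL ?_ hF.1 hG.1 ?_ ?_ ?_) ?_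
  · exact ⟨_, mem_pathFacet.2 ⟨0, rfl⟩⟩
  · intro z hz
    obtain ⟨k, rfl⟩ := hmem z hz
    exact hv.mem hF _
  · intro z hz
    obtain ⟨k, rfl⟩ := hmem z hz
    exact hw.mem hG _
  · intro z hz z' hz'
    obtain ⟨k, rfl⟩ := hmem z hz
    obtain ⟨k', rfl⟩ := hmem z' hz'
    simp only [pathPoints, projL_elim, projR_elim, hv.le_iff hc hF, hw.le_iff hd hG]
    rcases le_total k k' with hk | hk
    · exact Or.inl (hσ.monotone hk)
    · exact Or.inr (hσ.monotone hk)
  · rw [card_pathFacet, Fintype.card_sum, ← Fintype.card_congr e, ← Fintype.card_congr e',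
      Fintype.card_fin, Fintype.card_fin]
    intro k k' hk
    have h1 := pathPoints_label hv hw hF hG hσ k
    rw [hk, pathPoints_label hv hw hF hG hσ k'] at h1
    exact Fin.ext (by omega)

/-- The index sum is injective on a chain, and a product facet has `a + b + 1` vertices. So the
index sum is a bijection onto 0, …, a + b, and listing the vertices by it gives a staircase. -/
theorem exists_pathFacet_eq (e : Fin a ≃ ι) (e' : Fin b ≃ κ) (hK : IsSupportedComplex P K h)
    (hL : IsSupportedComplex Q L h') (hP : affineSpan ℝ P = ⊤) (hQ : affineSpan ℝ Q = ⊤)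
    (hH : IsSupportedComplex (polytopeProduct P Q) (simplicialProduct K O L O') H)
    {s' : Finset (ι → ℝ) → ℕ} (hv : IsLabeling K c v s') (hw : IsLabeling L d w s)
    (hc : IsOrderLabeling K O c) (hd : IsOrderLabeling L O' d)
    {C : Finset (ι ⊕ κ → ℝ)} (hC : C ∈ facets (simplicialProduct K O L O')) :
    ∃ F ∈ facets K, ∃ G ∈ facets L, ∃ σ : Fin (a + b + 1) → Fin (a + 1) × Fin (b + 1),
      StrictMono σ ∧ pathFacet (v F) (w G) σ = C := by
  classical
  obtain ⟨A, hA, B, hB, hAB, -, -, hch⟩ := exists_projections hC.1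
  obtain ⟨F, hF, hAF⟩ := hK.exists_facet_superset hA
  obtain ⟨G, hG, hBG⟩ := hL.exists_facet_superset hB
  choose i hi using fun z : C => hv.exists_eq hF (hAF (hAB z.1 z.2).1)
  choose j hj using fun z : C => hw.exists_eq hG (hBG (hAB z.1 z.2).2)
  have hcmp : ∀ z z' : C, (i z ≤ i z' ∧ j z ≤ j z') ∨ (i z' ≤ i z ∧ j z' ≤ j z) := by
    intro z z'
    have := hch z.1 z.2 z'.1 z'.2
    simpa only [← hi, ← hj, hv.le_iff hc hF, hw.le_iff hd hG] using this
  let r : C → Fin (a + b + 1) := fun z => ⟨i z + j z, by omega⟩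
  have hr : Function.Injective r := by
    intro z z' hzz
    have hzz : (i z : ℕ) + j z = i z' + j z' := congrArg Fin.val hzz
    have h1 : i z = i z' ∧ j z = j z' := by
      rcases hcmp z z' with ⟨h1, h2⟩ | ⟨h1, h2⟩ <;> rw [Fin.le_def] at h1 h2 <;>
        exact ⟨Fin.ext (by omega), Fin.ext (by omega)⟩
    exact Subtype.ext (ext_proj (by rw [← hi, ← hi, h1.1]) (by rw [← hj, ← hj, h1.2]))
  have hrb : Function.Bijective r := by
    rw [Fintype.bijective_iff_injective_and_card]
    refine ⟨hr, ?_⟩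
    rw [Fintype.card_coe, hH.card_facet (affineSpan_polytopeProduct hP hQ) hC, Fintype.card_sum,
      ← Fintype.card_congr e, ← Fintype.card_congr e', Fintype.card_fin, Fintype.card_fin,
      Fintype.card_fin]
  choose z hz using hrb.2
  have hzr : ∀ y, z (r y) = y := fun y => hr (hz _)
  have hpt : ∀ k, pathPoints (v F) (w G) (fun k => (i (z k), j (z k))) k = z k := fun k => by
    rw [pathPoints, hi, hj, elim_proj]
  refine ⟨F, hF, G, hG, fun k => (i (z k), j (z k)), ?_, ?_⟩
  · intro k k' hkk
    have h1 : (i (z k) : ℕ) + j (z k) = k := congrArg Fin.val (hz k)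
    have h2 : (i (z k') : ℕ) + j (z k') = k' := congrArg Fin.val (hz k')
    rw [Fin.lt_def] at hkk
    rw [Prod.lt_iff]
    simp only [Fin.le_def, Fin.lt_def]
    have := hcmp (z k) (z k')
    simp only [Fin.le_def] at this
    omega
  · rw [← Finset.coe_inj, coe_pathFacet]
    ext y
    constructor
    · rintro ⟨k, rfl⟩
      rw [hpt]
      exact (z k).2
    · intro hy
      exact ⟨r ⟨y, hy⟩, by rw [hpt, hzr]⟩

/-- The signature of a simplicial product factors. -/
theorem signature_simplicialProduct [DecidableEq ι] [DecidableEq κ] (e : Fin a ≃ ι)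
    (e' : Fin b ≃ κ) (hK : IsSupportedComplex P K h)
    (hL : IsSupportedComplex Q L h') (hP : affineSpan ℝ P = ⊤) (hQ : affineSpan ℝ Q = ⊤)
    (hH : IsSupportedComplex (polytopeProduct P Q) (simplicialProduct K O L O') H)
    (hv : IsLabeling K c v fun _ => 0) (hw : IsLabeling L d w s)
    (hc : IsOrderLabeling K O c) (hd : IsOrderLabeling L O' d)
    (hKl : ∀ x ∈ vertexSet K, IsLatticePoint x) (hLl : ∀ x ∈ vertexSet L, IsLatticePoint x) :
    signature (simplicialProduct K O L O') =
      ((∑ F ∈ hK.finite_facets.toFinset, oddSign (homDet e (v F))) *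
        (∑ G ∈ hL.finite_facets.toFinset, (-1) ^ ((a + b) * s G) * oddSign (homDet e' (w G))) *
        ∑ σ ∈ staircases a b, oddSign (homDet (sumCoord e e')
          (pathPoints (stdPoint e) (stdPoint e') σ))).natAbs := by
  classical
  choose! F hF G hG σ hσ hFGσ using fun C (hC : C ∈ facets (simplicialProduct K O L O')) =>
    exists_pathFacet_eq e e' hK hL hP hQ hH hv hw hc hd hC
  have hlab : IsLabeling (simplicialProduct K O L O') (fun z => c (projL z) + d (projR z))
      (fun C => pathPoints (v (F C)) (w (G C)) (σ C)) (fun C => s (G C)) := by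
    constructor
    · intro C hC
      rw [← coe_pathFacet, hFGσ C hC]
    · intro C hC k
      rw [pathPoints_label hv hw (hF C hC) (hG C hC) (hσ C hC), zero_add]
  have hval : ∀ F ∈ facets K, ∀ G ∈ facets L, ∀ σ, oddSign (homDet (sumCoord e e')
      (pathPoints (v F) (w G) σ)) = oddSign (homDet e (v F)) * oddSign (homDet e' (w G)) *
      oddSign (homDet (sumCoord e e') (pathPoints (stdPoint e) (stdPoint e') σ)) := by
    intro F hF G hG σ
    obtain ⟨k, hk⟩ := exists_int_homDet e (v := v F) fun i =>
      hKl _ (hK.mem_vertexSet hF.1 (hv.mem hF i))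
    obtain ⟨l, hl⟩ := exists_int_homDet e' (v := w G) fun i =>
      hLl _ (hL.mem_vertexSet hG.1 (hw.mem hG i))
    rw [homDet_pathPoints, oddSign_mul, oddSign_mul ⟨k, hk⟩ ⟨l, hl⟩]
    · exact ⟨k * l, by rw [hk, hl]; push_cast; rfl⟩
    · refine exists_int_homDet _ fun i => ?_
      obtain ⟨x, hx⟩ := isLatticePoint_stdPoint e (σ i).1
      obtain ⟨y, hy⟩ := isLatticePoint_stdPoint e' (σ i).2
      refine ⟨Sum.elim x y, ?_⟩
      rintro (i | j)
      exacts [hx i, hy j]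
  rw [hH.signature_eq_of_labeling (affineSpan_polytopeProduct hP hQ) (sumCoord e e') hlab,
    mul_assoc, Finset.sum_mul_sum, ← Finset.sum_product', Finset.sum_mul_sum,
    ← Finset.sum_product']
  congr 1
  symm
  -- The facets of the product are reindexed by triples of a facet of `K`, a facet of `L` and a
  -- staircase.
  refine Finset.sum_nbij (fun t => pathFacet (v t.1) (w t.2.1) t.2.2) ?_ ?_ ?_ ?_
  · rintro ⟨F, G, σ⟩ ht
    simp only [Finset.mem_product, Set.Finite.mem_toFinset, mem_staircases] at ht ⊢
    exact pathFacet_mem_facets e e' hK hL hH hv hw hc hd ht.1 ht.2.1 ht.2.2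
  · rintro ⟨F, G, σ⟩ ht ⟨F', G', σ'⟩ ht' heq
    simp only [Finset.mem_coe, Finset.mem_product, Set.Finite.mem_toFinset, mem_staircases] at ht ht'
    obtain ⟨rfl, rfl, rfl⟩ := pathFacet_injective hv hw ht.1 ht'.1 ht.2.1 ht'.2.1 ht.2.2 ht'.2.2 heq
    rfl
  · intro C hC
    simp only [Set.Finite.coe_toFinset] at hC
    refine ⟨(F C, G C, σ C), ?_, hFGσ C hC⟩
    simp only [Finset.mem_coe, Finset.mem_product, Set.Finite.mem_toFinset, mem_staircases]
    exact ⟨hF C hC, hG C hC, hσ C hC⟩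
  · rintro ⟨F', G', σ'⟩ ht
    simp only [Finset.mem_product, Set.Finite.mem_toFinset, mem_staircases] at ht
    dsimp only
    have hC := pathFacet_mem_facets e e' hK hL hH hv hw hc hd ht.1 ht.2.1 ht.2.2
    obtain ⟨h1, h2, h3⟩ := pathFacet_injective hv hw (hF _ hC) ht.1 (hG _ hC) ht.2.1 (hσ _ hC)
      ht.2.2 (hFGσ _ hC)
    rw [h1, h2, h3, hval _ ht.1 _ ht.2.1]
    ring

end Staircases

/-! ### Labelings from colorings and colorings from labelings -/

section Labelings

variable {ι κ : Type*} [Fintype ι] [Fintype κ] {a b : ℕ} {P : Set (ι → ℝ)} {Q : Set (κ → ℝ)}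
  {K : Set (Finset (ι → ℝ))} {L : Set (Finset (κ → ℝ))} {h : (ι → ℝ) → ℝ} {h' : (κ → ℝ) → ℝ}
  {H : (ι ⊕ κ → ℝ) → ℝ} {O : (ι → ℝ) → ℕ} {O' : (κ → ℝ) → ℕ}

theorem oddSign_eq {F : Finset (ι → ℝ)} {x : ℝ} (hx : normalizedVolume F = |x|)
    [Decidable (IsOddSimplex F)] :
    oddSign x = if IsOddSimplex F then (SignType.sign x : ℤ) else 0 := by
  classical
  rw [oddSign]
  by_cases hF : IsOddSimplex F
  · rw [if_pos hF, if_pos ((isOddSimplex_iff hx).1 hF)]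
  · rw [if_neg hF, if_neg (mt (isOddSimplex_iff hx).2 hF)]

/-- A facet has `a + 1` vertices with distinct labels in a window of `a + 1` integers, so every
value in the window occurs once. -/
theorem IsSupportedComplex.exists_isLabeling (hK : IsSupportedComplex P K h)
    (hP : affineSpan ℝ P = ⊤) (e : Fin a ≃ ι) {d : (ι → ℝ) → ℕ} {s : Finset (ι → ℝ) → ℕ}
    (hd : ∀ F ∈ facets K, ∀ x ∈ F, s F ≤ d x ∧ d x ≤ s F + a)
    (hinj : ∀ F ∈ facets K, Set.InjOn d F) :
    ∃ w : Finset (ι → ℝ) → Fin (a + 1) → ι → ℝ, IsLabeling K d w s := by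
  have key : ∀ F ∈ facets K, ∃ w : Fin (a + 1) → ι → ℝ, Set.range w = F ∧
      ∀ j, d (w j) = s F + j := by
    intro F hF
    let r : F → Fin (a + 1) := fun x => ⟨d x.1 - s F, by have := hd F hF x.1 x.2; omega⟩
    have hr : Function.Injective r := by
      intro x y hxy
      have h1 : d x.1 - s F = d y.1 - s F := congrArg Fin.val hxy
      have h2 := hd F hF x.1 x.2
      have h3 := hd F hF y.1 y.2
      exact Subtype.ext (hinj F hF x.2 y.2 (by omega))
    have hrb : Function.Bijective r := by
      rw [Fintype.bijective_iff_injective_and_card]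
      refine ⟨hr, ?_⟩
      rw [Fintype.card_coe, hK.card_facet hP hF, ← Fintype.card_congr e, Fintype.card_fin,
        Fintype.card_fin]
    choose z hz using hrb.2
    refine ⟨fun j => z j, ?_, fun j => ?_⟩
    · ext x
      constructor
      · rintro ⟨j, rfl⟩
        exact (z j).2
      · intro hx
        exact ⟨r ⟨x, hx⟩, congrArg Subtype.val (hr (hz (r ⟨x, hx⟩)))⟩
    · have h1 : d (z j).1 - s F = j := congrArg Fin.val (hz j)
      have h2 := hd F hF (z j).1 (z j).2
      change d (z j).1 = s F + j
      omega
  choose! w hw using key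
  exact ⟨w, fun F hF => (hw F hF).1, fun F hF => (hw F hF).2⟩

/-- The vertices of a face have distinct colors, so a weakly monotone coloring orders each face
exactly as `O` does. -/
theorem IsColorConsecutive.exists_isOrderLabeling (hK : IsSupportedComplex P K h)
    (e : Fin a ≃ ι) (hO : IsColorConsecutive K O) :
    ∃ c : (ι → ℝ) → ℕ, IsOrderLabeling K O c ∧ (∀ x, c x ≤ a) ∧ ∀ F ∈ K, Set.InjOn c F := by
  classical
  obtain ⟨c, hc, hmono⟩ := hO
  have hinj : ∀ F ∈ K, ∀ x ∈ F, ∀ y ∈ F, c x = c y → x = y := by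
    intro F hF x hx y hy hxy
    by_contra hne
    refine hc x y hne (hK.down_closed F hF _ ?_ (by simp)) hxy
    intro z hz
    rcases Finset.mem_insert.1 hz with rfl | hz
    · exact hx
    · rw [Finset.mem_singleton] at hz
      exact hz ▸ hy
  refine ⟨fun x => c x, fun F hF x hx y hy => ⟨fun hxy => ?_, fun hxy => ?_⟩, fun x => ?_,
    fun F hF x hx y hy hxy => hinj F hF x hx y hy (Fin.ext hxy)⟩
  · exact hmono x (hK.mem_vertexSet hF hx) y (hK.mem_vertexSet hF hy) hxy
  · by_contra! hlt
    have h1 := hmono y (hK.mem_vertexSet hF hy) x (hK.mem_vertexSet hF hx) hlt.le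
    obtain rfl := hinj F hF x hx y hy (le_antisymm hxy h1)
    exact lt_irrefl _ hlt
  · have h1 := (c x).2
    have h2 : a = Fintype.card ι := by rw [← Fintype.card_congr e, Fintype.card_fin]
    change (c x : ℕ) ≤ a
    omega

/-- Labels that are consecutive on facets give a coloring. -/
theorem IsSupportedComplex.isFoldable_of_isLabeling (hK : IsSupportedComplex P K h)
    (e : Fin a ≃ ι) {d : (ι → ℝ) → ℕ} {w : Finset (ι → ℝ) → Fin (a + 1) → ι → ℝ}
    {s : Finset (ι → ℝ) → ℕ} (hw : IsLabeling K d w s) : IsFoldable K := by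
  have hcard : Fintype.card ι = a := by rw [← Fintype.card_congr e, Fintype.card_fin]
  refine ⟨fun x => ⟨d x % (Fintype.card ι + 1), Nat.mod_lt _ (by omega)⟩, fun x y hne hxy heq => ?_⟩
  obtain ⟨F, hF, hsub⟩ := hK.exists_facet_superset hxy
  obtain ⟨i, rfl⟩ := hw.exists_eq hF (hsub (by simp : x ∈ _))
  obtain ⟨j, rfl⟩ := hw.exists_eq hF (hsub (by simp : y ∈ _))
  have h1 : d (w F i) % (Fintype.card ι + 1) = d (w F j) % (Fintype.card ι + 1) :=
    congrArg Fin.val heq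
  rw [hw.label F hF, hw.label F hF, hcard] at h1
  have h2 : (i : ℕ) ≡ j [MOD a + 1] := Nat.ModEq.add_left_cancel' (s F) h1
  exact hne (by rw [Fin.ext (Nat.ModEq.eq_of_lt_of_lt h2 i.2 j.2)])

theorem isFoldable_simplicialProduct (e : Fin a ≃ ι)
    (e' : Fin b ≃ κ) (hK : IsSupportedComplex P K h)
    (hL : IsSupportedComplex Q L h') (hP : affineSpan ℝ P = ⊤) (hQ : affineSpan ℝ Q = ⊤)
    (hH : IsSupportedComplex (polytopeProduct P Q) (simplicialProduct K O L O') H)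
    {c : (ι → ℝ) → ℕ} {v : Finset (ι → ℝ) → Fin (a + 1) → ι → ℝ}
    {d : (κ → ℝ) → ℕ} {w : Finset (κ → ℝ) → Fin (b + 1) → κ → ℝ} {s : Finset (κ → ℝ) → ℕ}
    (hv : IsLabeling K c v fun _ => 0) (hw : IsLabeling L d w s)
    (hc : IsOrderLabeling K O c) (hd : IsOrderLabeling L O' d) :
    IsFoldable (simplicialProduct K O L O') := by
  choose! F hF G hG σ hσ hFGσ using fun C (hC : C ∈ facets (simplicialProduct K O L O')) =>
    exists_pathFacet_eq e e' hK hL hP hQ hH hv hw hc hd hC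
  refine hH.isFoldable_of_isLabeling (sumCoord e e') (d := fun z => c (projL z) + d (projR z))
    (w := fun C => pathPoints (v (F C)) (w (G C)) (σ C)) (s := fun C => s (G C)) ⟨?_, ?_⟩
  · intro C hC
    rw [← coe_pathFacet, hFGσ C hC]
  · intro C hC k
    rw [pathPoints_label hv hw (hF C hC) (hG C hC) (hσ C hC), zero_add]

end Labelings

/-! ### The face complex of a single simplex -/

section Simplex

variable {ι : Type*} {a : ℕ}

theorem affineIndependent_of_homDet_ne_zero (e : Fin a ≃ ι) {v : Fin (a + 1) → ι → ℝ}
    (hv : homDet e v ≠ 0) : AffineIndependent ℝ v := by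
  classical
  rw [affineIndependent_iff]
  intro s w hw hz i hi
  have hc : (fun i => if i ∈ s then w i else 0) = 0 := by
    apply Matrix.eq_zero_of_vecMul_eq_zero hv
    ext j
    refine Fin.cases ?_ (fun k => ?_) j
    · simpa [Matrix.vecMul, dotProduct, Finset.sum_ite_mem] using hw
    · have := congrFun hz (e k)
      simpa [Matrix.vecMul, dotProduct, Finset.sum_ite_mem] using this
  simpa [hi] using congrFun hc i

variable [Fintype ι]

/-- The faces of a simplex. -/
theorem isSupportedComplex_simplex {S : Finset (ι → ℝ)}
    (hS : AffineIndependent ℝ ((↑) : S → (ι → ℝ))) (hne : S.Nonempty) :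
    IsSupportedComplex (convexHull ℝ (S : Set (ι → ℝ))) {F | F.Nonempty ∧ F ⊆ S} 0 := by
  have hV : vertexSet {F : Finset (ι → ℝ) | F.Nonempty ∧ F ⊆ S} = S := by
    ext x
    simp [vertexSet]
  refine ⟨?_, fun F hF => hF.1, fun F hF G hG hG' => ⟨hG', hG.trans hF.2⟩,
    fun F hF => hS.mono hF.2, fun x => ⟨fun hx => ⟨S, ⟨hne, subset_rfl⟩, hx⟩, ?_⟩,
    convex_convexHull ℝ _, fun F hF => ?_⟩
  · exact S.powerset.finite_toSet.subset fun F hF => Finset.mem_coe.2 (Finset.mem_powerset.2 hF.2)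
  · rintro ⟨F, hF, hx⟩
    exact convexHull_mono (Finset.coe_subset.2 hF.2) hx
  · rw [hV]
    exact exists_support_subset S.finite_toSet (h := 0) (a := 0) hS hF.2 (by simp) (by simp)

end Simplex

/-! ### Standard simplices and the signature of the staircase triangulation -/

section Standard

variable (m : ℕ)

theorem stdVertex_eq : stdVertex m = stdPoint (Equiv.refl (Fin m)) := rfl

theorem affineIndependent_stdVertex : AffineIndependent ℝ (stdVertex m) := by
  refine affineIndependent_of_homDet_ne_zero (Equiv.refl (Fin m)) ?_
  rw [stdVertex_eq, homDet_stdPoint]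
  exact one_ne_zero

theorem stdVertex_injective : Function.Injective (stdVertex m) :=
  (affineIndependent_stdVertex m).injective

/-- The vertex set of the standard simplex. -/
def stdVertices : Finset (Fin m → ℝ) :=
  Finset.univ.map ⟨stdVertex m, stdVertex_injective m⟩

theorem coe_stdVertices : (stdVertices m : Set (Fin m → ℝ)) = Set.range (stdVertex m) := by
  simp [stdVertices]

theorem stdSimplexComplex_eq :
    stdSimplexComplex m = {F | F.Nonempty ∧ F ⊆ stdVertices m} := by
  ext F
  rw [stdSimplexComplex, ← coe_stdVertices]
  simp

theorem stdVertices_nonempty : (stdVertices m).Nonempty := by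
  simp [stdVertices]

theorem isSupportedComplex_std :
    IsSupportedComplex (convexHull ℝ (stdVertices m : Set (Fin m → ℝ))) (stdSimplexComplex m) 0 := by
  rw [stdSimplexComplex_eq]
  refine isSupportedComplex_simplex ?_ (stdVertices_nonempty m)
  have := (affineIndependent_stdVertex m).range
  rw [← coe_stdVertices] at this
  exact this

theorem affineSpan_std :
    affineSpan ℝ (convexHull ℝ (stdVertices m : Set (Fin m → ℝ))) = ⊤ := by
  rw [affineSpan_convexHull, coe_stdVertices,
    (affineIndependent_stdVertex m).affineSpan_eq_top_iff_card_eq_finrank_add_one]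
  simp

theorem facets_std : facets (stdSimplexComplex m) = {stdVertices m} := by
  rw [stdSimplexComplex_eq]
  ext F
  simp only [Set.mem_singleton_iff]
  constructor
  · intro hF
    exact hF.2 _ ⟨stdVertices_nonempty m, subset_rfl⟩ hF.1.2
  · rintro rfl
    exact ⟨⟨stdVertices_nonempty m, subset_rfl⟩, fun G hG h => le_antisymm h hG.2⟩

theorem stdOrdering_stdVertex (i : Fin (m + 1)) : stdOrdering m (stdVertex m i) = i := by
  rw [stdOrdering, Function.leftInverse_invFun (stdVertex_injective m)]

theorem isLabeling_std :
    IsLabeling (stdSimplexComplex m) (stdOrdering m) (fun _ => stdVertex m) fun _ => 0 := by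
  constructor
  · intro F hF
    rw [facets_std] at hF
    rw [Set.mem_singleton_iff.1 hF, coe_stdVertices]
  · intro F _ j
    rw [stdOrdering_stdVertex, zero_add]

theorem mem_vertexSet_std {x : Fin m → ℝ} (hx : x ∈ vertexSet (stdSimplexComplex m)) :
    ∃ i, stdVertex m i = x := by
  have := hx.2
  simpa using this

theorem injOn_stdOrdering : Set.InjOn (stdOrdering m) (vertexSet (stdSimplexComplex m)) := by
  intro x hx y hy hxy
  obtain ⟨i, rfl⟩ := mem_vertexSet_std m hx
  obtain ⟨j, rfl⟩ := mem_vertexSet_std m hy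
  rw [stdOrdering_stdVertex, stdOrdering_stdVertex] at hxy
  rw [Fin.ext hxy]

theorem isLatticePoint_std {x : Fin m → ℝ} (hx : x ∈ vertexSet (stdSimplexComplex m)) :
    IsLatticePoint x := by
  obtain ⟨i, rfl⟩ := mem_vertexSet_std m hx
  exact isLatticePoint_stdPoint (Equiv.refl (Fin m)) i

/-- The product formula applied to two single facets of determinant 1 with labels starting at 0:
only the sum over staircases remains. -/
theorem staircaseSignature_eq (n : ℕ) : staircaseSignature m n =
    (∑ σ ∈ staircases m n, oddSign (homDet (sumCoord (Equiv.refl (Fin m)) (Equiv.refl (Fin n)))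
      (pathPoints (stdPoint (Equiv.refl (Fin m))) (stdPoint (Equiv.refl (Fin n))) σ))).natAbs := by
  obtain ⟨H, hH⟩ := exists_isSupportedComplex_simplicialProduct (isSupportedComplex_std m)
    (isSupportedComplex_std n) (injOn_stdOrdering m) (injOn_stdOrdering n)
  rw [staircaseSignature, staircaseTriangulation, signature_simplicialProduct
    (Equiv.refl (Fin m)) (Equiv.refl (Fin n)) (isSupportedComplex_std m) (isSupportedComplex_std n)
    (affineSpan_std m) (affineSpan_std n) hH (isLabeling_std m) (isLabeling_std n)
    (fun _ _ _ _ _ _ => Iff.rfl) (fun _ _ _ _ _ _ => Iff.rfl)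
    (fun x hx => isLatticePoint_std m hx) (fun x hx => isLatticePoint_std n hx)]
  have h1 : ∀ k, homDet (Equiv.refl (Fin k)) (stdVertex k) = 1 := fun k => by
    rw [stdVertex_eq, homDet_stdPoint]
  have h2 : ∀ k (hf : (facets (stdSimplexComplex k)).Finite), hf.toFinset = {stdVertices k} := by
    intro k hf
    ext F
    rw [hf.mem_toFinset, facets_std]
    simp
  rw [h2, h2, Finset.sum_singleton, Finset.sum_singleton, h1, h1, oddSign_one]
  simp

end Standard

/-! ### Regularity and labelings of the two-simplex bipyramid -/

section Bipyramid

open Filter Topology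

variable {ι : Type*} [Fintype ι] {n : ℕ} {Q : Set (ι → ℝ)} {B : Set (Finset (ι → ℝ))}
  {T : Finset (ι → ℝ)} {p q : ι → ℝ} {O : (ι → ℝ) → ℕ}

namespace IsBipyramidTriangulation

/-- A zero-dimensional space is a single point and has no room for two apices. -/
theorem base_nonempty (hB : IsBipyramidTriangulation Q B T p q) : T.Nonempty := by
  rw [← Finset.card_pos, hB.card_base, Fintype.card_pos_iff]
  by_contra hemp
  rw [not_nonempty_iff] at hemp
  exact hB.apices_ne (Subsingleton.elim p q)

theorem mem_vertexSet_iff (hB : IsBipyramidTriangulation Q B T p q) {x : ι → ℝ} :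
    x ∈ vertexSet B ↔ x = p ∨ x = q ∨ x ∈ T := by
  rw [vertexSet, hB.faces_eq]
  simp
  tauto

theorem left_mem (hB : IsBipyramidTriangulation Q B T p q) : insert p T ∈ B := by
  rw [hB.faces_eq]
  exact ⟨Finset.insert_nonempty _ _, Or.inl subset_rfl⟩

theorem right_mem (hB : IsBipyramidTriangulation Q B T p q) : insert q T ∈ B := by
  rw [hB.faces_eq]
  exact ⟨Finset.insert_nonempty _ _, Or.inr subset_rfl⟩

theorem left_notMem_right (hB : IsBipyramidTriangulation Q B T p q) : p ∉ insert q T := by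
  simp [hB.apices_ne, hB.left_notMem]

theorem right_notMem_left (hB : IsBipyramidTriangulation Q B T p q) : q ∉ insert p T := by
  simp [hB.apices_ne.symm, hB.right_notMem]

theorem facets_eq (hB : IsBipyramidTriangulation Q B T p q) :
    facets B = {insert p T, insert q T} := by
  have h1 := hB.left_notMem_right
  have h2 := hB.right_notMem_left
  ext F
  simp only [Set.mem_insert_iff, Set.mem_singleton_iff]
  constructor
  · rintro ⟨hF, hmax⟩
    have hF' := hF
    rw [hB.faces_eq] at hF'
    rcases hF'.2 with h | h
    · exact Or.inl (hmax _ hB.left_mem h)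
    · exact Or.inr (hmax _ hB.right_mem h)
  · rintro (rfl | rfl)
    · refine ⟨hB.left_mem, fun G hG hsub => ?_⟩
      rw [hB.faces_eq] at hG
      rcases hG.2 with h | h
      · exact le_antisymm hsub h
      · exact absurd (h (hsub (Finset.mem_insert_self _ _))) h1
    · refine ⟨hB.right_mem, fun G hG hsub => ?_⟩
      rw [hB.faces_eq] at hG
      rcases hG.2 with h | h
      · exact absurd (h (hsub (Finset.mem_insert_self _ _))) h2
      · exact le_antisymm hsub h

theorem affineIndependent (hB : IsBipyramidTriangulation Q B T p q) {F : Finset (ι → ℝ)}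
    (hF : F ∈ B) : AffineIndependent ℝ ((↑) : F → (ι → ℝ)) := by
  obtain ⟨-, S, rfl, -⟩ := hB.triangulation
  exact S.indep hF

theorem affineSpan_right (hB : IsBipyramidTriangulation Q B T p q) :
    affineSpan ℝ ((insert q T : Finset (ι → ℝ)) : Set (ι → ℝ)) = ⊤ := by
  have := (hB.affineIndependent hB.right_mem).affineSpan_eq_top_iff_card_eq_finrank_add_one.2
    (by rw [Fintype.card_coe, Finset.card_insert_of_notMem hB.right_notMem, hB.card_base]; simp)
  exact (congrArg (affineSpan ℝ) Subtype.range_coe).symm.trans this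

theorem affineSpan_eq_top (hB : IsBipyramidTriangulation Q B T p q) : affineSpan ℝ Q = ⊤ := by
  rw [eq_top_iff, ← hB.affineSpan_right]
  refine affineSpan_mono ℝ ?_
  have hm := hB.right_mem
  obtain ⟨-, S, rfl, rfl⟩ := hB.triangulation
  exact S.subset_space hm

theorem convex (hB : IsBipyramidTriangulation Q B T p q) : Convex ℝ Q := by
  obtain ⟨S, -, rfl⟩ := hB.latticePolytope
  exact convex_convexHull ℝ _

/-- The apices lie on different sides of the base. -/
theorem apply_left_neg (hB : IsBipyramidTriangulation Q B T p q) {l : (ι → ℝ) →ᵃ[ℝ] ℝ}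
    (hl : ∀ t ∈ T, l t = 0) (hlq : l q = 1) : l p < 0 := by
  -- Otherwise a point slightly off the relative interior of the base towards `p` lies in both
  -- simplices, hence in the base, although its barycentric coordinate at `p` is positive.
  by_contra! hlp
  let F := insert q T
  let b : AffineBasis F ℝ (ι → ℝ) := ⟨(↑), hB.affineIndependent hB.right_mem,
    (congrArg (affineSpan ℝ) Subtype.range_coe).trans hB.affineSpan_right⟩
  have hb : ∀ i, b i = i.1 := fun i => rfl
  have hbr : Set.range b = F := Subtype.range_coe
  have hlb : ∀ x, l x = b.coord ⟨q, Finset.mem_insert_self _ _⟩ x := fun x => by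
    rw [affineBasis_apply_eq_sum b l x, Finset.sum_eq_single ⟨q, Finset.mem_insert_self _ _⟩]
    · simp [hb, hlq]
    · intro i _ hi
      have : i.1 ∈ T := (Finset.mem_insert.1 i.2).resolve_left fun e => hi (Subtype.ext e)
      rw [hb, hl _ this, mul_zero]
    · simp
  obtain ⟨x, hx, hx'⟩ := exists_relativeInterior_point hB.base_nonempty
  have hpos : ∀ i : F, i.1 ∈ T → 0 < b.coord i x := by
    intro i hi
    by_contra! hle
    have := hx' (AffineMap.const ℝ _ 0) (b.coord i) (fun v hv => ?_) (by simpa using hle) i.1 hi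
    · have h1 := b.coord_apply_eq i
      rw [hb] at h1
      rw [h1] at this
      simp at this
    · have h1 := b.coord_apply i ⟨v, Finset.mem_insert_of_mem hv⟩
      rw [hb] at h1
      rw [h1]
      split_ifs <;> simp
  have hlx : l x = 0 := by
    have hle := affineMap_le_of_mem_convexHull (f := l) (g := AffineMap.const ℝ _ 0)
      (fun w hw => (hl w hw).le) hx
    have hge := affineMap_le_of_mem_convexHull (g := l) (f := AffineMap.const ℝ _ 0)
      (fun w hw => (hl w hw).ge) hx
    exact le_antisymm (by simpa using hle) (by simpa using hge)
  have hev : ∀ᶠ t in 𝓝[>] (0 : ℝ), ∀ i : F, i.1 ∈ T → 0 < b.coord i (AffineMap.lineMap x p t) := by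
    rw [eventually_all]
    intro i
    by_cases hi : i.1 ∈ T
    · have hlim : Tendsto (fun t : ℝ => b.coord i (AffineMap.lineMap x p t)) (𝓝[>] 0)
          (𝓝 (b.coord i (AffineMap.lineMap x p (0 : ℝ)))) := by
        apply Tendsto.mono_left _ nhdsWithin_le_nhds
        simp only [AffineMap.apply_lineMap]
        exact AffineMap.lineMap_continuous.tendsto 0
      rw [AffineMap.lineMap_apply_zero] at hlim
      filter_upwards [hlim.eventually_const_lt (hpos i hi)] with t ht _ using ht
    · simp [hi]
  obtain ⟨t, ht, ht0, ht1⟩ := (hev.and (Ioo_mem_nhdsGT (one_pos : (0 : ℝ) < 1))).exists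
  have hyF : AffineMap.lineMap x p t ∈ convexHull ℝ ((insert q T : Finset _) : Set (ι → ℝ)) := by
    change _ ∈ convexHull ℝ (F : Set (ι → ℝ))
    rw [← hbr, b.convexHull_eq_nonneg_coord]
    intro i
    by_cases hi : i.1 ∈ T
    · exact (ht i hi).le
    · have : i = ⟨q, Finset.mem_insert_self _ _⟩ :=
        Subtype.ext ((Finset.mem_insert.1 i.2).resolve_right hi)
      rw [this, ← hlb, AffineMap.apply_lineMap, hlx, AffineMap.lineMap_apply]
      simp only [vsub_eq_sub, sub_zero, smul_eq_mul, vadd_eq_add, add_zero]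
      positivity
  have hyG : AffineMap.lineMap x p t ∈ convexHull ℝ ((insert p T : Finset _) : Set (ι → ℝ)) := by
    refine (convex_convexHull ℝ _).lineMap_mem ?_ ?_ ⟨ht0.le, ht1.le⟩
    · exact convexHull_mono (by simp) hx
    · exact subset_convexHull ℝ _ (by simp)
  have hyT : AffineMap.lineMap x p t ∈ convexHull ℝ (T : Set (ι → ℝ)) := by
    have hl := hB.left_mem
    have hr := hB.right_mem
    obtain ⟨-, S, rfl, -⟩ := hB.triangulation
    refine convexHull_mono ?_ (S.inter_subset_convexHull hr hl ⟨hyF, hyG⟩)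
    rintro y ⟨hy1, hy2⟩
    rw [Finset.mem_coe, Finset.mem_insert] at hy1 hy2
    rcases hy2 with rfl | hy2
    · rcases hy1 with h | h
      · exact absurd h hB.apices_ne
      · exact h
    · exact hy2
  obtain ⟨f, hf⟩ := exists_affineMap_eq (hB.affineIndependent hB.left_mem)
    fun v => if v = p then 1 else 0
  have hfT : ∀ v ∈ T, f v = 0 := fun v hv => by
    rw [hf v (Finset.mem_insert_of_mem hv), if_neg]
    rintro rfl
    exact hB.left_notMem hv
  have hfp : f p = 1 := by rw [hf p (Finset.mem_insert_self _ _), if_pos rfl]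
  have hfx : 0 ≤ f x := by
    simpa using affineMap_le_of_mem_convexHull (g := f) (f := AffineMap.const ℝ _ 0)
      (fun w hw => (hfT w hw).ge) hx
  have hfy : f (AffineMap.lineMap x p t) ≤ 0 := by
    simpa using affineMap_le_of_mem_convexHull (f := f) (g := AffineMap.const ℝ _ 0)
      (fun w hw => (hfT w hw).le) hyT
  rw [AffineMap.apply_lineMap, hfp, AffineMap.lineMap_apply] at hfy
  simp only [vsub_eq_sub, smul_eq_mul, vadd_eq_add] at hfy
  nlinarith

/-- Regularity is automatic: with `l` the barycentric coordinate of `q`, fold along the base by the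
heights max(0, l). The function 0 supports the simplex at `p` and `l` the one at `q`; subfaces
follow by perturbation. -/
theorem exists_isSupportedComplex (hB : IsBipyramidTriangulation Q B T p q) :
    ∃ h, IsSupportedComplex Q B h := by
  obtain ⟨l, hl⟩ := exists_affineMap_eq (hB.affineIndependent hB.right_mem)
    fun v => if v = q then 1 else 0
  have hlT : ∀ v ∈ T, l v = 0 := fun v hv => by
    rw [hl v (Finset.mem_insert_of_mem hv), if_neg]
    rintro rfl
    exact hB.right_notMem hv
  have hlq : l q = 1 := by rw [hl q (Finset.mem_insert_self _ _), if_pos rfl]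
  have hlp := hB.apply_left_neg hlT hlq
  have hVfin : (vertexSet B).Finite := by
    refine (insert p (insert q T)).finite_toSet.subset fun x hx => ?_
    have := hB.mem_vertexSet_iff.1 hx
    simpa using this
  have hsupp : ∀ F ∈ B, ∃ a : (ι → ℝ) →ᵃ[ℝ] ℝ, (∀ v ∈ vertexSet B, a v ≤ max 0 (l v)) ∧
      ∀ v ∈ vertexSet B, (a v = max 0 (l v) ↔ v ∈ F) := by
    intro F hF
    have hF' := hF
    rw [hB.faces_eq] at hF'
    rcases hF'.2 with hsub | hsub
    · refine exists_support_subset hVfin (h := fun v => max 0 (l v)) (a := 0)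
        (hB.affineIndependent hB.left_mem) hsub (fun v _ => by simp) fun v hv => ?_
      rcases hB.mem_vertexSet_iff.1 hv with rfl | rfl | hv
      · simp [hlp.le]
      · simp [hlq, hB.apices_ne.symm, hB.right_notMem]
      · simp [hlT v hv, hv]
    · refine exists_support_subset hVfin (h := fun v => max 0 (l v)) (a := l)
        (hB.affineIndependent hB.right_mem) hsub (fun v _ => by simp) fun v hv => ?_
      rcases hB.mem_vertexSet_iff.1 hv with rfl | rfl | hv
      · simp [hlp, hB.apices_ne, hB.left_notMem]
      · simp [hlq]
      · simp [hlT v hv, hv]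
  have hconv := hB.convex
  refine ⟨fun v => max 0 (l v), ?_⟩
  obtain ⟨hfin, S, rfl, rfl⟩ := hB.triangulation
  exact ⟨hfin, fun F hF => S.nonempty_of_mem_faces hF, fun F hF G hG hG' =>
    S.down_closed hF hG hG', fun F hF => S.indep hF, fun x =>
    Geometry.SimplicialComplex.mem_space_iff, hconv, hsupp⟩

open Classical in
/-- The labels of the vertices in a symmetric ordering. -/
def _root_.RDF.symmetricLabel (T : Finset (ι → ℝ)) (p q : ι → ℝ) (O : (ι → ℝ) → ℕ)
    (x : ι → ℝ) : ℕ :=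
  if x = p then 0 else if x = q then T.card + 1 else 1 + (T.filter fun t => O t < O x).card

theorem symmetricLabel_base (hB : IsBipyramidTriangulation Q B T p q) {x : ι → ℝ} (hx : x ∈ T) :
    1 ≤ symmetricLabel T p q O x ∧ symmetricLabel T p q O x ≤ T.card := by
  classical
  have h1 : x ≠ p := fun e => hB.left_notMem (e ▸ hx)
  have h2 : x ≠ q := fun e => hB.right_notMem (e ▸ hx)
  rw [symmetricLabel, if_neg h1, if_neg h2]
  refine ⟨by omega, ?_⟩
  have : (T.filter fun t => O t < O x).card < T.card :=
    Finset.card_lt_card (Finset.filter_ssubset.2 ⟨x, hx, by simp⟩)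
  convert! (show 1 + (T.filter fun t => O t < O x).card ≤ T.card by omega) using 2

theorem symmetricLabel_left : symmetricLabel T p q O p = 0 := by
  simp [symmetricLabel]

theorem symmetricLabel_right (hB : IsBipyramidTriangulation Q B T p q) :
    symmetricLabel T p q O q = T.card + 1 := by
  simp [symmetricLabel, hB.apices_ne.symm]

theorem symmetricLabel_lt (hB : IsBipyramidTriangulation Q B T p q)
    (hO : IsSymmetricOrdering T p q O) {x y : ι → ℝ} (hx : x ∈ vertexSet B) (hy : y ∈ vertexSet B)
    (hxy : O x < O y) : symmetricLabel T p q O x < symmetricLabel T p q O y := by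
  classical
  obtain ⟨t, ht⟩ := hB.base_nonempty
  have hpq := (hO t ht).1.trans (hO t ht).2
  have hq := hB.symmetricLabel_right (O := O)
  have hp : symmetricLabel T p q O p = 0 := symmetricLabel_left
  rcases hB.mem_vertexSet_iff.1 hx with rfl | rfl | hxT <;>
    rcases hB.mem_vertexSet_iff.1 hy with rfl | rfl | hyT
  · exact absurd hxy (lt_irrefl _)
  · omega
  · have := hB.symmetricLabel_base (O := O) hyT
    omega
  · omega
  · exact absurd hxy (lt_irrefl _)
  · have := (hO y hyT).2
    omega
  · have := (hO x hxT).1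
    omega
  · have := hB.symmetricLabel_base (O := O) hxT
    omega
  · have h1 : x ≠ p := fun e => hB.left_notMem (e ▸ hxT)
    have h2 : x ≠ q := fun e => hB.right_notMem (e ▸ hxT)
    have h3 : y ≠ p := fun e => hB.left_notMem (e ▸ hyT)
    have h4 : y ≠ q := fun e => hB.right_notMem (e ▸ hyT)
    rw [symmetricLabel, symmetricLabel, if_neg h1, if_neg h2, if_neg h3, if_neg h4]
    refine Nat.add_lt_add_left (Finset.card_lt_card ?_) 1
    rw [Finset.ssubset_iff_of_subset]
    · exact ⟨x, by simp [hxT, hxy], by simp⟩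
    · intro u hu
      rw [Finset.mem_filter] at hu ⊢
      exact ⟨hu.1, hu.2.trans hxy⟩

theorem isOrderLabeling_symmetricLabel (hB : IsBipyramidTriangulation Q B T p q)
    (hOB : IsVertexOrdering B O) (hO : IsSymmetricOrdering T p q O) :
    IsOrderLabeling B O (symmetricLabel T p q O) ∧
      ∀ F ∈ B, Set.InjOn (symmetricLabel T p q O) F := by
  obtain ⟨h, hS⟩ := hB.exists_isSupportedComplex
  have hV : ∀ F ∈ B, ∀ x ∈ F, x ∈ vertexSet B := fun F hF x hx => hS.mem_vertexSet hF hx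
  constructor
  · intro F hF x hx y hy
    constructor
    · intro hxy
      rcases hxy.eq_or_lt with heq | hlt
      · rw [hOB (hV F hF x hx) (hV F hF y hy) heq]
      · exact (hB.symmetricLabel_lt hO (hV F hF x hx) (hV F hF y hy) hlt).le
    · intro hxy
      by_contra! hlt
      exact absurd hxy (hB.symmetricLabel_lt hO (hV F hF y hy) (hV F hF x hx) hlt).not_ge
  · intro F hF x hx y hy hxy
    by_contra hne
    rcases lt_trichotomy (O x) (O y) with hlt | heq | hlt
    · exact (hB.symmetricLabel_lt hO (hV F hF x hx) (hV F hF y hy) hlt).ne hxy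
    · exact hne (hOB (hV F hF x hx) (hV F hF y hy) heq)
    · exact (hB.symmetricLabel_lt hO (hV F hF y hy) (hV F hF x hx) hlt).ne' hxy

open Classical in
/-- The smallest label of a facet in a symmetric ordering. -/
def _root_.RDF.symmetricShift (p : ι → ℝ) (F : Finset (ι → ℝ)) : ℕ :=
  if p ∈ F then 0 else 1

/-- The labels are 0 at `p`, 1 to n on the base and n + 1 at `q`. So the simplex at `p` uses 0 to n,
and the one at `q` uses 1 to n + 1. -/
theorem exists_isLabeling_symmetric (hB : IsBipyramidTriangulation Q B T p q) (e : Fin n ≃ ι)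
    (hOB : IsVertexOrdering B O) (hO : IsSymmetricOrdering T p q O) :
    ∃ w : Finset (ι → ℝ) → Fin (n + 1) → ι → ℝ,
      IsLabeling B (symmetricLabel T p q O) w (symmetricShift p) := by
  obtain ⟨h, hS⟩ := hB.exists_isSupportedComplex
  have hcard : T.card = n := by
    rw [hB.card_base, ← Fintype.card_congr e, Fintype.card_fin]
  refine hS.exists_isLabeling hB.affineSpan_eq_top e ?_ fun F hF =>
    (hB.isOrderLabeling_symmetricLabel hOB hO).2 F hF.1
  intro F hF x hx
  rw [hB.facets_eq] at hF
  rcases hF with rfl | rfl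
  · rw [symmetricShift, if_pos (Finset.mem_insert_self _ _)]
    rcases Finset.mem_insert.1 hx with rfl | hx
    · rw [symmetricLabel_left]; omega
    · have := hB.symmetricLabel_base (O := O) hx
      omega
  · rw [symmetricShift, if_neg hB.left_notMem_right]
    rcases Finset.mem_insert.1 hx with rfl | hx
    · rw [hB.symmetricLabel_right]; omega
    · have := hB.symmetricLabel_base (O := O) hx
      omega

theorem sum_facets (hB : IsBipyramidTriangulation Q B T p q) (hfin : (facets B).Finite)
    (f : Finset (ι → ℝ) → ℤ) :
    ∑ G ∈ hfin.toFinset, f G = f (insert p T) + f (insert q T) := by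
  classical
  have hne : insert p T ≠ insert q T := fun e =>
    hB.left_notMem_right (e ▸ Finset.mem_insert_self p T)
  have : hfin.toFinset = {insert p T, insert q T} := by
    ext F
    rw [hfin.mem_toFinset, hB.facets_eq]
    simp
  rw [this, Finset.sum_pair hne]

theorem adj (hB : IsBipyramidTriangulation Q B T p q) :
    (dualGraph B).Adj ⟨insert p T, by rw [hB.facets_eq]; simp⟩
      ⟨insert q T, by rw [hB.facets_eq]; simp⟩ := by
  have h1 : insert p T \ insert q T = {p} := by
    ext x
    have := hB.left_notMem_right
    have := hB.left_notMem
    simp only [Finset.mem_sdiff, Finset.mem_insert, Finset.mem_singleton] at *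
    constructor
    · tauto
    · rintro rfl; tauto
  have h2 : insert q T \ insert p T = {q} := by
    ext x
    have := hB.right_notMem_left
    have := hB.right_notMem
    simp only [Finset.mem_sdiff, Finset.mem_insert, Finset.mem_singleton] at *
    constructor
    · tauto
    · rintro rfl; tauto
  exact ⟨by rw [h1]; rfl, by rw [h2]; rfl⟩

open Classical in
theorem oddFacetCount_eq (hB : IsBipyramidTriangulation Q B T p q) :
    oddFacetCount B = (if IsOddSimplex (insert p T) then 1 else 0) +
      if IsOddSimplex (insert q T) then 1 else 0 := by
  have hne : insert p T ≠ insert q T := fun e =>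
    hB.left_notMem_right (e ▸ Finset.mem_insert_self p T)
  have : {F | F ∈ facets B ∧ IsOddSimplex F} =
      (({insert p T, insert q T} : Finset (Finset (ι → ℝ))).filter IsOddSimplex : Finset _) := by
    rw [hB.facets_eq]
    ext F
    simp
  rw [oddFacetCount, this, Set.ncard_coe_finset, Finset.card_filter, Finset.sum_pair hne]

end IsBipyramidTriangulation

end Bipyramid

/-! ### The product with a labeled bipyramid -/

section Main

variable {m n : ℕ} {P : Set (Fin m → ℝ)} {K : Set (Finset (Fin m → ℝ))} {OK : (Fin m → ℝ) → ℕ}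
  {Q : Set (Fin n → ℝ)} {B : Set (Finset (Fin n → ℝ))} {OB : (Fin n → ℝ) → ℕ}
  {T : Finset (Fin n → ℝ)} {p q : Fin n → ℝ}

theorem IsRDFTriangulation.exists_isSupportedComplex (hK : IsRDFTriangulation P K) :
    ∃ h, IsSupportedComplex P K h := by
  refine RDF.exists_isSupportedComplex ?_ hK.triangulation hK.regular
  obtain ⟨S, -, rfl⟩ := hK.latticePolytope
  exact convex_convexHull ℝ _

/-- The simplicial product with a bipyramid whose vertices are suitably labeled. -/
theorem isRDFTriangulation_and_signature (hK : IsRDFTriangulation P K)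
    (hOK : IsVertexOrdering K OK) (hcc : IsColorConsecutive K OK)
    (hB : IsBipyramidTriangulation Q B T p q) (hOB : IsVertexOrdering B OB)
    {h : (Fin n → ℝ) → ℝ} (hS : IsSupportedComplex Q B h)
    {d : (Fin n → ℝ) → ℕ} {w : Finset (Fin n → ℝ) → Fin (n + 1) → Fin n → ℝ}
    {s : Finset (Fin n → ℝ) → ℕ} (hw : IsLabeling B d w s) (hd : IsOrderLabeling B OB d) :
    IsRDFTriangulation (polytopeProduct P Q) (simplicialProduct K OK B OB) ∧
      signature (simplicialProduct K OK B OB) = staircaseSignature m n * signature K *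
        (∑ G ∈ hS.finite_facets.toFinset,
          (-1) ^ ((m + n) * s G) * oddSign (homDet (Equiv.refl (Fin n)) (w G))).natAbs := by
  obtain ⟨k, hSK⟩ := hK.exists_isSupportedComplex
  obtain ⟨H, hH⟩ := exists_isSupportedComplex_simplicialProduct hSK hS hOK hOB
  obtain ⟨c, hc, hca, hci⟩ := hcc.exists_isOrderLabeling hSK (Equiv.refl (Fin m))
  obtain ⟨v, hv⟩ := hSK.exists_isLabeling hK.fullDim (Equiv.refl (Fin m)) (d := c)
    (s := fun _ => 0) (fun F _ x _ => by simpa using hca x) fun F hF => hci F hF.1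
  -- In the signature formula, density serves only to make the determinants integers.
  have hKl : ∀ x ∈ vertexSet K, IsLatticePoint x := fun x hx => by
    rw [hK.dense] at hx
    exact hx.2
  have hBl : ∀ x ∈ vertexSet B, IsLatticePoint x := fun x hx => by
    rw [hB.dense] at hx
    exact hx.2
  refine ⟨⟨isLatticePolytope_polytopeProduct hK.latticePolytope hB.latticePolytope,
    affineSpan_polytopeProduct hK.fullDim hB.affineSpan_eq_top, hH.isTriangulation, hH.isRegular,
    isDense_simplicialProduct hK.dense hB.dense,
    isFoldable_simplicialProduct (Equiv.refl _) (Equiv.refl _) hSK hS hK.fullDim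
      hB.affineSpan_eq_top hH hv hw hc hd⟩, ?_⟩
  rw [signature_simplicialProduct (Equiv.refl _) (Equiv.refl _) hSK hS hK.fullDim
    hB.affineSpan_eq_top hH hv hw hc hd hKl hBl, staircaseSignature_eq,
    hSK.signature_eq_of_labeling hK.fullDim (Equiv.refl _) hv, Int.natAbs_mul, Int.natAbs_mul]
  simp only [mul_zero, pow_zero, one_mul]
  ring

/-- The signed count of the facets when neighboring facets are counted with equal signs. -/
theorem IsBipyramidTriangulation.natAbs_sum_of_odd (hB : IsBipyramidTriangulation Q B T p q)
    {h : (Fin n → ℝ) → ℝ} (hS : IsSupportedComplex Q B h) (hm : Odd m)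
    {d : (Fin n → ℝ) → ℕ} {w : Finset (Fin n → ℝ) → Fin (n + 1) → Fin n → ℝ}
    (hw : IsLabeling B d w (symmetricShift p)) :
    (∑ G ∈ hS.finite_facets.toFinset, (-1) ^ ((m + n) * symmetricShift p G) *
      oddSign (homDet (Equiv.refl (Fin n)) (w G))).natAbs = oddFacetCount B := by
  classical
  have hneg := hS.labeling_homDet_neg hB.affineSpan_eq_top (Equiv.refl (Fin n)) hw hB.adj
  have hF1 : insert p T ∈ facets B := by rw [hB.facets_eq]; simp
  have hF2 : insert q T ∈ facets B := by rw [hB.facets_eq]; simp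
  have h1 : symmetricShift p (insert p T) = 0 := if_pos (Finset.mem_insert_self _ _)
  have h2 : symmetricShift p (insert q T) = 1 := if_neg hB.left_notMem_right
  have hv1 := normalizedVolume_eq_abs_homDet (Equiv.refl (Fin n)) (hw.range_eq _ hF1)
  have hv2 := normalizedVolume_eq_abs_homDet (Equiv.refl (Fin n)) (hw.range_eq _ hF2)
  rw [hB.sum_facets, hB.oddFacetCount_eq, h1, h2]
  simp only [h1, h2, mul_zero, pow_zero, one_mul, mul_one] at hneg ⊢
  generalize homDet (Equiv.refl (Fin n)) (w (insert p T)) = x at *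
  generalize homDet (Equiv.refl (Fin n)) (w (insert q T)) = y at *
  have hv2' : normalizedVolume (insert q T) = |(-1) ^ n * y| := by rw [hv2, abs_mul]; simp
  -- By `hneg`, `x` and (-1)^n·y have opposite signs. The extra (-1)^m = -1 reverses the second, so
  -- both odd simplices contribute with the same sign.
  have hy : (-1) ^ (m + n) * oddSign y = -oddSign ((-1) ^ n * y) := by
    rw [oddSign_neg_one_pow_mul, pow_add, hm.neg_one_pow]
    ring
  rw [hy, oddSign_eq hv1, oddSign_eq hv2']
  rcases mul_neg_iff.1 hneg with ⟨hx, hy⟩ | ⟨hx, hy⟩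
  · rw [sign_pos hx, sign_neg hy]
    split_ifs <;> simp
  · rw [sign_neg hx, sign_pos hy]
    split_ifs <;> simp

end Main

end RDF

end

/-! ### The proposition: color consecutive and symmetric orderings -/

theorem mainTheorem5 (m n : ℕ)
    (P : Set (Fin m → ℝ)) (K : Set (Finset (Fin m → ℝ))) (OK : (Fin m → ℝ) → ℕ)
    (hK : RDF.IsRDFTriangulation P K)
    (hOK : RDF.IsVertexOrdering K OK)
    (hcc : RDF.IsColorConsecutive K OK)
    (Q : Set (Fin n → ℝ)) (B : Set (Finset (Fin n → ℝ))) (OB : (Fin n → ℝ) → ℕ)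
    (T : Finset (Fin n → ℝ)) (p q : Fin n → ℝ)
    (hB : RDF.IsBipyramidTriangulation Q B T p q)
    (hOB : RDF.IsVertexOrdering B OB)
    (hord : RDF.IsColorConsecutive B OB ∨ RDF.IsSymmetricOrdering T p q OB) :
    RDF.IsRDFTriangulation (RDF.polytopeProduct P Q) (RDF.simplicialProduct K OK B OB) ∧
    (RDF.IsColorConsecutive B OB ∨ Even m →
      RDF.signature (RDF.simplicialProduct K OK B OB) =
        RDF.staircaseSignature m n * RDF.signature K * RDF.signature B) ∧
    (RDF.IsSymmetricOrdering T p q OB ∧ Odd m →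
      RDF.signature (RDF.simplicialProduct K OK B OB) =
        RDF.staircaseSignature m n * RDF.signature K * RDF.oddFacetCount B) := by
  obtain ⟨h, hS⟩ := hB.exists_isSupportedComplex
  have hcons : RDF.IsColorConsecutive B OB →
      RDF.IsRDFTriangulation (RDF.polytopeProduct P Q) (RDF.simplicialProduct K OK B OB) ∧
      RDF.signature (RDF.simplicialProduct K OK B OB) =
        RDF.staircaseSignature m n * RDF.signature K * RDF.signature B := by
    intro hBc
    obtain ⟨d, hd, hda, hdi⟩ := hBc.exists_isOrderLabeling hS (Equiv.refl (Fin n))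
    obtain ⟨w, hw⟩ := hS.exists_isLabeling hB.affineSpan_eq_top (Equiv.refl (Fin n)) (d := d)
      (s := fun _ => 0) (fun F _ x _ => by simpa using hda x) fun F hF => hdi F hF.1
    obtain ⟨h1, h2⟩ := RDF.isRDFTriangulation_and_signature hK hOK hcc hB hOB hS hw hd
    refine ⟨h1, ?_⟩
    rw [h2, hS.signature_eq_of_labeling hB.affineSpan_eq_top (Equiv.refl _) hw]
    simp only [mul_zero]
  have hsymm : RDF.IsSymmetricOrdering T p q OB →
      RDF.IsRDFTriangulation (RDF.polytopeProduct P Q) (RDF.simplicialProduct K OK B OB) ∧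
      (Even m → RDF.signature (RDF.simplicialProduct K OK B OB) =
        RDF.staircaseSignature m n * RDF.signature K * RDF.signature B) ∧
      (Odd m → RDF.signature (RDF.simplicialProduct K OK B OB) =
        RDF.staircaseSignature m n * RDF.signature K * RDF.oddFacetCount B) := by
    intro hBs
    obtain ⟨w, hw⟩ := hB.exists_isLabeling_symmetric (Equiv.refl (Fin n)) hOB hBs
    obtain ⟨h1, h2⟩ := RDF.isRDFTriangulation_and_signature hK hOK hcc hB hOB hS hw
      (hB.isOrderLabeling_symmetricLabel hOB hBs).1
    refine ⟨h1, fun hm => ?_, fun hm => ?_⟩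
    · rw [h2, hS.signature_eq_of_labeling hB.affineSpan_eq_top (Equiv.refl _) hw]
      -- For even `m` the factor (-1)^(m·s) is 1, leaving the exponent n·s of the signature of the
      -- bipyramid itself.
      simp only [add_mul, pow_add, (hm.mul_right _).neg_one_pow, one_mul]
    · rw [h2, hB.natAbs_sum_of_odd hS hm hw]
  refine ⟨hord.elim (fun h => (hcons h).1) fun h => (hsymm h).1, fun hcase => ?_,
    fun hcase => (hsymm hcase.1).2.2 hcase.2⟩
  rcases hord with hBc | hBs
  · exact (hcons hBc).2
  · exact hcase.elim (fun hBc => (hcons hBc).2) (hsymm hBs).2.1
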